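/- **Setting.** Let $(X,\omega)$ be a symplectic manifold of dimension $2n$ and let $L_0,\dots,L_k\subset X$ ($k\ge 2$) be Lagrangian submanifolds, with points $p_0\in L_k\cap L_0$ and $p_j\in L_{j-1}\cap L_j$ for $1\le j\le k$; put $p_{k+1}=p_0$, $L_{k+1}=L_0$. For a closed real 2-form $B$ on $X$, a *brane structure* on a Lagrangian $L$ is a Hermitian complex line bundle $\mathcal L$ on $L$ with a unitary connection $\nabla$ of curvature $F_\nabla=2\pi i\,B|_L$, where $F_\nabla(Y,Z)=[\nabla_Y,\nabla_Z]-\nabla_{[Y,Z]}$ (that is, $\nabla e=2\pi i\,\theta\, e$ with $d\theta=B|_L$ in a local unitary frame $e$); $\mathrm{Hol}_\nabla(\gamma)$ denotes $\nabla$-parallel transport along a path $\gamma$. A *polygon* $u$ consists of points $z_j=e^{i\theta_j}$ with $\theta_0<\theta_1<\dots<\theta_k<\theta_0+2\pi=:\theta_{k+1}$ and a piecewise smooth continuous map $u:\mathbb D\to X$ of finite area on the closed unit disc with $u(z_j)=p_j$, such that for each $j$ the restriction $\partial_ju$ of $u$ to the arc $\partial_j\mathbb D$ from $z_j$ to $z_{j+1}$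 is a piecewise smooth path of finite length in $L_j$ from $p_j$ to $p_{j+1}$. For inputs $\rho_j\in\mathrm{Hom}_{\mathbb C}((\mathcal L_{j-1})_{p_j},(\mathcal L_j)_{p_j})$, $1\le j\le k$, its *weight* is $$\rho(\rho_k,\dots,\rho_1;u)=e^{2\pi i\int_{\mathbb D}u^*(B+i\omega)}\,\mathrm{Hol}_{\nabla_k}(\partial_ku)\circ\rho_k\circ\mathrm{Hol}_{\nabla_{k-1}}(\partial_{k-1}u)\circ\cdots\circ\rho_1\circ\mathrm{Hol}_{\nabla_0}(\partial_0u)\in\mathrm{Hom}_{\mathbb C}((\mathcal L_0)_{p_0},(\mathcal L_k)_{p_0}).$$ Let $1\le m\le k-1$ and let $\psi:L_m\times[0,1]\to X$ be a Lagrangian isotopy: $(p,t)\mapsto(\psi_t(p),t)$ is a smooth embedding into $X\times[0,1]$, every $\psi_t(L_m)$ is Lagrangian, and $\psi_0$ is the inclusion. Assume $\gamma_m(t):=\psi(p_m,t)\in L_{m-1}$ and $\gamma_{m+1}(t):=\psi(p_{m+1},t)\in L_{m+1}$ for all $t\in[0,1]$. Let $L_m'=\psi_1(L_m)$, $p'_m=\gamma_m(1)$,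 $p'_{m+1}=\gamma_{m+1}(1)$. Write $\psi^*\omega=b_t\wedge dt$ and $\theta_\psi=\int_0^1b_t\,dt\in\Omega^1(L_m)$. *Gluing.* Let $R_2$ be the closed region of $\mathbb D$ between the arc $\partial_m\mathbb D$ and its chord, and $R_1=\overline{\mathbb D\setminus R_2}$. Let $\phi_1:R_1\to\mathbb D$ and $\phi_2:R_2\to\partial_m\mathbb D\times[0,1]$ be homeomorphisms that are diffeomorphisms between the interiors, such that $\phi_1$ is the identity on $R_1\cap\partial\mathbb D$ and maps the open chord diffeomorphically to the open arc; $\phi_2=(\phi_1,0)$ on the chord; and $\phi_2$ restricted to $\partial_m\mathbb D$ is a piecewise smooth path along the other three sides of $\partial_m\mathbb D\times[0,1]$, taking the trisection points $z_m'=e^{i(2\theta_m+\theta_{m+1})/3}$ and $z_{m+1}'=e^{i(\theta_m+2\theta_{m+1})/3}$ to $(z_m,1)$ and $(z_{m+1},1)$. Define $u'=u\circ\phi_1$ on $R_1$ and $u'(z)=\psi_t(\partial_mu(w))$ for $z\in R_2$, $\phi_2(z)=(w,t)$. **Theorem.** For every such $u$, $\psi$, $\phi_1$, $\phi_2$: 1.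 $u'$, with $z_m,z_{m+1}$ replaced by $z_m',z_{m+1}'$, is a polygon for $(L_0,\dots,L_{m-1},L_m',L_{m+1},\dots,L_k)$ and $(p_0,\dots,p_{m-1},p_m',p_{m+1}',p_{m+2},\dots,p_k)$. 2. The number $c=e^{2\pi\int_{\partial_m\mathbb D}(\partial_mu)^*\theta_\psi}$, which does not depend on $B$, has the following property. Let $B$ be any closed real 2-form on $X$, let $(\mathcal L_j,\nabla_j)$ be brane structures on the $L_j$, let $(\mathcal L_m',\nabla_m')$ be a line bundle with unitary connection on $L_m'$, and let $(\tilde{\mathcal L},\tilde\nabla)$ be a line bundle with unitary connection on $L_m\times[0,1]$ of curvature $2\pi i\,\psi^*B$ which restricts to $(\mathcal L_m,\nabla_m)$ at $t=0$ and to $\psi_1^*(\mathcal L'_m,\nabla'_m)$ at $t=1$. For inputs $\rho_1,\dots,\rho_k$ put $$\rho_m'=\mathrm{Hol}_{\tilde\nabla}(\gamma_m)\circ\rho_m\circ\mathrm{Hol}_{\nabla_{m-1}}(\gamma_m)^{-1},\qquad \rho_{m+1}'=\mathrm{Hol}_{\nabla_{m+1}}(\gamma_{m+1})\circ\rho_{m+1}\circ\mathrm{Hol}_{\tilde\nabla}(\gamma_{m+1})^{-1},$$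 where $\mathrm{Hol}_{\tilde\nabla}(\gamma_m)$, $\mathrm{Hol}_{\tilde\nabla}(\gamma_{m+1})$ are the transports along $t\mapsto(p_m,t)$, $t\mapsto(p_{m+1},t)$. Then $$\rho(\rho_k,\dots,\rho_{m+2},\rho'_{m+1},\rho'_m,\rho_{m-1},\dots,\rho_1;u')=c\cdot\rho(\rho_k,\dots,\rho_1;u).$$ -/

import Mathlib

open Set Bundle Function
open scoped Manifold ContDiff Topology

noncomputable section

namespace LagPolygon

/-! ### Differential forms on manifolds -/

section Forms

variable {E H : Type*} [NormedAddCommGroup E] [NormedSpace ℝ E] [TopologicalSpace H]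
  {E' H' : Type*} [NormedAddCommGroup E'] [NormedSpace ℝ E'] [TopologicalSpace H']

/-- Real differential forms of degree `d` on `M` (no regularity is imposed here). -/
abbrev Form (I : ModelWithCorners ℝ E H) (M : Type*) [TopologicalSpace M] [ChartedSpace H M]
    (d : ℕ) :=
  ∀ x : M, TangentSpace I x [⋀^Fin d]→L[ℝ] ℝ

variable {I : ModelWithCorners ℝ E H} {M : Type*} [TopologicalSpace M] [ChartedSpace H M]
  {I' : ModelWithCorners ℝ E' H'} {M' : Type*} [TopologicalSpace M'] [ChartedSpace H' M']
  {d : ℕ}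

/-- The expression of a form in the preferred chart at `x₀`, a form on the model space `E`. -/
def Form.inChart (β : Form I M d) (x₀ : M) (y : E) : E [⋀^Fin d]→L[ℝ] ℝ :=
  (β ((extChartAt I x₀).symm y)).compContinuousLinearMap
    (mfderivWithin 𝓘(ℝ, E) I (extChartAt I x₀).symm (range I) y)

/-- A form is smooth if it is smooth in all charts. -/
def Form.IsSmooth (β : Form I M d) : Prop :=
  ∀ x₀ : M, ContDiffOn ℝ ∞ (β.inChart x₀) (extChartAt I x₀).target

/-- A form is closed if its exterior derivative vanishes in all charts. -/
def Form.IsClosed (β : Form I M d) : Prop :=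
  ∀ x₀ : M, ∀ y ∈ (extChartAt I x₀).target, extDerivWithin (β.inChart x₀) (range I) y = 0

/-- The pullback `f^* β`. -/
def Form.pullback (I : ModelWithCorners ℝ E H) (f : M → M') (β : Form I' M' d) : Form I M d :=
  fun x => (β (f x)).compContinuousLinearMap (mfderiv I I' f x)

/-- A symplectic form: a smooth closed nondegenerate 2-form. -/
structure Form.IsSymplectic (Ω : Form I M 2) : Prop where
  smooth : Ω.IsSmooth
  closed : Ω.IsClosed
  nondegenerate : ∀ (x : M) (v : TangentSpace I x), (∀ w, Ω x ![v, w] = 0) → v = 0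

/-- The velocity vector `γ'(t)`. -/
def velocity (I : ModelWithCorners ℝ E H) (γ : ℝ → M) (t : ℝ) : TangentSpace I (γ t) :=
  mfderiv 𝓘(ℝ, ℝ) I γ t (1 : ℝ)

/-- `γ` restricted to `[a, b]` is a piecewise smooth path: it is continuous, smooth except at
finitely many parameters, and rectifiable, in the sense that every smooth 1-form is integrable
along it. -/
structure IsPiecewiseSmoothPath (I : ModelWithCorners ℝ E H) (γ : ℝ → M) (a b : ℝ) : Prop where
  continuousOn : ContinuousOn γ (Icc a b)
  smooth : ∃ S : Set ℝ, S.Finite ∧ ∀ t ∈ Ioo a b \ S, ContMDiffAt 𝓘(ℝ, ℝ) I ∞ γ t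
  rectifiable : ∀ α : Form I M 1, α.IsSmooth →
    IntervalIntegrable (fun t => α (γ t) ![velocity I γ t]) MeasureTheory.volume a b

/-- The density of `u^* σ` with respect to `dx ∧ dy`, for a map `u` defined on the disc. -/
def discDensity (σ : Form I M 2) (u : ℂ → M) (z : ℂ) : ℝ :=
  σ (u z) ![mfderiv 𝓘(ℝ, ℂ) I u z (1 : ℂ), mfderiv 𝓘(ℝ, ℂ) I u z Complex.I]

/-- The integral `∫_𝔻 u^* σ` over the unit disc oriented by its complex structure. -/
def discIntegral (σ : Form I M 2) (u : ℂ → M) : ℝ :=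
  ∫ z in Metric.ball (0 : ℂ) 1, discDensity σ u z

/-- `u` restricted to the closed unit disc is a piecewise smooth map: it is continuous, smooth in
the interior away from a relatively closed finite union of smooth arcs (possibly constant, i.e.
points), and of finite area, in the sense that the pullback of every smooth 2-form is
integrable. -/
structure IsPiecewiseSmoothDisc (I : ModelWithCorners ℝ E H) (u : ℂ → M) : Prop where
  continuousOn : ContinuousOn u (Metric.closedBall 0 1)
  smooth : ∃ (N : ℕ) (c : Fin N → ℝ → ℂ),
    (∀ i, ContDiffOn ℝ ∞ (c i) (Ioo 0 1)) ∧
    (∀ i, MapsTo (c i) (Ioo 0 1) (Metric.ball 0 1)) ∧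
    _root_.IsClosed ((⋃ i, c i '' Ioo 0 1) ∪ (Metric.ball 0 1)ᶜ) ∧
    ∀ z ∈ Metric.ball (0 : ℂ) 1 \ ⋃ i, c i '' Ioo 0 1, ContMDiffAt 𝓘(ℝ, ℂ) I ∞ u z
  finite_area : ∀ σ : Form I M 2, σ.IsSmooth →
    MeasureTheory.IntegrableOn (discDensity σ u) (Metric.ball 0 1)

end Forms

/-! ### Complex line bundles with unitary connection -/

section LineBundles

universe w

variable {E H : Type*} [NormedAddCommGroup E] [NormedSpace ℝ E] [TopologicalSpace H]
  {E' H' : Type*} [NormedAddCommGroup E'] [NormedSpace ℝ E'] [TopologicalSpace H']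

/-- The section `σ` of a bundle with fibre `ℂ` is smooth near `x`. -/
def SmoothSectionAt (I : ModelWithCorners ℝ E H) {M : Type*} [TopologicalSpace M]
    [ChartedSpace H M] {V : M → Type*} [TopologicalSpace (TotalSpace ℂ V)]
    [∀ x, TopologicalSpace (V x)] [FiberBundle ℂ V] (σ : ∀ x, V x) (x : M) : Prop :=
  ContMDiffAt I (I.prod 𝓘(ℝ, ℂ)) ∞ (fun y => TotalSpace.mk' ℂ y (σ y)) x

/-- A smooth complex line bundle on a real manifold, with a smooth Hermitian metric and a smooth
unitary connection. `cov σ x v` is `∇_v σ` at `x`. -/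
structure UnitaryLineBundle (I : ModelWithCorners ℝ E H) (M : Type*) [TopologicalSpace M]
    [ChartedSpace H M] [IsManifold I ∞ M] where
  fiber : M → Type w
  [normedAddCommGroup : ∀ x, NormedAddCommGroup (fiber x)]
  [innerProductSpace : ∀ x, InnerProductSpace ℂ (fiber x)]
  [topology : TopologicalSpace (TotalSpace ℂ fiber)]
  [fiberBundle : FiberBundle ℂ fiber]
  [complexVectorBundle : VectorBundle ℂ ℂ fiber]
  [realVectorBundle : VectorBundle ℝ ℂ fiber]
  [smoothBundle : ContMDiffVectorBundle ∞ ℂ fiber I]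
  smooth_metric : ∀ (σ τ : ∀ x, fiber x) (x : M), SmoothSectionAt I σ x → SmoothSectionAt I τ x →
    ContMDiffAt I 𝓘(ℝ, ℂ) ∞ (fun y => inner ℂ (σ y) (τ y)) x
  cov : CovariantDerivative I ℂ fiber
  [smooth_cov : CovariantDerivative.ContMDiffCovariantDerivative cov ∞]
  cov_complex_linear : ∀ (σ : ∀ x, fiber x) (x : M), SmoothSectionAt I σ x →
    ∀ v : TangentSpace I x, cov (fun y => Complex.I • σ y) x v = Complex.I • cov σ x v
  unitary : ∀ (σ τ : ∀ x, fiber x) (x : M), SmoothSectionAt I σ x → SmoothSectionAt I τ x →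
    ∀ v : TangentSpace I x,
      mfderiv I 𝓘(ℝ, ℂ) (fun y => inner ℂ (σ y) (τ y)) x v =
        inner ℂ (cov σ x v) (τ x) + inner ℂ (σ x) (cov τ x v)

attribute [instance] UnitaryLineBundle.normedAddCommGroup UnitaryLineBundle.innerProductSpace
  UnitaryLineBundle.topology UnitaryLineBundle.fiberBundle
  UnitaryLineBundle.complexVectorBundle UnitaryLineBundle.realVectorBundle
  UnitaryLineBundle.smoothBundle UnitaryLineBundle.smooth_cov

namespace UnitaryLineBundle

variable {I : ModelWithCorners ℝ E H} {M : Type*} [TopologicalSpace M]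
    [ChartedSpace H M] [IsManifold I ∞ M]
    {I' : ModelWithCorners ℝ E' H'} {M' : Type*} [TopologicalSpace M']
    [ChartedSpace H' M'] [IsManifold I' ∞ M']

/-- The curvature `F_∇(X, Y) σ = ∇_X ∇_Y σ - ∇_Y ∇_X σ - ∇_{[X, Y]} σ` at `x`. -/
def curvature (V : UnitaryLineBundle I M) (X Y : ∀ x : M, TangentSpace I x)
    (σ : ∀ x, V.fiber x) (x : M) : V.fiber x :=
  V.cov (fun y => V.cov σ y (Y y)) x (X x) - V.cov (fun y => V.cov σ y (X y)) x (Y x)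
    - V.cov σ x (VectorField.mlieBracket I X Y x)

/-- The curvature equation `F_∇ = 2πi β` for a real 2-form `β` on the base. In a local unitary frame
`e` with `∇ e = 2πi θ e` it reads `dθ = β`. For `β = B|_L` this is the sign for which
`exp (2πi ∫ u^* B) Hol_∇(∂u)` is unchanged when `∂u` moves inside `L`, the holonomy around the
boundary of a disc `D` in the base being `exp (-∫_D F_∇)`. -/
def HasCurvature (V : UnitaryLineBundle I M) (β : Form I M 2) : Prop :=
  ∀ (X Y : ∀ x : M, TangentSpace I x) (σ : ∀ x, V.fiber x) (x : M),
    CMDiffAt ∞ (T% X) x → CMDiffAt ∞ (T% Y) x → SmoothSectionAt I σ x →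
    V.curvature X Y σ x = (2 * Real.pi * Complex.I * (β x ![X x, Y x] : ℂ)) • σ x

/-- `s` is a horizontal (parallel) lift of the path `γ : [a, b] → M`: a continuous section along
`γ` which, for all but finitely many `t`, satisfies `D s / dt = 0`, where
`D (f • σ ∘ γ) / dt = f' • σ + f • ∇_{γ'} σ` for a local frame `σ`. -/
structure IsHorizontalLift (V : UnitaryLineBundle I M) (γ : ℝ → M) (a b : ℝ)
    (s : ℝ → TotalSpace ℂ V.fiber) : Prop where
  lift : ∀ t ∈ Icc a b, (s t).proj = γ t
  continuousOn : ContinuousOn s (Icc a b)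
  parallel : ∃ S : Set ℝ, S.Finite ∧ ∀ t ∈ Ioo a b \ S,
    ∃ (σ : ∀ x, V.fiber x) (f : ℝ → ℂ) (f' : ℂ),
      SmoothSectionAt I σ (γ t) ∧ σ (γ t) ≠ 0 ∧
      (∀ᶠ τ in 𝓝 t, s τ = ⟨γ τ, f τ • σ (γ τ)⟩) ∧
      HasDerivAt f f' t ∧
      f' • σ (γ t) + f t • V.cov σ (γ t) (velocity I γ t) = 0

/-- `T` is the parallel transport along `γ : [a, b] → M` from `x = γ a` to `y = γ b`. -/
def IsParallelTransport (V : UnitaryLineBundle I M) (γ : ℝ → M) (a b : ℝ) {x y : M}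
    (T : V.fiber x ≃ₗ[ℂ] V.fiber y) : Prop :=
  ∀ v : V.fiber x, ∃ s : ℝ → TotalSpace ℂ V.fiber, V.IsHorizontalLift γ a b s ∧
    s a = ⟨x, v⟩ ∧ s b = ⟨y, T v⟩

/-- Any two fibres of a line bundle are abstractly isomorphic (used only as a default value). -/
lemma nonempty_equiv (V : UnitaryLineBundle I M) (x y : M) :
    Nonempty (V.fiber x ≃ₗ[ℂ] V.fiber y) :=
  ⟨((trivializationAt ℂ V.fiber x).linearEquivAt ℂ x
      (FiberBundle.mem_baseSet_trivializationAt' x)).trans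
    ((trivializationAt ℂ V.fiber y).linearEquivAt ℂ y
      (FiberBundle.mem_baseSet_trivializationAt' y)).symm⟩

open Classical in
/-- The holonomy `Hol_∇(γ)`: the parallel transport along `γ : [a, b] → M` from the fibre over
`x = γ a` to the fibre over `y = γ b` (an arbitrary isomorphism if there is none). -/
def hol (V : UnitaryLineBundle I M) (γ : ℝ → M) (a b : ℝ) (x y : M) :
    V.fiber x ≃ₗ[ℂ] V.fiber y :=
  if h : ∃ T : V.fiber x ≃ₗ[ℂ] V.fiber y, V.IsParallelTransport γ a b T then h.choose
  else (V.nonempty_equiv x y).some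

/-- An identification `(𝓛, ∇) = f^* (𝓛', ∇')` of line bundles with connection. -/
structure PullbackIso (V : UnitaryLineBundle I M) (f : M → M') (V' : UnitaryLineBundle I' M') where
  equiv : ∀ x, V.fiber x ≃ₗ[ℂ] V'.fiber (f x)
  smooth : ∀ (σ : ∀ y, V'.fiber y) (x : M), SmoothSectionAt I' σ (f x) →
    SmoothSectionAt I (fun x => (equiv x).symm (σ (f x))) x
  cov_eq : ∀ (σ : ∀ y, V'.fiber y) (x : M), SmoothSectionAt I' σ (f x) → ∀ v : TangentSpace I x,
    V.cov (fun x => (equiv x).symm (σ (f x))) x v =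
      (equiv x).symm (V'.cov σ (f x) (mfderiv I I' f x v))

/-- The identity, read as a map between fibres of equal bundles over equal points. -/
def fiberCongr {V V' : UnitaryLineBundle I M} (hV : V = V') {x y : M} (hx : x = y) :
    V.fiber x ≃ₗ[ℂ] V'.fiber y := by
  subst hV hx
  exact LinearEquiv.refl ℂ _

end UnitaryLineBundle

end LineBundles

/-! ### Lagrangians and Lagrangian isotopies

A Lagrangian submanifold of the `2n`-dimensional manifold `X` is given by an `n`-manifold `M` and
its inclusion `ι : M → X`. -/

section Lagrangians

universe w

variable {n : ℕ} {X : Type*} [TopologicalSpace X]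
  [ChartedSpace (EuclideanSpace ℝ (Fin (2 * n))) X]
  {M : Type*} [TopologicalSpace M] [ChartedSpace (EuclideanSpace ℝ (Fin n)) M]

/-- `ι : M → X` is (the inclusion of) a Lagrangian submanifold. -/
structure IsLagrangian (Ω : Form (𝓡 (2 * n)) X 2) (ι : M → X) : Prop where
  embedding : Manifold.IsSmoothEmbedding (𝓡 n) (𝓡 (2 * n)) ∞ ι
  isotropic : Form.pullback (𝓡 n) ι Ω = 0

/-- `ψ : M × [0, 1] → X` is a Lagrangian isotopy which starts at the inclusion `ι`. -/
structure IsLagrangianIsotopy (Ω : Form (𝓡 (2 * n)) X 2) (ι : M → X)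
    (ψ : M × Icc (0 : ℝ) 1 → X) : Prop where
  track : Manifold.IsSmoothEmbedding ((𝓡 n).prod (𝓡∂ 1)) ((𝓡 (2 * n)).prod (𝓡∂ 1)) ∞
    (fun q : M × Icc (0 : ℝ) 1 => (ψ q, q.2))
  lagrangian : ∀ t, IsLagrangian Ω (fun p => ψ (p, t))
  src : ∀ p, ψ (p, 0) = ι p

/-- The velocity `∂ψ/∂t` at `(p, t)`. -/
def isotopyVelocity (ψ : M × Icc (0 : ℝ) 1 → X) (p : M) (t : ℝ) :
    TangentSpace (𝓡 (2 * n)) (ψ (p, projIcc 0 1 zero_le_one t)) :=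
  mfderivWithin 𝓘(ℝ, ℝ) (𝓡 (2 * n)) (fun τ : ℝ => ψ (p, projIcc 0 1 zero_le_one τ))
    (Icc 0 1) t (1 : ℝ)

/-- The 1-form `b_t` on `M` with `ψ^* Ω = b_t ∧ dt`, i.e. `b_t(v) = (ψ^* Ω)(v, ∂_t)`. -/
def isotopyForm (Ω : Form (𝓡 (2 * n)) X 2) (ψ : M × Icc (0 : ℝ) 1 → X) (t : ℝ) (p : M)
    (v : TangentSpace (𝓡 n) p) : ℝ :=
  Ω (ψ (p, projIcc 0 1 zero_le_one t))
    ![mfderiv (𝓡 n) (𝓡 (2 * n)) (fun q => ψ (q, projIcc 0 1 zero_le_one t)) p v,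
      isotopyVelocity ψ p t]

/-- The 1-form `θ_ψ = ∫₀¹ b_t dt` on `M`. -/
def thetaForm (Ω : Form (𝓡 (2 * n)) X 2) (ψ : M × Icc (0 : ℝ) 1 → X) (p : M)
    (v : TangentSpace (𝓡 n) p) : ℝ :=
  ∫ t in (0 : ℝ)..1, isotopyForm Ω ψ t p v

/-- An isotopy of line bundles with connection covering `ψ`: a bundle `(𝓛̃, ∇̃)` on `M × [0, 1]`
with `F_∇̃ = 2πi ψ^* B`, restricting to `V` at time `0` and to `W` at time `1`. Here `W` is the
bundle carried by `ψ₁(M)`, pulled back to `M` by `ψ₁`. -/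
structure BundleIsotopy [IsManifold (𝓡 n) ∞ M] (B : Form (𝓡 (2 * n)) X 2)
    (ψ : M × Icc (0 : ℝ) 1 → X) (V W : UnitaryLineBundle.{w} (𝓡 n) M) where
  bundle : UnitaryLineBundle.{w} ((𝓡 n).prod (𝓡∂ 1)) (M × Icc (0 : ℝ) 1)
  curvature : bundle.HasCurvature (Form.pullback ((𝓡 n).prod (𝓡∂ 1)) ψ B)
  atZero : V.PullbackIso (fun p => (p, (0 : Icc (0 : ℝ) 1))) bundle
  atOne : W.PullbackIso (fun p => (p, (1 : Icc (0 : ℝ) 1))) bundle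

/-- The holonomy of `∇̃` along the path `t ↦ (p, t)`, from `V_p` to `W_p`. -/
def BundleIsotopy.hol [IsManifold (𝓡 n) ∞ M] {B : Form (𝓡 (2 * n)) X 2}
    {ψ : M × Icc (0 : ℝ) 1 → X} {V W : UnitaryLineBundle (𝓡 n) M}
    (L : BundleIsotopy B ψ V W) (p : M) : V.fiber p ≃ₗ[ℂ] W.fiber p :=
  ((L.atZero.equiv p).trans
    (L.bundle.hol (fun t : ℝ => (p, projIcc 0 1 zero_le_one t)) 0 1 (p, 0) (p, 1))).trans
    (L.atOne.equiv p).symm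

end Lagrangians

/-! ### Polygons -/

section Polygons

variable {n k : ℕ} {X : Type*} [TopologicalSpace X]
  [ChartedSpace (EuclideanSpace ℝ (Fin (2 * n))) X]
  {M : Fin (k + 1) → Type*} [∀ j, TopologicalSpace (M j)]
  [∀ j, ChartedSpace (EuclideanSpace ℝ (Fin n)) (M j)]

/-- A polygon with sides on the submanifolds `L_j = ι_j(M_j)`, `0 ≤ j ≤ k`, and corners
`p_j ∈ L_{j-1} ∩ L_j` (indices mod `k + 1`). The corner `p_j` is recorded as the point
`src j` of `M_j`, and `p_{j+1}` as the point `tgt j` of `M_j`. The marked points are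
`z_j = exp (i * angle j)`, in counterclockwise order. -/
structure PolygonMap (ι : ∀ j, M j → X) (src tgt : ∀ j, M j) where
  angle : Fin (k + 1) → ℝ
  angle_strictMono : StrictMono angle
  angle_last : angle (Fin.last k) < angle 0 + 2 * Real.pi
  toFun : ℂ → X
  piecewiseSmooth : IsPiecewiseSmoothDisc (𝓡 (2 * n)) toFun
  /-- The boundary path `∂_j u`, parametrized by the angle. -/
  side : ∀ j, ℝ → M j
  side_piecewiseSmooth : ∀ j, IsPiecewiseSmoothPath (𝓡 n) (side j) (angle j)
    (if j = Fin.last k then angle 0 + 2 * Real.pi else angle (j + 1))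
  side_spec : ∀ j, ∀ s ∈ Icc (angle j)
    (if j = Fin.last k then angle 0 + 2 * Real.pi else angle (j + 1)),
    ι j (side j s) = toFun (Complex.exp (s * Complex.I))
  side_src : ∀ j, side j (angle j) = src j
  side_tgt : ∀ j,
    side j (if j = Fin.last k then angle 0 + 2 * Real.pi else angle (j + 1)) = tgt j

namespace PolygonMap

variable {ι : ∀ j, M j → X} {src tgt : ∀ j, M j}

/-- The angle at which the `j`-th boundary arc ends. -/
def endAngle (P : PolygonMap (n := n) ι src tgt) (j : Fin (k + 1)) : ℝ :=
  if j = Fin.last k then P.angle 0 + 2 * Real.pi else P.angle (j + 1)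

variable [∀ j, IsManifold (𝓡 n) ∞ (M j)]

/-- The holonomy `Hol_{∇_j}(∂_j u)`. -/
def sideHol (P : PolygonMap (n := n) ι src tgt) (V : ∀ j, UnitaryLineBundle (𝓡 n) (M j))
    (j : Fin (k + 1)) : (V j).fiber (src j) ≃ₗ[ℂ] (V j).fiber (tgt j) :=
  (V j).hol (P.side j) (P.angle j) (P.endAngle j) (src j) (tgt j)

/-- The composition
`Hol_{∇_j}(∂_j u) ∘ ρ_j ∘ Hol_{∇_{j-1}}(∂_{j-1} u) ∘ ⋯ ∘ ρ_1 ∘ Hol_{∇_0}(∂_0 u)`,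
where the input `ρ_{i+1}` at the corner `p_{i+1}` is `ρ i`. -/
def chain (P : PolygonMap (n := n) ι src tgt) (V : ∀ j, UnitaryLineBundle (𝓡 n) (M j))
    (ρ : ∀ i : Fin k, (V i.castSucc).fiber (tgt i.castSucc) →ₗ[ℂ] (V i.succ).fiber (src i.succ))
    (j : Fin (k + 1)) : (V 0).fiber (src 0) →ₗ[ℂ] (V j).fiber (tgt j) :=
  Fin.induction
    (motive := fun j => (V 0).fiber (src 0) →ₗ[ℂ] (V j).fiber (tgt j))
    (P.sideHol V 0).toLinearMap
    (fun i T => (P.sideHol V i.succ).toLinearMap ∘ₗ ρ i ∘ₗ T) j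

/-- The weight `ρ(ρ_k, …, ρ_1; u) = exp (2πi ∫_𝔻 u^* (B + iΩ)) Hol(∂_k u) ∘ ρ_k ∘ ⋯ ∘ Hol(∂_0 u)`,
a linear map from the fibre of `𝓛_0` to the fibre of `𝓛_k` at the output corner `p_0`. -/
def weight (P : PolygonMap (n := n) ι src tgt) (Ω B : Form (𝓡 (2 * n)) X 2)
    (V : ∀ j, UnitaryLineBundle (𝓡 n) (M j))
    (ρ : ∀ i : Fin k,
      (V i.castSucc).fiber (tgt i.castSucc) →ₗ[ℂ] (V i.succ).fiber (src i.succ)) :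
    (V 0).fiber (src 0) →ₗ[ℂ] (V (Fin.last k)).fiber (tgt (Fin.last k)) :=
  Complex.exp (2 * Real.pi * Complex.I *
      (discIntegral B P.toFun + Complex.I * discIntegral Ω P.toFun)) •
    P.chain V ρ (Fin.last k)

/-- The integral `∫_{∂_j 𝔻} (∂_j u)^* θ` of a 1-form `θ` on `M_j`. -/
def sideIntegral (P : PolygonMap (n := n) ι src tgt) (j : Fin (k + 1))
    (θ : ∀ p : M j, TangentSpace (𝓡 n) p → ℝ) : ℝ :=
  ∫ s in (P.angle j)..(P.endAngle j), θ (P.side j s) (velocity (𝓡 n) (P.side j) s)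

end PolygonMap

end Polygons

/-! ### Gluing in the trace of the isotopy -/

section Gluing

/-- The closed region `R₁` of the unit disc cut off by the chord from `exp (iα)` to `exp (iβ)`,
opposite to the arc from `α` to `β`. -/
def mainRegion (α β : ℝ) : Set ℂ :=
  {z | ‖z‖ ≤ 1 ∧ (z * Complex.exp (-((α + β) / 2 : ℝ) * Complex.I)).re ≤ Real.cos ((β - α) / 2)}

/-- The closed region `R₂` of the unit disc bounded by the arc from `exp (iα)` to `exp (iβ)` and
its chord. -/
def segmentRegion (α β : ℝ) : Set ℂ :=
  {z | ‖z‖ ≤ 1 ∧ Real.cos ((β - α) / 2) ≤ (z * Complex.exp (-((α + β) / 2 : ℝ) * Complex.I)).re}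

/-- The point `(1 - s) exp (iα) + s exp (iβ)` of the chord. -/
def chordPoint (α β s : ℝ) : ℂ :=
  (1 - s) * Complex.exp (α * Complex.I) + s * Complex.exp (β * Complex.I)

/-- The pair of homeomorphisms `φ₁ : R₁ → 𝔻` and `φ₂ : R₂ → ∂_m 𝔻 × [0, 1]`, where the arc
`∂_m 𝔻` is identified with `[α, β]` by the angle. Both are diffeomorphisms in the interior; `φ₁`
fixes the rest of the circle and maps the open chord diffeomorphically to the open arc; `φ₂` agrees
with `(φ₁, 0)` on the chord, and maps the arc to the other three sides of the rectangle, the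
trisection points of the arc going to the corners at height `1`. The signs of the Jacobians
express that `φ₁` preserves and `φ₂` reverses the orientation (as they must by their boundary
behaviour), the rectangle being oriented by (angle, height). -/
structure GluingMaps (α β : ℝ) where
  φ₁ : ℂ → ℂ
  φ₁_cont : ContinuousOn φ₁ (mainRegion α β)
  φ₁_bij : BijOn φ₁ (mainRegion α β) (Metric.closedBall 0 1)
  φ₁_bij_interior : BijOn φ₁ (interior (mainRegion α β)) (Metric.ball 0 1)
  φ₁_smooth : ContDiffOn ℝ ∞ φ₁ (interior (mainRegion α β))
  φ₁_jacobian : ∀ z ∈ interior (mainRegion α β),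
    0 < (fderiv ℝ φ₁ z 1).re * (fderiv ℝ φ₁ z Complex.I).im -
      (fderiv ℝ φ₁ z Complex.I).re * (fderiv ℝ φ₁ z 1).im
  φ₁_circle : ∀ z ∈ mainRegion α β, ‖z‖ = 1 → φ₁ z = z
  /-- The angle of `φ₁` along the chord. -/
  η : ℝ → ℝ
  η_cont : ContinuousOn η (Icc 0 1)
  η_bij : BijOn η (Icc 0 1) (Icc α β)
  η_zero : η 0 = α
  η_one : η 1 = β
  η_smooth : ContDiffOn ℝ ∞ η (Ioo 0 1)
  η_deriv : ∀ s ∈ Ioo (0 : ℝ) 1, 0 < deriv η s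
  φ₁_chord : ∀ s ∈ Icc (0 : ℝ) 1, φ₁ (chordPoint α β s) = Complex.exp (η s * Complex.I)
  φ₂ : ℂ → ℝ × ℝ
  φ₂_cont : ContinuousOn φ₂ (segmentRegion α β)
  φ₂_bij : BijOn φ₂ (segmentRegion α β) (Icc α β ×ˢ Icc 0 1)
  φ₂_bij_interior : BijOn φ₂ (interior (segmentRegion α β)) (Ioo α β ×ˢ Ioo 0 1)
  φ₂_smooth : ContDiffOn ℝ ∞ φ₂ (interior (segmentRegion α β))
  φ₂_jacobian : ∀ z ∈ interior (segmentRegion α β),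
    (fderiv ℝ φ₂ z 1).1 * (fderiv ℝ φ₂ z Complex.I).2 -
      (fderiv ℝ φ₂ z Complex.I).1 * (fderiv ℝ φ₂ z 1).2 < 0
  φ₂_chord : ∀ s ∈ Icc (0 : ℝ) 1, φ₂ (chordPoint α β s) = (η s, 0)
  φ₂_arc : IsPiecewiseSmoothPath 𝓘(ℝ, ℝ × ℝ) (fun s : ℝ => φ₂ (Complex.exp (s * Complex.I))) α β
  φ₂_arc_left : ∀ s ∈ Icc α ((2 * α + β) / 3), (φ₂ (Complex.exp (s * Complex.I))).1 = α
  φ₂_arc_top : ∀ s ∈ Icc ((2 * α + β) / 3) ((α + 2 * β) / 3),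
    (φ₂ (Complex.exp (s * Complex.I))).2 = 1
  φ₂_arc_right : ∀ s ∈ Icc ((α + 2 * β) / 3) β, (φ₂ (Complex.exp (s * Complex.I))).1 = β
  φ₂_corner_left : φ₂ (Complex.exp (((2 * α + β) / 3 : ℝ) * Complex.I)) = (α, 1)
  φ₂_corner_right : φ₂ (Complex.exp (((α + 2 * β) / 3 : ℝ) * Complex.I)) = (β, 1)

/-! In the rest of this section the sides are numbered `0, …, k + 1`, the inputs `1, …, k + 1` and
`m = i + 1` with `i < k`, so that `1 ≤ m` and `m + 1 ≤ k + 1`. The indices `m - 1`, `m`, `m + 1`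
of sides are `i.castSucc.castSucc`, `i.castSucc.succ` and `i.succ.succ`; the inputs `ρ_m` and
`ρ_{m+1}` are `ρ i.castSucc` and `ρ i.succ`. -/

variable {n k : ℕ} {X : Type*} [TopologicalSpace X]
  [ChartedSpace (EuclideanSpace ℝ (Fin (2 * n))) X]
  {M : Fin (k + 1 + 1) → Type*} [∀ j, TopologicalSpace (M j)]
  [∀ j, ChartedSpace (EuclideanSpace ℝ (Fin n)) (M j)]

/-- Replace the `m`-th Lagrangian by `ψ₁(M_m)`, included by `ψ₁`. -/
abbrev newIncl (ι : ∀ j, M j → X) (i : Fin k)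
    (ψ : M i.castSucc.succ × Icc (0 : ℝ) 1 → X) : ∀ j, M j → X :=
  update ι i.castSucc.succ (fun p => ψ (p, 1))

/-- The starting corners of the sides after the isotopy: only that of side `m + 1` moves. (In
`M_m`, the new corner `ψ(p_m, 1)` is represented by the same point as `p_m`.) -/
abbrev newSrc (src : ∀ j, M j) (i : Fin k) (γnext : ℝ → M i.succ.succ) : ∀ j, M j :=
  update src i.succ.succ (γnext 1)

/-- The final corners of the sides after the isotopy: only that of side `m - 1` moves. -/
abbrev newTgt (tgt : ∀ j, M j) (i : Fin k) (γprev : ℝ → M i.castSucc.castSucc) : ∀ j, M j :=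
  update tgt i.castSucc.castSucc (γprev 1)

/-- The polygon `P'` is the polygon `u'` obtained from the polygon `P = u` by gluing in the trace
of the isotopy `ψ` along the `m`-th boundary arc. -/
structure IsGluing {ι : ∀ j, M j → X} {src tgt : ∀ j, M j} {i : Fin k}
    {ψ : M i.castSucc.succ × Icc (0 : ℝ) 1 → X}
    {γprev : ℝ → M i.castSucc.castSucc} {γnext : ℝ → M i.succ.succ}
    (P : PolygonMap (n := n) ι src tgt)
    (G : GluingMaps (P.angle i.castSucc.succ) (P.angle i.succ.succ))
    (P' : PolygonMap (n := n) (newIncl ι i ψ) (newSrc src i γnext) (newTgt tgt i γprev)) :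
    Prop where
  angle_m : P'.angle i.castSucc.succ =
    (2 * P.angle i.castSucc.succ + P.angle i.succ.succ) / 3
  angle_succ : P'.angle i.succ.succ = (P.angle i.castSucc.succ + 2 * P.angle i.succ.succ) / 3
  angle_other : ∀ j, j ≠ i.castSucc.succ → j ≠ i.succ.succ → P'.angle j = P.angle j
  on_main : ∀ z ∈ mainRegion (P.angle i.castSucc.succ) (P.angle i.succ.succ),
    P'.toFun z = P.toFun (G.φ₁ z)
  on_segment : ∀ z ∈ segmentRegion (P.angle i.castSucc.succ) (P.angle i.succ.succ),
    P'.toFun z = ψ (P.side i.castSucc.succ (G.φ₂ z).1, projIcc 0 1 zero_le_one (G.φ₂ z).2)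

variable [∀ j, IsManifold (𝓡 n) ∞ (M j)]

/-- Replace the `m`-th line bundle by `W`. -/
abbrev newBundle (V : ∀ j, UnitaryLineBundle (𝓡 n) (M j)) (i : Fin k)
    (W : UnitaryLineBundle (𝓡 n) (M i.castSucc.succ)) : ∀ j, UnitaryLineBundle (𝓡 n) (M j) :=
  update V i.castSucc.succ W

lemma prev_ne (i : Fin k) : i.castSucc.castSucc ≠ i.castSucc.succ := by
  simp [Fin.ext_iff]

lemma next_ne (i : Fin k) : i.succ.succ ≠ i.castSucc.succ := by
  simp [Fin.ext_iff]

lemma castSucc_ne {i : Fin k} {j : Fin (k + 1)} (h : j ≠ i.succ) :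
    j.castSucc ≠ i.castSucc.succ := by
  simpa [Fin.ext_iff] using h

lemma zero_ne_mid (i : Fin k) : (0 : Fin (k + 1 + 1)) ≠ i.castSucc.succ := by
  simp [Fin.ext_iff]

lemma zero_ne_next (i : Fin k) : (0 : Fin (k + 1 + 1)) ≠ i.succ.succ := by
  simp [Fin.ext_iff]

lemma last_ne_mid (i : Fin k) : Fin.last (k + 1) ≠ i.castSucc.succ := by
  have := i.2
  simp [Fin.ext_iff]
  omega

lemma last_ne_prev (i : Fin k) : Fin.last (k + 1) ≠ i.castSucc.castSucc := by
  have := i.2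
  simp [Fin.ext_iff]
  omega

open UnitaryLineBundle in
/-- The inputs of the glued polygon:
`ρ'_m = Hol_∇̃(γ_m) ∘ ρ_m ∘ Hol_{∇_{m-1}}(γ_m)⁻¹`,
`ρ'_{m+1} = Hol_{∇_{m+1}}(γ_{m+1}) ∘ ρ_{m+1} ∘ Hol_∇̃(γ_{m+1})⁻¹`, and `ρ'_j = ρ_j` otherwise. The
maps `fiberCongr` are identities. -/
def newInputs (V : ∀ j, UnitaryLineBundle (𝓡 n) (M j)) {src tgt : ∀ j, M j} {i : Fin k}
    {B : Form (𝓡 (2 * n)) X 2} {ψ : M i.castSucc.succ × Icc (0 : ℝ) 1 → X}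
    {W : UnitaryLineBundle (𝓡 n) (M i.castSucc.succ)}
    (L : BundleIsotopy B ψ (V i.castSucc.succ) W)
    (γprev : ℝ → M i.castSucc.castSucc) (γnext : ℝ → M i.succ.succ)
    (ρ : ∀ j : Fin (k + 1),
      (V j.castSucc).fiber (tgt j.castSucc) →ₗ[ℂ] (V j.succ).fiber (src j.succ))
    (j : Fin (k + 1)) :
    (newBundle V i W j.castSucc).fiber (newTgt tgt i γprev j.castSucc) →ₗ[ℂ]
      (newBundle V i W j.succ).fiber (newSrc src i γnext j.succ) :=
  if h₁ : j = i.castSucc then by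
    subst h₁
    exact (fiberCongr (update_self i.castSucc.succ W V).symm
        (update_of_ne (next_ne i).symm (γnext 1) src).symm).toLinearMap ∘ₗ
      ((L.hol (src i.castSucc.succ)).toLinearMap ∘ₗ ρ i.castSucc ∘ₗ
        ((V i.castSucc.castSucc).hol γprev 0 1
          (tgt i.castSucc.castSucc) (γprev 1)).symm.toLinearMap) ∘ₗ
      (fiberCongr (update_of_ne (prev_ne i) W V)
        (update_self _ (γprev 1) tgt)).toLinearMap
  else if h₂ : j = i.succ then by
    subst h₂
    exact (fiberCongr (update_of_ne (next_ne i) W V).symm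
        (update_self _ (γnext 1) src).symm).toLinearMap ∘ₗ
      (((V i.succ.succ).hol γnext 0 1 (src i.succ.succ) (γnext 1)).toLinearMap ∘ₗ
        ρ i.succ ∘ₗ (L.hol (tgt i.castSucc.succ)).symm.toLinearMap) ∘ₗ
      (fiberCongr (update_self i.castSucc.succ W V)
        (update_of_ne (prev_ne i).symm (γprev 1) tgt)).toLinearMap
  else
    (fiberCongr (update_of_ne (fun h => h₁ (Fin.succ_injective _ h)) W V).symm
        (update_of_ne (fun h => h₂ (Fin.succ_injective _ h)) (γnext 1) src).symm).toLinearMap ∘ₗ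
      ρ j ∘ₗ
      (fiberCongr (update_of_ne (castSucc_ne h₂) W V)
        (update_of_ne (fun h => h₁ (Fin.castSucc_injective _ h)) (γprev 1) tgt)).toLinearMap

open UnitaryLineBundle in
/-- A linear map between the fibres at the output corner, which is not moved by the isotopy, read
as a map for the new boundary condition. -/
def readOutput (V : ∀ j, UnitaryLineBundle (𝓡 n) (M j)) {src tgt : ∀ j, M j} {i : Fin k}
    (W : UnitaryLineBundle (𝓡 n) (M i.castSucc.succ))
    (γprev : ℝ → M i.castSucc.castSucc) (γnext : ℝ → M i.succ.succ)
    (T : (V 0).fiber (src 0) →ₗ[ℂ] (V (Fin.last (k + 1))).fiber (tgt (Fin.last (k + 1)))) :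
    (newBundle V i W 0).fiber (newSrc src i γnext 0) →ₗ[ℂ]
      (newBundle V i W (Fin.last (k + 1))).fiber (newTgt tgt i γprev (Fin.last (k + 1))) :=
  (fiberCongr (update_of_ne (last_ne_mid i) W V).symm
      (update_of_ne (last_ne_prev i) (γprev 1) tgt).symm).toLinearMap ∘ₗ T ∘ₗ
    (fiberCongr (update_of_ne (zero_ne_mid i) W V)
      (update_of_ne (zero_ne_next i) (γnext 1) src)).toLinearMap

end Gluing

end LagPolygon

end

open LagPolygon

/-!
The glued map `u'` is `u`, reparametrized by `φ₁` on the main region, with the trace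
`(w, t) ↦ ψ_t (∂_m u (w))` of the `m`-th side inserted in the segment. As `φ₁` preserves and `φ₂`
reverses the orientation, the change of variables formula `integral_planeJac_smul` gives, for every
smooth 2-form `σ`,

  `∫ u'^* σ = ∫ u^* σ - ∫∫ σ (∂_w, ∂_t)`,

where the double integral is taken over the trace (`IsGluedMap.discIntegral_eq`). For `σ = Ω`
Fubini's theorem identifies it with the integral of `θ_ψ` along the `m`-th side
(`sideIntegral_thetaForm`), and the factor `exp (-2π ∫ u'^* Ω)` of the weight yields
`c = exp (2π ∫ θ_ψ)`.

For `σ = B` the correction is cancelled by the holonomies. The bundle over `L_m × [0, 1]` has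
curvature `2πi ψ^* B`, so its transports along the two ways around the rectangle over the `m`-th
side differ by `exp (2πi ∫∫ B (∂_w, ∂_t))` (`rectangleHolonomy`, `BundleIsotopy.hol_comm`). This is local
in the rectangle, which may be subdivided until the bundle is trivialized over each piece
(`interval_subdivision`). In a local frame with connection form `Θ`, parallel transport is
`exp (-∫ Θ)` (`IsFramed.coord_lift`), the curvature equation says `dΘ = 2πi ψ^* B`
(`HasCurvature.fderiv_pullConn`), and Green's formula for a rectangle over a path which is only
piecewise smooth and of finite length (`green_rectangle`) relates the two.

The sides `m - 1` and `m + 1` are prolonged by the paths of the two moving corners. The holonomies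
of these prolongations, and those of the bundle isotopy at the corners, cancel against the factors
by which the new inputs differ from the old ones: all holonomies and inputs are conjugated by the
motions `srcMove` and `tgtMove` of the fibres at the corners (`newInputs_tgtMove`,
`IsGluing.sideHol_srcMove`, `chain_srcMove`). The fibres at the output corner do not move.

That `u'` is a polygon (`gluedPolygon`) comes down to three facts. Its singular arcs are the
preimages of those of `u`, the chord, and the preimages of the vertical segments over the singular
parameters of the `m`-th side (`IsGluedMap.exists_arcs`). It has finite area, because a smooth
2-form is integrable over the trace of a path of finite length (`integrableOn_traceDensity`). On the
arc of the segment it runs along the path of one corner, the moved side, and the path of the other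
corner backwards (`isSide_gluedSide`).

Parallel transport is handled as the relation `UnitaryLineBundle.Par` on the total space, which
makes concatenation and reparametrization independent of equalities between base points. Paths enter
the arguments through `IsRectifiablePath`, which only asks for the differentials of smooth functions
to be integrable along the path.
-/

noncomputable section

namespace LagPolygon

/-! ### Local frames and connection forms -/

section Frames

variable {E H : Type*} [NormedAddCommGroup E] [NormedSpace ℝ E] [TopologicalSpace H]
  {I : ModelWithCorners ℝ E H} {M : Type*} [TopologicalSpace M] [ChartedSpace H M]
  [IsManifold I ∞ M]

namespace UnitaryLineBundle

variable (V : UnitaryLineBundle I M)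

/-- The domain of the preferred trivialization at `q`. -/
def dom (q : M) : Set M := (trivializationAt ℂ V.fiber q).baseSet

/-- The local frame given by the preferred trivialization at `q`. -/
def frame (q y : M) : V.fiber y := (trivializationAt ℂ V.fiber q).symm y 1

/-- The coordinate of a vector with respect to the local frame at `q`. -/
def coord (q : M) (u : TotalSpace ℂ V.fiber) : ℂ := (trivializationAt ℂ V.fiber q u).2

/-- The connection form `Θ` of the local frame at `q`, defined by `∇ e = Θ e`. -/
def connForm (q y : M) : TangentSpace I y →L[ℝ] ℂ :=
  ((trivializationAt ℂ V.fiber q).continuousLinearMapAt ℝ y).comp (V.cov (V.frame q) y)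

variable {V}
variable {q y : M}

lemma isOpen_dom (q : M) : IsOpen (V.dom q) := (trivializationAt ℂ V.fiber q).open_baseSet

lemma mem_dom_self (q : M) : q ∈ V.dom q := FiberBundle.mem_baseSet_trivializationAt' q

lemma coord_eq_linearEquivAt (hy : y ∈ V.dom q) (v : V.fiber y) :
    V.coord q ⟨y, v⟩ = (trivializationAt ℂ V.fiber q).linearEquivAt ℂ y hy v := rfl

lemma coord_smul (hy : y ∈ V.dom q) (c : ℂ) (v : V.fiber y) :
    V.coord q ⟨y, c • v⟩ = c * V.coord q ⟨y, v⟩ := by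
  simp [coord_eq_linearEquivAt hy]

lemma coord_frame (hy : y ∈ V.dom q) : V.coord q ⟨y, V.frame q y⟩ = 1 := by
  simp only [coord, frame]
  rw [Trivialization.apply_mk_symm _ hy]

lemma coord_injective (hy : y ∈ V.dom q) {v w : V.fiber y}
    (h : V.coord q ⟨y, v⟩ = V.coord q ⟨y, w⟩) : v = w := by
  rw [coord_eq_linearEquivAt hy, coord_eq_linearEquivAt hy] at h
  exact (LinearEquiv.injective _) h

lemma coord_smul_frame (hy : y ∈ V.dom q) (v : V.fiber y) :
    V.coord q ⟨y, v⟩ • V.frame q y = v :=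
  coord_injective hy (by rw [coord_smul hy, coord_frame hy, mul_one])

lemma frame_ne_zero (hy : y ∈ V.dom q) : V.frame q y ≠ 0 := by
  intro h
  have h1 := coord_frame hy
  rw [h, ← zero_smul ℂ (0 : V.fiber y), coord_smul hy] at h1
  simp at h1

lemma smoothSectionAt_frame (hy : y ∈ V.dom q) : SmoothSectionAt I (V.frame q) y := by
  refine ((trivializationAt ℂ V.fiber q).contMDiffAt_section_iff hy).2 ?_
  refine (contMDiffAt_const (c := (1 : ℂ))).congr_of_eventuallyEq ?_
  filter_upwards [(isOpen_dom q).mem_nhds hy] with z hz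
  exact coord_frame hz

lemma contMDiffAt_coord {σ : ∀ x, V.fiber x} (hσ : SmoothSectionAt I σ y)
    (hy : y ∈ V.dom q) : ContMDiffAt I 𝓘(ℝ, ℂ) ∞ (fun z => V.coord q ⟨z, σ z⟩) y :=
  ((trivializationAt ℂ V.fiber q).contMDiffAt_section_iff hy).1 hσ

lemma connForm_apply (hy : y ∈ V.dom q) (v : TangentSpace I y) :
    V.connForm q y v = V.coord q ⟨y, V.cov (V.frame q) y v⟩ := by
  rw [connForm, ContinuousLinearMap.comp_apply, Trivialization.continuousLinearMapAt_apply,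
    Trivialization.linearMapAt_apply]
  exact if_pos hy

lemma cov_frame (hy : y ∈ V.dom q) (v : TangentSpace I y) :
    V.cov (V.frame q) y v = V.connForm q y v • V.frame q y := by
  refine coord_injective hy ?_
  rw [coord_smul hy, coord_frame hy, mul_one, connForm_apply hy]

lemma smul_smoothSectionAt {h : M → ℂ} {σ : ∀ x, V.fiber x}
    (hh : ContMDiffAt I 𝓘(ℝ, ℂ) ∞ h y) (hσ : SmoothSectionAt I σ y) :
    SmoothSectionAt I (fun z => h z • σ z) y := by
  refine ((trivializationAt ℂ V.fiber y).contMDiffAt_section_iff (mem_dom_self y)).2 ?_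
  have hmul : ContDiff ℝ ∞ (fun p : ℂ × ℂ => p.1 * p.2) := contDiff_fst.mul contDiff_snd
  have h1 := hmul.contMDiff.contMDiffAt.comp y
    (hh.prodMk_space (contMDiffAt_coord hσ (mem_dom_self y)))
  refine h1.congr_of_eventuallyEq ?_
  filter_upwards [(isOpen_dom (V := V) y).mem_nhds (mem_dom_self y)] with z hz
  exact coord_smul (V := V) hz (h z) (σ z)

lemma mdiff_section {σ : ∀ x, V.fiber x} (hσ : SmoothSectionAt I σ y) :
    MDifferentiableAt I (I.prod 𝓘(ℝ, ℂ)) (fun z => TotalSpace.mk' ℂ z (σ z)) y :=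
  ContMDiffAt.mdifferentiableAt hσ (by simp)

/-- The Leibniz rule for complex valued functions. -/
lemma cov_smul {h : M → ℂ} {σ : ∀ x, V.fiber x}
    (hh : ContMDiffAt I 𝓘(ℝ, ℂ) ∞ h y) (hσ : SmoothSectionAt I σ y) (v : TangentSpace I y) :
    V.cov (fun z => h z • σ z) y v =
      (mvfderiv I h y v) • σ y + h y • V.cov σ y v := by
  have hre : ContMDiffAt I 𝓘(ℝ, ℝ) ∞ (fun z => (h z).re) y :=
    (Complex.reCLM.contMDiff (n := ∞)).contMDiffAt.comp y hh
  have him : ContMDiffAt I 𝓘(ℝ, ℝ) ∞ (fun z => (h z).im) y :=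
    (Complex.imCLM.contMDiff (n := ∞)).contMDiffAt.comp y hh
  have hI : SmoothSectionAt I (fun z => Complex.I • σ z) y :=
    smul_smoothSectionAt contMDiffAt_const hσ
  have hmd := hh.mdifferentiableAt (by simp)
  have e1 : mvfderiv I (fun z => (h z).re) y v = (mvfderiv I h y v).re := by
    have := (Complex.reCLM.hasMFDerivAt (x := h y)).comp y hmd.hasMFDerivAt
    exact congrArg (fun L => L v) this.mfderiv
  have e2 : mvfderiv I (fun z => (h z).im) y v = (mvfderiv I h y v).im := by
    have := (Complex.imCLM.hasMFDerivAt (x := h y)).comp y hmd.hasMFDerivAt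
    exact congrArg (fun L => L v) this.mfderiv
  -- `∇` satisfies the Leibniz rule for real functions only, so `h • σ` is written as
  -- `Re h • σ + Im h • (I • σ)`, and complex linearity of `∇` is used for the second summand.
  have hdec : (fun z => h z • σ z) =
      (fun z => (h z).re) • σ + (fun z => (h z).im) • (fun z => Complex.I • σ z) := by
    funext z
    rw [Pi.add_apply, Pi.smul_apply', Pi.smul_apply']
    rw [← Complex.coe_smul (h z).re, ← Complex.coe_smul (h z).im, smul_smul, ← add_smul]
    rw [Complex.re_add_im]
  have s1 : MDifferentiableAt I (I.prod 𝓘(ℝ, ℂ))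
      (fun z => TotalSpace.mk' ℂ z (((fun z => (h z).re) • σ) z)) y :=
    (ContMDiffAt.smul_section (V := V.fiber) hre hσ).mdifferentiableAt (by simp)
  have s2 : MDifferentiableAt I (I.prod 𝓘(ℝ, ℂ))
      (fun z => TotalSpace.mk' ℂ z (((fun z => (h z).im) • fun z => Complex.I • σ z) z)) y :=
    (ContMDiffAt.smul_section (V := V.fiber) him hI).mdifferentiableAt (by simp)
  rw [hdec, V.cov.isCovariantDerivativeOnUniv.add s1 s2,
    V.cov.isCovariantDerivativeOnUniv.leibniz (mdiff_section hσ) (hre.mdifferentiableAt (by simp)),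
    V.cov.isCovariantDerivativeOnUniv.leibniz (mdiff_section hI) (him.mdifferentiableAt (by simp))]
  have key : ∀ (c : ℂ) (w : V.fiber y), c • w = c.re • w + c.im • Complex.I • w := by
    intro c w
    rw [← Complex.coe_smul c.re, ← Complex.coe_smul c.im, smul_smul, ← add_smul,
      Complex.re_add_im]
  rw [key (h y), key (mvfderiv I h y v), ← e1, ← e2, ← V.cov_complex_linear σ y hσ v]
  simp only [add_apply, smul_apply, ContinuousLinearMap.smulRight_apply]
  abel

lemma cov_congr {σ τ : ∀ x, V.fiber x} (hσ : SmoothSectionAt I σ y) (h : ∀ᶠ z in 𝓝 y, σ z = τ z) :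
    V.cov σ y = V.cov τ y := by
  have hτ : SmoothSectionAt I τ y :=
    ContMDiffAt.congr_of_eventuallyEq hσ (by filter_upwards [h] with z hz; rw [hz])
  exact V.cov.isCovariantDerivativeOnUniv.congr_of_eventuallyEq (mdiff_section hσ) (mdiff_section hτ)
    Filter.univ_mem h

/-- The covariant derivative of a section in terms of a local frame. -/
lemma cov_eq {σ : ∀ x, V.fiber x} (hσ : SmoothSectionAt I σ y) (hy : y ∈ V.dom q)
    (v : TangentSpace I y) :
    V.cov σ y v = ((mvfderiv I (fun z => V.coord q ⟨z, σ z⟩) y v) +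
      V.coord q ⟨y, σ y⟩ * V.connForm q y v) • V.frame q y := by
  have h1 : ∀ᶠ z in 𝓝 y, σ z = V.coord q ⟨z, σ z⟩ • V.frame q z := by
    filter_upwards [(isOpen_dom q).mem_nhds hy] with z hz
    exact (coord_smul_frame hz _).symm
  rw [cov_congr hσ h1, cov_smul (contMDiffAt_coord hσ hy) (smoothSectionAt_frame hy), cov_frame hy,
    smul_smul, ← add_smul]

/-- The covariant derivative of a section that is smooth near `y` is smooth at `y`. -/
lemma contMDiffAt_cov [FiniteDimensional ℝ E] [T2Space M] {σ : ∀ x, V.fiber x}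
    (hσ : ∀ᶠ z in 𝓝 y, SmoothSectionAt I σ z) :
    ContMDiffAt I (I.prod 𝓘(ℝ, E →L[ℝ] ℂ)) ∞
      (fun z => (⟨z, V.cov σ z⟩ :
        TotalSpace (E →L[ℝ] ℂ) fun x => TangentSpace I x →L[ℝ] V.fiber x)) y := by
  -- Smoothness of `∇` is available for global smooth sections only: `σ` is cut off by a bump
  -- function, which does not change `∇ σ` near `y`.
  obtain ⟨U, hUs, hUo, hyU⟩ := mem_nhds_iff.1 hσ
  obtain ⟨χ, -, hχ⟩ := (SmoothBumpFunction.nhds_basis_tsupport (I := I) y).mem_iff.1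
    (hUo.mem_nhds hyU)
  have hglob : ContMDiff I (I.prod 𝓘(ℝ, ℂ)) ∞
      (fun z => (⟨z, ((χ : M → ℝ) • σ) z⟩ : TotalSpace ℂ V.fiber)) :=
    ContMDiffOn.smul_section_of_tsupport (χ.contMDiff.contMDiffOn) hUo hχ
      (fun z hz => (hUs hz : SmoothSectionAt I σ z).contMDiffWithinAt)
  have h1 := (V.smooth_cov.contMDiff).contMDiff (σ := (χ : M → ℝ) • σ)
    (by simpa using hglob.contMDiffOn)
  rw [contMDiffOn_univ] at h1
  refine (h1 y).congr_of_eventuallyEq ?_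
  filter_upwards [χ.eventuallyEq_one.eventuallyEq_nhds, hσ] with z hz hz2
  have : V.cov σ z = V.cov ((χ : M → ℝ) • σ) z := by
    refine cov_congr hz2 ?_
    filter_upwards [hz] with w hw
    simp only [Pi.smul_apply', hw, Pi.one_apply, one_smul]
  rw [this]

end UnitaryLineBundle

end Frames

/-! ### Parallel transport inside the domain of a local frame -/

section Calculus

lemma integral_eq_sub_of_hasDerivAt_off_finite {F : Type*} [NormedAddCommGroup F] [NormedSpace ℝ F]
    [CompleteSpace F] {f f' : ℝ → F} {a b : ℝ} (hab : a ≤ b) {S : Set ℝ} (hS : S.Finite)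
    (hc : ContinuousOn f (Icc a b)) (hd : ∀ t ∈ Ioo a b \ S, HasDerivAt f (f' t) t)
    (hi : IntervalIntegrable f' MeasureTheory.volume a b) :
    ∫ t in a..b, f' t = f b - f a :=
  MeasureTheory.integral_eq_of_hasDerivAt_off_countable_of_le f f' hab hS.countable hc
    (fun t ht => hd t ht) hi

lemma eq_of_hasDerivAt_zero_off_finite {F : Type*} [NormedAddCommGroup F] [NormedSpace ℝ F]
    [CompleteSpace F] {f : ℝ → F} {a b : ℝ} (hab : a ≤ b) {S : Set ℝ} (hS : S.Finite)
    (hc : ContinuousOn f (Icc a b)) (hd : ∀ t ∈ Ioo a b \ S, HasDerivAt f 0 t) : f b = f a := by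
  have := integral_eq_sub_of_hasDerivAt_off_finite hab hS hc hd (f' := fun _ => 0)
    (by simp)
  simpa [sub_eq_zero, eq_comm] using this

/-- The fundamental theorem of calculus at an interior point of `[a, b]` where `f` is continuous. -/
lemma hasDerivAt_primitive {F : Type*} [NormedAddCommGroup F] [NormedSpace ℝ F]
    [CompleteSpace F] {f : ℝ → F} {a b t : ℝ} (hi : IntervalIntegrable f MeasureTheory.volume a b)
    (ht : t ∈ Ioo a b) (hc : ContinuousAt f t) :
    HasDerivAt (fun r => ∫ x in a..r, f x) (f t) t := by
  have hab : a ≤ b := (ht.1.trans ht.2).le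
  refine intervalIntegral.integral_hasDerivAt_right
    (hi.mono_set ?_) ⟨Ioc a b, Ioc_mem_nhds ht.1 ht.2, ?_⟩ hc
  · rw [uIcc_of_le ht.1.le, uIcc_of_le hab]
    exact Icc_subset_Icc le_rfl ht.2.le
  · have := hi.1.aestronglyMeasurable
    exact this

end Calculus

section Transport

variable {E H : Type*} [NormedAddCommGroup E] [NormedSpace ℝ E] [TopologicalSpace H]
  {I : ModelWithCorners ℝ E H} {M : Type*} [TopologicalSpace M] [ChartedSpace H M]
  [IsManifold I ∞ M]

namespace UnitaryLineBundle

/-- Parallel transport along `c : [a, b] → M`, as a relation on the total space: there is a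
horizontal lift of `c` from `u` to `u'`. -/
def Par (V : UnitaryLineBundle I M) (c : ℝ → M) (a b : ℝ) (u u' : TotalSpace ℂ V.fiber) : Prop :=
  ∃ s, V.IsHorizontalLift c a b s ∧ s a = u ∧ s b = u'

variable {V : UnitaryLineBundle I M} {q : M} {c : ℝ → M} {a b : ℝ}

/-- The data which reduces parallel transport along `c` to the scalar equation `f' = -A f`: the
path stays inside the domain of the local frame at `q`, and `A` is the pullback of the connection
form, integrable and continuous away from finitely many points. -/
structure IsFramed (V : UnitaryLineBundle I M) (q : M) (c : ℝ → M) (a b : ℝ) (A : ℝ → ℂ) :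
    Prop where
  le : a ≤ b
  continuousOn : ContinuousOn c (Icc a b)
  mapsTo : MapsTo c (Icc a b) (V.dom q)
  integrable : IntervalIntegrable A MeasureTheory.volume a b
  regular : ∃ S : Set ℝ, S.Finite ∧ ∀ t ∈ Ioo a b \ S, MDifferentiableAt 𝓘(ℝ, ℝ) I c t ∧
    ContinuousAt A t ∧ A t = V.connForm q (c t) (velocity I c t)

lemma continuousOn_coord {s : ℝ → TotalSpace ℂ V.fiber} {K : Set ℝ} (hs : ContinuousOn s K)
    (h : ∀ t ∈ K, (s t).proj ∈ V.dom q) : ContinuousOn (fun t => V.coord q (s t)) K := by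
  refine continuous_snd.comp_continuousOn
    ((trivializationAt ℂ V.fiber q).continuousOn.comp hs fun t ht => ?_)
  exact (Trivialization.mem_source _).2 (h t ht)

/-- In a local frame a horizontal lift solves `f' = -Θ(c') f`. -/
lemma hasDerivAt_coord_of_parallel {s : ℝ → TotalSpace ℂ V.fiber} {t : ℝ}
    (hq : c t ∈ V.dom q) (hc : MDifferentiableAt 𝓘(ℝ, ℝ) I c t)
    (hs : ∃ (σ : ∀ x, V.fiber x) (f : ℝ → ℂ) (f' : ℂ),
      SmoothSectionAt I σ (c t) ∧ σ (c t) ≠ 0 ∧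
      (∀ᶠ τ in 𝓝 t, s τ = ⟨c τ, f τ • σ (c τ)⟩) ∧
      HasDerivAt f f' t ∧
      f' • σ (c t) + f t • V.cov σ (c t) (velocity I c t) = 0) :
    HasDerivAt (fun τ => V.coord q (s τ))
      (-(V.connForm q (c t) (velocity I c t)) * V.coord q (s t)) t := by
  obtain ⟨σ, f, f', hσ, -, hev, hf, hpar⟩ := hs
  set h : M → ℂ := fun z => V.coord q ⟨z, σ z⟩ with hh
  have hhd : MDifferentiableAt I 𝓘(ℝ, ℂ) h (c t) :=
    (contMDiffAt_coord hσ hq).mdifferentiableAt (by simp)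
  have hhc : HasDerivAt (fun τ => h (c τ)) (mvfderiv I h (c t) (velocity I c t)) t := by
    have h1 : HasFDerivAt (h ∘ c) (show ℝ →L[ℝ] ℂ from
        (mfderiv I 𝓘(ℝ, ℂ) h (c t)).comp (mfderiv 𝓘(ℝ, ℝ) I c t)) t :=
      (hhd.hasMFDerivAt.comp t hc.hasMFDerivAt).hasFDerivAt
    exact h1.hasDerivAt
  have hprod := hf.mul hhc
  have hcoordt : V.coord q (s t) = f t * h (c t) := by
    rw [hev.self_of_nhds, coord_smul hq]
  have hev2 : (fun τ => V.coord q (s τ)) =ᶠ[𝓝 t] fun τ => f τ * h (c τ) := by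
    have hcont : ∀ᶠ τ in 𝓝 t, c τ ∈ V.dom q :=
      hc.continuousAt.eventually_mem ((isOpen_dom q).mem_nhds hq)
    filter_upwards [hev, hcont] with τ h1 h2
    rw [h1, coord_smul h2]
  refine (hprod.congr_of_eventuallyEq hev2).congr_deriv ?_
  rw [cov_eq hσ hq, ← coord_smul_frame hq (σ (c t)), smul_smul, smul_smul, ← add_smul] at hpar
  have hz := (smul_eq_zero.1 hpar).resolve_right (frame_ne_zero hq)
  rw [coord_smul hq, coord_frame hq, mul_one] at hz
  rw [hcoordt]
  simp only [hh] at hz ⊢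
  linear_combination hz

namespace IsFramed

variable {A : ℝ → ℂ}

/-- In the frame, the parallel transport is multiplication by `exp (-∫ A)`. -/
lemma coord_lift (h : V.IsFramed q c a b A) {s : ℝ → TotalSpace ℂ V.fiber}
    (hs : V.IsHorizontalLift c a b s) :
    V.coord q (s b) = Complex.exp (-∫ t in a..b, A t) * V.coord q (s a) := by
  obtain ⟨S, hS, hreg⟩ := h.regular
  obtain ⟨S', hS', hpar⟩ := hs.parallel
  set J : ℝ → ℂ := fun r => ∫ t in a..r, A t
  have hJ : ContinuousOn J (Icc a b) := by
    have := intervalIntegral.continuousOn_primitive_interval' h.integrable left_mem_uIcc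
    rwa [uIcc_of_le h.le] at this
  -- Along a lift with coordinate `f`, the product `exp (∫ A) f` has zero derivative.
  have hconst := eq_of_hasDerivAt_zero_off_finite (f := fun t => Complex.exp (J t) * V.coord q (s t))
    h.le (hS.union hS')
    (hJ.cexp.mul (continuousOn_coord hs.continuousOn fun t ht => by
      rw [hs.lift t ht]; exact h.mapsTo ht)) (fun t ht => by
      obtain ⟨hd, hcA, hA⟩ := hreg t ⟨ht.1, fun hh => ht.2 (Or.inl hh)⟩
      have h1 := hasDerivAt_coord_of_parallel (h.mapsTo (Ioo_subset_Icc_self ht.1)) hd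
        (hpar t ⟨ht.1, fun hh => ht.2 (Or.inr hh)⟩)
      have h2 := ((hasDerivAt_primitive h.integrable ht.1 hcA).cexp).mul h1
      refine h2.congr_deriv ?_
      rw [← hA]
      ring)
  have hJa : J a = 0 := intervalIntegral.integral_same
  simp only [hJa, Complex.exp_zero, one_mul] at hconst
  rw [← hconst, ← mul_assoc, ← Complex.exp_add]
  simp [J]

/-- A horizontal lift with a given initial vector, namely `exp (-∫ A)` times a multiple of the
frame. -/
lemma exists_lift (h : V.IsFramed q c a b A) (v : V.fiber (c a)) :
    ∃ s, V.IsHorizontalLift c a b s ∧ s a = ⟨c a, v⟩ := by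
  obtain ⟨S, hS, hreg⟩ := h.regular
  set J : ℝ → ℂ := fun r => ∫ t in a..r, A t
  have hJ : ContinuousOn J (Icc a b) := by
    have := intervalIntegral.continuousOn_primitive_interval' h.integrable left_mem_uIcc
    rwa [uIcc_of_le h.le] at this
  set k : ℝ → ℂ := fun t => Complex.exp (-J t) * V.coord q ⟨c a, v⟩ with hk
  have ha : a ∈ Icc a b := left_mem_Icc.2 h.le
  refine ⟨fun t => ⟨c t, k t • V.frame q (c t)⟩, ⟨fun t _ => rfl, ?_, S, hS, ?_⟩, ?_⟩
  · have h1 : ContinuousOn (fun t => (trivializationAt ℂ V.fiber q).toOpenPartialHomeomorph.symm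
        (c t, k t)) (Icc a b) := by
      refine (trivializationAt ℂ V.fiber q).continuousOn_invFun.comp
        (h.continuousOn.prodMk (hJ.neg.cexp.mul continuousOn_const)) fun t ht => ?_
      exact (Trivialization.mem_target _).2 (h.mapsTo ht)
    refine h1.congr fun t ht => ?_
    have := (trivializationAt ℂ V.fiber q).mk_symm (h.mapsTo ht) (k t)
    dsimp only
    rw [← this]
    congr 1
    refine coord_injective (h.mapsTo ht) ?_
    rw [coord_smul (h.mapsTo ht), coord_frame (h.mapsTo ht), mul_one]
    simp only [coord]
    rw [Trivialization.apply_mk_symm _ (h.mapsTo ht)]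
  · intro t ht
    obtain ⟨hd, hcA, hA⟩ := hreg t ht
    have hq := h.mapsTo (Ioo_subset_Icc_self ht.1)
    refine ⟨V.frame q, k, -(A t) * k t, smoothSectionAt_frame hq, frame_ne_zero hq,
      Filter.Eventually.of_forall fun _ => rfl, ?_, ?_⟩
    · refine (((hasDerivAt_primitive h.integrable ht.1 hcA).neg.cexp).mul_const _).congr_deriv ?_
      simp only [hk, J, Pi.neg_apply]
      ring
    · rw [cov_frame hq, ← hA, smul_smul, ← add_smul]
      simp [mul_comm]
  · have hJa : J a = 0 := intervalIntegral.integral_same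
    simp only [hk, hJa, neg_zero, Complex.exp_zero, one_mul]
    rw [coord_smul_frame (h.mapsTo ha)]

end IsFramed

/-! ### Restriction and concatenation of parallel transports -/

lemma Par.proj_right (hab : a ≤ b) {u u' : TotalSpace ℂ V.fiber} (h : V.Par c a b u u') :
    u'.proj = c b := by
  obtain ⟨s, hs, -, rfl⟩ := h
  exact hs.lift b (right_mem_Icc.2 hab)

lemma IsHorizontalLift.mono {s : ℝ → TotalSpace ℂ V.fiber} {a' b' : ℝ}
    (hs : V.IsHorizontalLift c a b s) (ha : a ≤ a') (hb : b' ≤ b) :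
    V.IsHorizontalLift c a' b' s where
  lift t ht := hs.lift t ⟨ha.trans ht.1, ht.2.trans hb⟩
  continuousOn := hs.continuousOn.mono (Icc_subset_Icc ha hb)
  parallel := by
    obtain ⟨S, hS, h⟩ := hs.parallel
    exact ⟨S, hS, fun t ht => h t ⟨Ioo_subset_Ioo ha hb ht.1, ht.2⟩⟩

lemma Par.split {u u' : TotalSpace ℂ V.fiber} {m : ℝ} (h : V.Par c a b u u') (ha : a ≤ m)
    (hb : m ≤ b) : ∃ w, V.Par c a m u w ∧ V.Par c m b w u' := by
  obtain ⟨s, hs, rfl, rfl⟩ := h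
  exact ⟨s m, ⟨s, hs.mono le_rfl hb, rfl, rfl⟩, ⟨s, hs.mono ha le_rfl, rfl, rfl⟩⟩

/-- A horizontal lift only depends on the path on the closed interval. -/
lemma IsHorizontalLift.congr {s : ℝ → TotalSpace ℂ V.fiber} {c' : ℝ → M}
    (hs : V.IsHorizontalLift c a b s) (h : EqOn c c' (Icc a b)) :
    V.IsHorizontalLift c' a b s where
  lift t ht := (hs.lift t ht).trans (h ht)
  continuousOn := hs.continuousOn
  parallel := by
    obtain ⟨S, hS, hp⟩ := hs.parallel
    refine ⟨S, hS, fun t ht => ?_⟩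
    have hev : c =ᶠ[𝓝 t] c' := by
      filter_upwards [Icc_mem_nhds ht.1.1 ht.1.2] with τ hτ using h hτ
    have hct : c t = c' t := hev.self_of_nhds
    obtain ⟨σ, f, f', h1, h2, h3, h4, h5⟩ := hp t ht
    refine ⟨σ, f, f', hct ▸ h1, hct ▸ h2, ?_, h4, ?_⟩
    · filter_upwards [h3, hev] with τ e1 e2
      rw [e1, e2]
    · have hv : (velocity I c t : E) = velocity I c' t := by
        simp only [velocity]
        exact congrArg (fun L : ℝ →L[ℝ] E => L 1) hev.mfderiv_eq
      have key : ∀ y, y = c' t → ∀ w : E, w = velocity I c' t →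
          f' • σ y + f t • V.cov σ y (show TangentSpace I y from w) = 0 →
          f' • σ (c' t) + f t • V.cov σ (c' t) (velocity I c' t) = 0 := by
        rintro _ rfl _ rfl h
        exact h
      exact key _ hct _ hv h5

/-- Concatenation of horizontal lifts. -/
lemma Par.trans {u u' u'' : TotalSpace ℂ V.fiber} {m : ℝ} (ha : a ≤ m) (hb : m ≤ b)
    (h : V.Par c a m u u') (h' : V.Par c m b u' u'') : V.Par c a b u u'' := by
  obtain ⟨s, hs, rfl, hsm⟩ := h
  obtain ⟨s', hs', hsm', rfl⟩ := h'
  set r : ℝ → TotalSpace ℂ V.fiber := fun t => if t ≤ m then s t else s' t with hr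
  have e1 : EqOn r s (Icc a m) := fun t ht => if_pos ht.2
  have e2 : EqOn r s' (Icc m b) := by
    intro t ht
    rcases ht.1.eq_or_lt with rfl | h
    · rw [hr]; simp [hsm, hsm']
    · exact if_neg (not_le.2 h)
  refine ⟨r, ⟨?_, ?_, ?_⟩, e1 (left_mem_Icc.2 ha), e2 (right_mem_Icc.2 hb)⟩
  · intro t ht
    rcases le_total t m with h | h
    · rw [e1 ⟨ht.1, h⟩]; exact hs.lift t ⟨ht.1, h⟩
    · rw [e2 ⟨h, ht.2⟩]; exact hs'.lift t ⟨h, ht.2⟩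
  · rw [← Icc_union_Icc_eq_Icc ha hb]
    exact (hs.continuousOn.congr e1).union_of_isClosed (hs'.continuousOn.congr e2)
      isClosed_Icc isClosed_Icc
  · obtain ⟨S, hS, hp⟩ := hs.parallel
    obtain ⟨S', hS', hp'⟩ := hs'.parallel
    refine ⟨(S ∪ S') ∪ {m}, (hS.union hS').union (finite_singleton m), fun t ht => ?_⟩
    have hne : t ≠ m := fun h => ht.2 (Or.inr h)
    rcases lt_or_gt_of_ne hne with h | h
    · obtain ⟨σ, f, f', h1, h2, h3, h4, h5⟩ := hp t ⟨⟨ht.1.1, h⟩, fun hh => ht.2 (Or.inl (Or.inl hh))⟩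
      refine ⟨σ, f, f', h1, h2, ?_, h4, h5⟩
      filter_upwards [h3, Icc_mem_nhds ht.1.1 h] with τ k1 k2
      rw [e1 k2, k1]
    · obtain ⟨σ, f, f', h1, h2, h3, h4, h5⟩ := hp' t ⟨⟨h, ht.1.2⟩, fun hh => ht.2 (Or.inl (Or.inr hh))⟩
      refine ⟨σ, f, f', h1, h2, ?_, h4, h5⟩
      filter_upwards [h3, Icc_mem_nhds h ht.1.2] with τ k1 k2
      rw [e2 k2, k1]

/-- Scalar multiplication on the total space. -/
def scale (l : ℂ) (u : TotalSpace ℂ V.fiber) : TotalSpace ℂ V.fiber := ⟨u.proj, l • u.2⟩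

end UnitaryLineBundle

end Transport

/-! ### From local to global on an interval -/

section Subdivision

/-- A property of intervals which is additive under concatenation and holds for all sufficiently
short intervals holds for all intervals. -/
lemma interval_subdivision {Q : ℝ → ℝ → Prop} {a b : ℝ} (hab : a ≤ b)
    (hadd : ∀ x y z, a ≤ x → x ≤ y → y ≤ z → z ≤ b → Q x y → Q y z → Q x z)
    (hloc : ∀ t ∈ Icc a b, ∃ ε > 0, ∀ x y, a ≤ x → x ≤ y → y ≤ b → |x - t| < ε → |y - t| < ε →
      Q x y) : Q a b := by
  choose! ε hε hQ using hloc
  obtain ⟨t, ht0, hmono, ⟨m, hm⟩, hsub⟩ := exists_monotone_Icc_subset_open_cover_Icc hab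
    (c := fun i : Icc a b => {x : Icc a b | |(x : ℝ) - i| < ε i})
    (fun i => isOpen_lt (by fun_prop) continuous_const)
    (fun x _ => mem_iUnion.2 ⟨x, by simpa using hε x x.2⟩)
  have hstep : ∀ n, Q (t n) (t (n + 1)) := by
    intro n
    obtain ⟨i, hi⟩ := hsub n
    have hle : t n ≤ t (n + 1) := hmono (Nat.le_succ n)
    exact hQ i i.2 _ _ (t n).2.1 hle (t (n + 1)).2.2 (hi (left_mem_Icc.2 hle))
      (hi (right_mem_Icc.2 hle))
  have hall : ∀ n, Q a (t (n + 1)) := by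
    intro n
    induction n with
    | zero => have := hstep 0; rwa [ht0] at this
    | succ n ih =>
      exact hadd _ _ _ le_rfl (t (n + 1)).2.1 (hmono (Nat.le_succ _)) (t (n + 2)).2.2 ih (hstep _)
  have := hall m
  rwa [hm (m + 1) (Nat.le_succ m)] at this

end Subdivision

/-! ### Rectifiable paths in coordinates -/

section Paths

variable {E H : Type*} [NormedAddCommGroup E] [NormedSpace ℝ E] [TopologicalSpace H]
  {I : ModelWithCorners ℝ E H} {M : Type*} [TopologicalSpace M] [ChartedSpace H M]

/-- A continuous path, smooth away from finitely many parameters, along which the differential of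
every smooth function is integrable. -/
structure IsRectifiablePath (I : ModelWithCorners ℝ E H) (c : ℝ → M) (a b : ℝ) : Prop where
  le : a ≤ b
  continuousOn : ContinuousOn c (Icc a b)
  smooth : ∃ S : Set ℝ, S.Finite ∧ ∀ t ∈ Ioo a b \ S, ContMDiffAt 𝓘(ℝ, ℝ) I ∞ c t
  integrable : ∀ g : M → ℝ, ContMDiff I 𝓘(ℝ, ℝ) ∞ g →
    IntervalIntegrable (deriv fun t => g (c t)) MeasureTheory.volume a b

lemma ae_Ioc_of_Ioo_diff_finite {a b : ℝ} {S : Set ℝ} (hS : S.Finite) {p : ℝ → Prop}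
    (h : ∀ t ∈ Ioo a b \ S, p t) :
    ∀ᵐ t ∂(MeasureTheory.volume.restrict (Ioc a b)), p t := by
  rw [MeasureTheory.ae_restrict_iff' measurableSet_Ioc]
  have : (S ∪ {b})ᶜ ∈ MeasureTheory.ae (MeasureTheory.volume : MeasureTheory.Measure ℝ) :=
    MeasureTheory.compl_mem_ae_iff.2 ((hS.union (finite_singleton b)).measure_zero _)
  filter_upwards [this] with t ht htab
  refine h t ⟨⟨htab.1, lt_of_le_of_ne htab.2 fun hb => ht (Or.inr hb)⟩, fun hs => ht (Or.inl hs)⟩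

lemma intervalIntegrable_congr_off_finite {F : Type*} [NormedAddCommGroup F] {f g : ℝ → F}
    {a b : ℝ} (hab : a ≤ b) {S : Set ℝ} (hS : S.Finite) (h : ∀ t ∈ Ioo a b \ S, f t = g t)
    (hf : IntervalIntegrable f MeasureTheory.volume a b) :
    IntervalIntegrable g MeasureTheory.volume a b := by
  rw [intervalIntegrable_iff_integrableOn_Ioc_of_le hab] at hf ⊢
  exact MeasureTheory.Integrable.congr hf (ae_Ioc_of_Ioo_diff_finite hS h)

/-- The integrability of `g ∘ c` for functions with values in a finite dimensional space. -/
lemma IsRectifiablePath.integrable_vector {F : Type*} [NormedAddCommGroup F] [NormedSpace ℝ F]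
    [FiniteDimensional ℝ F] {c : ℝ → M} {a b : ℝ} (h : IsRectifiablePath I c a b) {g : M → F}
    (hg : ContMDiff I 𝓘(ℝ, F) ∞ g) :
    IntervalIntegrable (deriv fun t => g (c t)) MeasureTheory.volume a b := by
  obtain ⟨S, hS, hsm⟩ := h.smooth
  set B := Module.finBasis ℝ F
  have h1 : IntervalIntegrable
      (fun t => ∑ i, (deriv fun t => (B.coord i).toContinuousLinearMap (g (c t))) t • B i)
      MeasureTheory.volume a b := by
    have : ∀ i ∈ Finset.univ, IntervalIntegrable (fun t =>
        (deriv fun t => (B.coord i).toContinuousLinearMap (g (c t))) t • B i)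
        MeasureTheory.volume a b := by
      intro i _
      have h2 := h.integrable (fun x => (B.coord i).toContinuousLinearMap (g x))
        ((ContinuousLinearMap.contMDiff _).comp hg)
      exact ⟨h2.1.smul_const _, h2.2.smul_const _⟩
    simpa [Finset.sum_fn] using IntervalIntegrable.sum Finset.univ this
  refine intervalIntegrable_congr_off_finite h.le hS (fun t ht => ?_) h1
  have hd : DifferentiableAt ℝ (fun t => g (c t)) t :=
    ((hg.contMDiffAt.comp t (hsm t ht)).mdifferentiableAt (by simp)).differentiableAt
  have h3 : ∀ i, deriv (fun t => (B.coord i).toContinuousLinearMap (g (c t))) t =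
      B.coord i (deriv (fun t => g (c t)) t) := by
    intro i
    exact (((B.coord i).toContinuousLinearMap.hasFDerivAt.comp_hasDerivAt t hd.hasDerivAt)).deriv
  simp only [h3]
  exact B.sum_repr _

/-- Near every parameter, the expression of a rectifiable path in a chart has an integrable
derivative. -/
lemma IsRectifiablePath.exists_chart [FiniteDimensional ℝ E] [T2Space M] [IsManifold I ∞ M]
    {c : ℝ → M} {a b : ℝ} (h : IsRectifiablePath I c a b) {t₀ : ℝ} (ht₀ : t₀ ∈ Icc a b)
    {U : Set M} (hU : U ∈ 𝓝 (c t₀)) :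
    ∃ ε > 0, (∀ t ∈ Icc a b, |t - t₀| < ε → c t ∈ U ∩ (chartAt H (c t₀)).source) ∧
      ∀ x y, a ≤ x → x ≤ y → y ≤ b → |x - t₀| < ε → |y - t₀| < ε →
        IntervalIntegrable (deriv fun t => extChartAt I (c t₀) (c t)) MeasureTheory.volume x y := by
  set q := c t₀
  -- The chart multiplied by a bump function is a global function, which agrees with the chart near
  -- `c t₀`.
  obtain ⟨χ, -, -⟩ := (SmoothBumpFunction.nhds_basis_tsupport (I := I) q).mem_iff.1
    Filter.univ_mem
  have hg : ContMDiff I 𝓘(ℝ, E) ∞ fun x => χ x • extChartAt I q x :=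
    χ.contMDiff_smul contMDiffOn_extChartAt
  have hint := h.integrable_vector hg
  have hW : {x | x ∈ U ∩ (chartAt H q).source ∧ χ x = 1} ∈ 𝓝 q := by
    filter_upwards [hU, (chartAt H q).open_source.mem_nhds (mem_chart_source H q),
      χ.eventuallyEq_one] with x h1 h2 h3
    exact ⟨⟨h1, h2⟩, h3⟩
  have hpre := (h.continuousOn t₀ ht₀).preimage_mem_nhdsWithin hW
  obtain ⟨ε, hε, hsub⟩ := Metric.mem_nhdsWithin_iff.1 hpre
  have hsub' : ∀ t ∈ Icc a b, |t - t₀| < ε → c t ∈ U ∩ (chartAt H q).source ∧ χ (c t) = 1 :=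
    fun t ht hd => hsub ⟨by simpa [Real.dist_eq] using hd, ht⟩
  refine ⟨ε, hε, fun t ht hd => (hsub' t ht hd).1, ?_⟩
  intro x y hx hxy hy hxε hyε
  have hint' : IntervalIntegrable (deriv fun t => χ (c t) • extChartAt I q (c t))
      MeasureTheory.volume x y := by
    refine hint.mono_set ?_
    rw [uIcc_of_le hxy, uIcc_of_le h.le]
    exact Icc_subset_Icc hx hy
  refine intervalIntegrable_congr_off_finite hxy finite_empty (fun t ht => ?_) hint'
  refine Filter.EventuallyEq.deriv_eq ?_
  filter_upwards [Ioo_mem_nhds ht.1.1 ht.1.2] with τ hτ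
  rw [(hsub' τ ⟨hx.trans hτ.1.le, hτ.2.le.trans hy⟩ ?_).2, one_smul]
  rw [abs_lt] at hxε hyε ⊢
  constructor <;> linarith [hτ.1, hτ.2]

end Paths

/-! ### Connection forms in coordinates -/

section Coordinates

variable {E H : Type*} [NormedAddCommGroup E] [NormedSpace ℝ E] [TopologicalSpace H]
  {I : ModelWithCorners ℝ E H} {M : Type*} [TopologicalSpace M] [ChartedSpace H M]
  [IsManifold I ∞ M] {F : Type*} [NormedAddCommGroup F] [NormedSpace ℝ F]

/-- The pullback of the connection form by a map `Φ` from an open subset of a vector space or, more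
generally, from a set `D` with unique derivatives. -/
def UnitaryLineBundle.pullConn (V : UnitaryLineBundle I M) (q : M) (Φ : F → M) (D : Set F) (z : F) :
    F →L[ℝ] ℂ :=
  (V.connForm q (Φ z)).comp (mfderivWithin 𝓘(ℝ, F) I Φ D z)

/-- The pullback of the connection form is smooth, evaluated on a constant vector: it is the frame
coordinate of the pairing of `∇ e`, a smooth section of the bundle of homomorphisms, with the vector
`dΦ v`. -/
lemma UnitaryLineBundle.contDiffWithinAt_pullConn_apply [FiniteDimensional ℝ E]
    [T2Space M] (V : UnitaryLineBundle I M) {q : M} {Φ : F → M} {D : Set F}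
    (hΦ : ContMDiffOn 𝓘(ℝ, F) I ∞ Φ D) (hD : UniqueDiffOn ℝ D) {z₀ : F} (hz : z₀ ∈ D)
    (hq : Φ z₀ ∈ V.dom q) (v : F) :
    ContDiffWithinAt ℝ ∞ (fun z => V.pullConn q Φ D z v) D z₀ := by
  have h1 : ContMDiffWithinAt 𝓘(ℝ, F) (I.prod 𝓘(ℝ, E →L[ℝ] ℂ)) ∞
      (fun z => (⟨Φ z, V.cov (V.frame q) (Φ z)⟩ :
        TotalSpace (E →L[ℝ] ℂ) fun x => TangentSpace I x →L[ℝ] V.fiber x)) D z₀ := by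
    have := contMDiffAt_cov (V := V) (y := Φ z₀) (σ := V.frame q) (by
      filter_upwards [(isOpen_dom q).mem_nhds hq] with y hy using smoothSectionAt_frame hy)
    exact this.comp_contMDiffWithinAt z₀ (hΦ z₀ hz)
  have h2 : ContMDiffWithinAt 𝓘(ℝ, F) I.tangent ∞
      (fun z => (⟨Φ z, mfderivWithin 𝓘(ℝ, F) I Φ D z v⟩ : TangentBundle I M)) D z₀ := by
    have ht := hΦ.contMDiffOn_tangentMapWithin (m := ∞) (by simp) hD.uniqueMDiffOn
    have hs : ContMDiff 𝓘(ℝ, F) 𝓘(ℝ, F).tangent ∞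
        (fun z => (⟨z, v⟩ : TangentBundle 𝓘(ℝ, F) F)) := by
      intro z
      refine (contMDiffAt_section z).2 ?_
      simpa using contMDiffAt_const
    exact (ht ⟨z₀, v⟩ hz).comp z₀ (hs z₀).contMDiffWithinAt fun z hz => hz
  have h3 := ContMDiffWithinAt.clm_bundle_apply (E₂ := V.fiber) h1 h2
  have hsrc : (⟨Φ z₀, V.cov (V.frame q) (Φ z₀) (mfderivWithin 𝓘(ℝ, F) I Φ D z₀ v)⟩ :
      TotalSpace ℂ V.fiber) ∈ (trivializationAt ℂ V.fiber q).source :=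
    (Trivialization.mem_source _).2 hq
  have h4 := (((trivializationAt ℂ V.fiber q).contMDiffOn (IB := I) (n := ∞)).contMDiffAt
    ((trivializationAt ℂ V.fiber q).open_source.mem_nhds hsrc)).comp_contMDiffWithinAt_of_eq h3 rfl
  have h5 : ContMDiffWithinAt 𝓘(ℝ, F) 𝓘(ℝ, ℂ) ∞ (fun z => V.pullConn q Φ D z v) D z₀ := by
    refine (contMDiffAt_snd.comp_contMDiffWithinAt z₀ h4).congr_of_eventuallyEq_of_mem ?_ hz
    have hev : ∀ᶠ z in 𝓝[D] z₀, Φ z ∈ V.dom q :=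
      (hΦ z₀ hz).continuousWithinAt.eventually_mem ((isOpen_dom q).mem_nhds hq)
    filter_upwards [hev] with z hz
    exact connForm_apply (V := V) hz _
  exact contMDiffWithinAt_iff_contDiffWithinAt.1 h5

lemma UnitaryLineBundle.contDiffWithinAt_pullConn [FiniteDimensional ℝ E] [FiniteDimensional ℝ F]
    [T2Space M] (V : UnitaryLineBundle I M) {q : M} {Φ : F → M} {D : Set F}
    (hΦ : ContMDiffOn 𝓘(ℝ, F) I ∞ Φ D) (hD : UniqueDiffOn ℝ D) {z₀ : F} (hz : z₀ ∈ D)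
    (hq : Φ z₀ ∈ V.dom q) : ContDiffWithinAt ℝ ∞ (V.pullConn q Φ D) D z₀ := by
  have h : ContDiffOn ℝ ∞ (V.pullConn q Φ D) (D ∩ Φ ⁻¹' V.dom q) := by
    rw [contDiffOn_clm_apply]
    exact fun v z hz => (V.contDiffWithinAt_pullConn_apply hΦ hD hz.1 hz.2 v).mono inter_subset_left
  refine (h z₀ ⟨hz, hq⟩).mono_of_mem_nhdsWithin ?_
  exact Filter.inter_mem self_mem_nhdsWithin
    ((hΦ z₀ hz).continuousWithinAt ((isOpen_dom q).mem_nhds hq))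

end Coordinates

/-! ### Framing paths through coordinates -/

section Integrability

lemma aestronglyMeasurable_clm_apply {α F G : Type*} [MeasurableSpace α]
    {μ : MeasureTheory.Measure α} [NormedAddCommGroup F] [NormedSpace ℝ F] [NormedAddCommGroup G]
    [NormedSpace ℝ G] {L : α → F →L[ℝ] G} {f : α → F} (hL : MeasureTheory.AEStronglyMeasurable L μ)
    (hf : MeasureTheory.AEStronglyMeasurable f μ) :
    MeasureTheory.AEStronglyMeasurable (fun x => L x (f x)) μ :=
  (ContinuousLinearMap.id ℝ (F →L[ℝ] G)).aestronglyMeasurable_comp₂ hL hf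

/-- A continuous family of functionals applied to an integrable function is integrable. -/
lemma integrableOn_clm_apply {α F G : Type*} [MeasurableSpace α] [TopologicalSpace α]
    [OpensMeasurableSpace α] [SecondCountableTopology α]
    [TopologicalSpace.PseudoMetrizableSpace α]
    {μ : MeasureTheory.Measure α} [NormedAddCommGroup F] [NormedSpace ℝ F] [NormedAddCommGroup G]
    [NormedSpace ℝ G] {K s : Set α} (hK : IsCompact K) (hsK : s ⊆ K) (hs : MeasurableSet s)
    {L : α → F →L[ℝ] G} {f : α → F} (hL : ContinuousOn L K)
    (hf : MeasureTheory.IntegrableOn f s μ) :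
    MeasureTheory.IntegrableOn (fun x => L x (f x)) s μ := by
  obtain ⟨C, hC⟩ := hK.exists_bound_of_continuousOn hL
  refine MeasureTheory.Integrable.mono' (g := fun x => C * ‖f x‖) (hf.norm.const_mul C)
    (aestronglyMeasurable_clm_apply ((hL.mono hsK).aestronglyMeasurable hs) hf.aestronglyMeasurable)
    ?_
  rw [MeasureTheory.ae_restrict_iff' hs]
  refine Filter.Eventually.of_forall fun x hx => ?_
  exact ((L x).le_opNorm _).trans (mul_le_mul_of_nonneg_right (hC x (hsK hx)) (norm_nonneg _))

lemma intervalIntegrable_clm_apply {F G : Type*} [NormedAddCommGroup F] [NormedSpace ℝ F]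
    [NormedAddCommGroup G] [NormedSpace ℝ G] {a b : ℝ} (hab : a ≤ b) {L : ℝ → F →L[ℝ] G}
    {f : ℝ → F} (hL : ContinuousOn L (Icc a b))
    (hf : IntervalIntegrable f MeasureTheory.volume a b) :
    IntervalIntegrable (fun x => L x (f x)) MeasureTheory.volume a b := by
  rw [intervalIntegrable_iff_integrableOn_Ioc_of_le hab] at hf ⊢
  exact integrableOn_clm_apply isCompact_Icc Ioc_subset_Icc_self measurableSet_Ioc hL hf

end Integrability

section

variable {E H : Type*} [NormedAddCommGroup E] [NormedSpace ℝ E] [TopologicalSpace H]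
  {I : ModelWithCorners ℝ E H} {M : Type*} [TopologicalSpace M] [ChartedSpace H M]
  {F : Type*} [NormedAddCommGroup F] [NormedSpace ℝ F]

/-- The velocity of a path given in coordinates. -/
lemma hasMFDerivAt_of_coordinates {Φ : F → M} {D : Set F} {c : ℝ → M} {z : ℝ → F} {t : ℝ}
    (hΦ : MDifferentiableWithinAt 𝓘(ℝ, F) I Φ D (z t)) (hz : DifferentiableAt ℝ z t)
    (hD : ∀ᶠ τ in 𝓝 t, z τ ∈ D) (hc : ∀ᶠ τ in 𝓝 t, c τ = Φ (z τ)) :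
    HasMFDerivAt 𝓘(ℝ, ℝ) I c t
      (show ℝ →L[ℝ] E from (mfderivWithin 𝓘(ℝ, F) I Φ D (z t)).comp (fderiv ℝ z t)) := by
  have h1 : HasMFDerivWithinAt 𝓘(ℝ, ℝ) I (Φ ∘ z) (z ⁻¹' D) t
      ((mfderivWithin 𝓘(ℝ, F) I Φ D (z t)).comp (fderiv ℝ z t)) :=
    hΦ.hasMFDerivWithinAt.comp t (hz.hasFDerivAt.hasMFDerivAt.hasMFDerivWithinAt)
      fun τ hτ => hτ
  have h2 := h1.hasMFDerivAt hD
  exact h2.congr_of_eventuallyEq hc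

lemma velocity_of_coordinates {Φ : F → M} {D : Set F} {c : ℝ → M} {z : ℝ → F} {t : ℝ}
    (hΦ : MDifferentiableWithinAt 𝓘(ℝ, F) I Φ D (z t)) (hz : DifferentiableAt ℝ z t)
    (hD : ∀ᶠ τ in 𝓝 t, z τ ∈ D) (hc : ∀ᶠ τ in 𝓝 t, c τ = Φ (z τ)) :
    (velocity I c t : E) = mfderivWithin 𝓘(ℝ, F) I Φ D (z t) (deriv z t) := by
  have h := (hasMFDerivAt_of_coordinates hΦ hz hD hc).mfderiv
  simp only [velocity]
  exact congrArg (fun L : ℝ →L[ℝ] E => L 1) h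

variable [IsManifold I ∞ M]

/-- The connection form on the velocity of a path given in coordinates. -/
lemma UnitaryLineBundle.connForm_velocity (V : UnitaryLineBundle I M) {q : M}
    {Φ : F → M} {D : Set F} {c : ℝ → M} {z : ℝ → F} {t : ℝ}
    (hΦ : MDifferentiableWithinAt 𝓘(ℝ, F) I Φ D (z t)) (hz : DifferentiableAt ℝ z t)
    (hD : ∀ᶠ τ in 𝓝 t, z τ ∈ D) (hc : ∀ᶠ τ in 𝓝 t, c τ = Φ (z τ)) :
    V.connForm q (c t) (velocity I c t) = V.pullConn q Φ D (z t) (deriv z t) := by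
  have key : ∀ y, y = Φ (z t) → ∀ w : E, w = mfderivWithin 𝓘(ℝ, F) I Φ D (z t) (deriv z t) →
      V.connForm q y (show TangentSpace I y from w) = V.pullConn q Φ D (z t) (deriv z t) := by
    rintro _ rfl _ rfl
    rfl
  exact key _ hc.self_of_nhds _ (velocity_of_coordinates hΦ hz hD hc)

/-- A path given in coordinates inside the domain of a local frame is framed. -/
lemma UnitaryLineBundle.isFramed_of_coordinates [FiniteDimensional ℝ E] [FiniteDimensional ℝ F]
    [T2Space M] (V : UnitaryLineBundle I M) {q : M}
    {Φ : F → M} {D : Set F} {c : ℝ → M} {z : ℝ → F} {a b : ℝ} (hab : a ≤ b)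
    (hΦ : ContMDiffOn 𝓘(ℝ, F) I ∞ Φ D) (hD : UniqueDiffOn ℝ D)
    (hq : MapsTo Φ D (V.dom q)) (hzD : MapsTo z (Icc a b) D) (hz : ContinuousOn z (Icc a b))
    {S : Set ℝ} (hS : S.Finite) (hzS : ∀ t ∈ Ioo a b \ S, ContDiffAt ℝ ∞ z t)
    (hzi : IntervalIntegrable (deriv z) MeasureTheory.volume a b)
    (hc : ∀ t ∈ Icc a b, c t = Φ (z t)) :
    V.IsFramed q c a b (fun t => V.pullConn q Φ D (z t) (deriv z t)) where
  le := hab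
  continuousOn := (hΦ.continuousOn.comp hz hzD).congr hc
  mapsTo t ht := by rw [hc t ht]; exact hq (hzD ht)
  integrable := by
    refine intervalIntegrable_clm_apply hab (fun t ht => ?_) hzi
    exact (V.contDiffWithinAt_pullConn hΦ hD (hzD ht) (hq (hzD ht))).continuousWithinAt.comp
      (hz t ht) hzD
  regular := by
    refine ⟨S, hS, fun t ht => ?_⟩
    have htI := Ioo_subset_Icc_self ht.1
    have hev : ∀ᶠ τ in 𝓝 t, τ ∈ Icc a b := Icc_mem_nhds ht.1.1 ht.1.2
    have hD' : ∀ᶠ τ in 𝓝 t, z τ ∈ D := hev.mono fun τ hτ => hzD hτ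
    have hc' : ∀ᶠ τ in 𝓝 t, c τ = Φ (z τ) := hev.mono fun τ hτ => hc τ hτ
    have hd : DifferentiableAt ℝ z t := (hzS t ht).differentiableAt (by simp)
    have hΦd := (hΦ (z t) (hzD htI)).mdifferentiableWithinAt (by simp)
    refine ⟨(hasMFDerivAt_of_coordinates hΦd hd hD' hc').mdifferentiableAt, ?_,
      (V.connForm_velocity hΦd hd hD' hc').symm⟩
    have h1 : ContinuousAt (fun τ => V.pullConn q Φ D (z τ)) t := by
      have := (V.contDiffWithinAt_pullConn hΦ hD (hzD htI) (hq (hzD htI))).continuousWithinAt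
      exact this.tendsto.comp (tendsto_nhdsWithin_iff.2 ⟨hd.continuousAt, hD'⟩)
    have h2 : ContinuousAt (deriv z) t := by
      have := ((hzS t ht).fderiv_right (m := 0) (by simp)).continuousAt
      exact this.clm_apply continuousAt_const
    exact h1.clm_apply h2

/-- Short pieces of rectifiable paths are framed. -/
lemma UnitaryLineBundle.exists_isFramed [FiniteDimensional ℝ E] [T2Space M]
    (V : UnitaryLineBundle I M) {c : ℝ → M} {a b : ℝ} (h : IsRectifiablePath I c a b)
    {t₀ : ℝ} (ht₀ : t₀ ∈ Icc a b) :
    ∃ ε > 0, ∀ x y, a ≤ x → x ≤ y → y ≤ b → |x - t₀| < ε → |y - t₀| < ε →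
      ∃ A, V.IsFramed (c t₀) c x y A := by
  obtain ⟨ε, hε, hU, hint⟩ := h.exists_chart ht₀ ((V.isOpen_dom (c t₀)).mem_nhds (V.mem_dom_self _))
  obtain ⟨S, hS, hsm⟩ := h.smooth
  refine ⟨ε, hε, fun x y hx hxy hy hxε hyε => ?_⟩
  set q := c t₀
  have hsub : ∀ t ∈ Icc x y, t ∈ Icc a b ∧ |t - t₀| < ε := by
    intro t ht
    refine ⟨⟨hx.trans ht.1, ht.2.trans hy⟩, ?_⟩
    rw [abs_lt] at hxε hyε ⊢
    constructor <;> linarith [ht.1, ht.2]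
  have hsrc : ∀ t ∈ Icc x y, c t ∈ V.dom q ∩ (extChartAt I q).source := by
    intro t ht
    rw [extChartAt_source]
    exact hU t (hsub t ht).1 (hsub t ht).2
  obtain ⟨O, hO, hOeq⟩ := (continuousOn_iff'.1 (continuousOn_extChartAt_symm (I := I) q))
    _ (V.isOpen_dom q)
  have hmem : ∀ z, z ∈ (extChartAt I q).target ∩ O ↔ z ∈ (extChartAt I q).target ∧
      (extChartAt I q).symm z ∈ V.dom q := by
    intro z
    have : z ∈ O ∩ (extChartAt I q).target ↔
        z ∈ (extChartAt I q).symm ⁻¹' V.dom q ∩ (extChartAt I q).target := by rw [← hOeq]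
    constructor
    · intro hz; exact ⟨hz.1, (this.1 ⟨hz.2, hz.1⟩).1⟩
    · intro hz; exact ⟨hz.1, (this.2 ⟨hz.2, hz.1⟩).1⟩
  refine ⟨_, V.isFramed_of_coordinates (Φ := (extChartAt I q).symm)
    (D := (extChartAt I q).target ∩ O) (z := fun t => extChartAt I q (c t)) (S := S) hxy
    ((contMDiffOn_extChartAt_symm q).mono inter_subset_left)
    ((uniqueDiffOn_extChartAt_target q).inter hO) (fun z hz => ((hmem z).1 hz).2) ?_ ?_ hS ?_
    (hint x y hx hxy hy hxε hyε) ?_⟩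
  · intro t ht
    refine (hmem _).2 ⟨(extChartAt I q).map_source (hsrc t ht).2, ?_⟩
    rw [(extChartAt I q).left_inv (hsrc t ht).2]
    exact (hsrc t ht).1
  · exact (continuousOn_extChartAt q).comp (h.continuousOn.mono fun t ht => (hsub t ht).1)
      fun t ht => (hsrc t ht).2
  · intro t ht
    have h1 := hsm t ⟨⟨hx.trans_lt ht.1.1, ht.1.2.trans_le hy⟩, ht.2⟩
    have h2 : ContMDiffAt I 𝓘(ℝ, E) ∞ (extChartAt I q) (c t) :=
      contMDiffAt_extChartAt' (by
        have := (hsrc t (Ioo_subset_Icc_self ht.1)).2; rwa [extChartAt_source] at this)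
    exact contMDiffAt_iff_contDiffAt.1 (h2.comp t h1)
  · intro t ht
    exact ((extChartAt I q).left_inv (hsrc t ht).2).symm

end

/-! ### Existence and uniqueness of parallel transport -/

section Transport

variable {E H : Type*} [NormedAddCommGroup E] [NormedSpace ℝ E] [TopologicalSpace H]
  {I : ModelWithCorners ℝ E H} {M : Type*} [TopologicalSpace M] [ChartedSpace H M]
  [IsManifold I ∞ M]

namespace UnitaryLineBundle

variable {V : UnitaryLineBundle I M} {q : M} {c : ℝ → M} {a b : ℝ}

lemma totalSpace_eq_of_coord {u u' : TotalSpace ℂ V.fiber} (h : u.proj = u'.proj)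
    (hq : u.proj ∈ V.dom q) (hc : V.coord q u = V.coord q u') : u = u' := by
  obtain ⟨x, v⟩ := u
  obtain ⟨x', v'⟩ := u'
  obtain rfl : x = x' := h
  rw [coord_injective hq hc]

lemma IsFramed.par_unique {A : ℝ → ℂ} (h : V.IsFramed q c a b A) {u w w' : TotalSpace ℂ V.fiber}
    (hw : V.Par c a b u w) (hw' : V.Par c a b u w') : w = w' := by
  have e1 := hw.proj_right h.le
  have e2 := hw'.proj_right h.le
  obtain ⟨s, hs, rfl, rfl⟩ := hw
  obtain ⟨s', hs', hss, rfl⟩ := hw'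
  refine totalSpace_eq_of_coord (q := q) (e1.trans e2.symm) ?_ ?_
  · rw [e1]; exact h.mapsTo (right_mem_Icc.2 h.le)
  · rw [h.coord_lift hs, h.coord_lift hs', hss]

lemma IsFramed.par_coord {A : ℝ → ℂ} (h : V.IsFramed q c a b A) {u w : TotalSpace ℂ V.fiber}
    (hw : V.Par c a b u w) : V.coord q w = Complex.exp (-∫ t in a..b, A t) * V.coord q u := by
  obtain ⟨s, hs, rfl, rfl⟩ := hw
  exact h.coord_lift hs

lemma IsFramed.par_exists {A : ℝ → ℂ} (h : V.IsFramed q c a b A) {u : TotalSpace ℂ V.fiber}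
    (hu : u.proj = c a) : ∃ w, V.Par c a b u w := by
  obtain ⟨x, v⟩ := u
  obtain rfl : x = c a := hu
  obtain ⟨s, hs, hsa⟩ := h.exists_lift v
  exact ⟨s b, s, hs, hsa, rfl⟩

variable [FiniteDimensional ℝ E] [T2Space M]

/-- Parallel transport along a rectifiable path is unique, by subdivision of the path into framed
pieces. -/
lemma par_unique (h : IsRectifiablePath I c a b) {u w w' : TotalSpace ℂ V.fiber}
    (hw : V.Par c a b u w) (hw' : V.Par c a b u w') : w = w' := by
  have := interval_subdivision (Q := fun x y => ∀ u w w' : TotalSpace ℂ V.fiber,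
    V.Par c x y u w → V.Par c x y u w' → w = w') h.le ?_ ?_
  · exact this u w w' hw hw'
  · intro x y z _ hxy hyz _ h1 h2 u w w' hw hw'
    obtain ⟨m, hm1, hm2⟩ := hw.split hxy hyz
    obtain ⟨m', hm1', hm2'⟩ := hw'.split hxy hyz
    obtain rfl := h1 _ _ _ hm1 hm1'
    exact h2 _ _ _ hm2 hm2'
  · intro t ht
    obtain ⟨ε, hε, hf⟩ := V.exists_isFramed h ht
    refine ⟨ε, hε, fun x y hx hxy hy hxt hyt u w w' hw hw' => ?_⟩
    obtain ⟨A, hA⟩ := hf x y hx hxy hy hxt hyt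
    exact hA.par_unique hw hw'

/-- Parallel transport exists, and transports nonzero vectors to nonzero vectors. -/
lemma par_exists (h : IsRectifiablePath I c a b) {u : TotalSpace ℂ V.fiber} (hu : u.proj = c a) :
    ∃ w, V.Par c a b u w ∧ (u.2 ≠ 0 → w.2 ≠ 0) := by
  have := interval_subdivision (Q := fun x y => ∀ u : TotalSpace ℂ V.fiber, u.proj = c x →
    ∃ w, V.Par c x y u w ∧ (u.2 ≠ 0 → w.2 ≠ 0)) h.le ?_ ?_
  · exact this u hu
  · intro x y z _ hxy hyz _ h1 h2 u hu
    obtain ⟨w, hw, hw0⟩ := h1 u hu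
    obtain ⟨w', hw', hw0'⟩ := h2 w (hw.proj_right hxy)
    exact ⟨w', hw.trans hxy hyz hw', fun h => hw0' (hw0 h)⟩
  · intro t ht
    obtain ⟨ε, hε, hf⟩ := V.exists_isFramed h ht
    refine ⟨ε, hε, fun x y hx hxy hy hxt hyt u hu => ?_⟩
    obtain ⟨A, hA⟩ := hf x y hx hxy hy hxt hyt
    obtain ⟨w, hw⟩ := hA.par_exists hu
    refine ⟨w, hw, fun hu0 hw0 => hu0 ?_⟩
    have hc := hA.par_coord hw
    have hwq : w.proj ∈ V.dom (c t) := by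
      rw [hw.proj_right hxy]; exact hA.mapsTo (right_mem_Icc.2 hxy)
    have huq : u.proj ∈ V.dom (c t) := by rw [hu]; exact hA.mapsTo (left_mem_Icc.2 hxy)
    have hw1 : V.coord (c t) w = 0 := by
      have := coord_smul hwq 0 w.2
      rw [zero_smul, zero_mul, ← hw0] at this
      exact this
    rw [hw1] at hc
    have hu1 := (mul_eq_zero.1 hc.symm).resolve_left (Complex.exp_ne_zero _)
    rw [← coord_smul_frame huq u.2]
    change V.coord (c t) u • _ = _
    rw [hu1, zero_smul]

end UnitaryLineBundle

end Transport

/-! ### Holonomy, reparametrization and pullback -/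

section Transport

variable {E H : Type*} [NormedAddCommGroup E] [NormedSpace ℝ E] [TopologicalSpace H]
  {I : ModelWithCorners ℝ E H} {M : Type*} [TopologicalSpace M] [ChartedSpace H M]
  [IsManifold I ∞ M]
  {E' H' : Type*} [NormedAddCommGroup E'] [NormedSpace ℝ E'] [TopologicalSpace H']
  {I' : ModelWithCorners ℝ E' H'} {M' : Type*} [TopologicalSpace M'] [ChartedSpace H' M']
  [IsManifold I' ∞ M']

namespace UnitaryLineBundle

variable {V : UnitaryLineBundle I M} {q : M} {c : ℝ → M} {a b : ℝ}

lemma continuousWithinAt_of_coord {s : ℝ → TotalSpace ℂ V.fiber} {K : Set ℝ} {t : ℝ}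
    (hp : ContinuousWithinAt (fun τ => (s τ).proj) K t)
    (hc : ContinuousWithinAt (fun τ => V.coord (s t).proj (s τ)) K t) :
    ContinuousWithinAt s K t :=
  (FiberBundle.continuousWithinAt_totalSpace ℂ _).2 ⟨hp, hc⟩

lemma continuousOn_proj {s : ℝ → TotalSpace ℂ V.fiber} {K : Set ℝ} (hs : ContinuousOn s K) :
    ContinuousOn (fun τ => (s τ).proj) K :=
  (FiberBundle.continuous_proj ℂ V.fiber).comp_continuousOn hs

lemma coord_scale (l : ℂ) {u : TotalSpace ℂ V.fiber} (hu : u.proj ∈ V.dom q) :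
    V.coord q (scale l u) = l * V.coord q u := coord_smul hu l u.2

/-- Parallel transport is homogeneous. -/
lemma Par.scale {u w : TotalSpace ℂ V.fiber} (h : V.Par c a b u w) (l : ℂ) :
    V.Par c a b (scale l u) (scale l w) := by
  obtain ⟨s, hs, rfl, rfl⟩ := h
  refine ⟨fun t => UnitaryLineBundle.scale l (s t), ⟨fun t ht => hs.lift t ht, fun t ht => ?_, ?_⟩,
    rfl, rfl⟩
  · have hp := continuousOn_proj hs.continuousOn t ht
    refine continuousWithinAt_of_coord hp ?_
    have hev : ∀ᶠ τ in 𝓝[Icc a b] t, (s τ).proj ∈ V.dom (s t).proj :=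
      hp.eventually_mem ((isOpen_dom _).mem_nhds (mem_dom_self _))
    have h1 : ContinuousWithinAt (fun τ => V.coord (s t).proj (s τ)) (Icc a b) t :=
      ((FiberBundle.continuousWithinAt_totalSpace ℂ _).1 (hs.continuousOn t ht)).2
    refine (h1.const_mul l).congr_of_eventuallyEq ?_ ?_
    · filter_upwards [hev] with τ hτ using coord_scale l hτ
    · exact coord_scale l (mem_dom_self _)
  · obtain ⟨S, hS, hp⟩ := hs.parallel
    refine ⟨S, hS, fun t ht => ?_⟩
    obtain ⟨σ, f, f', h1, h2, h3, h4, h5⟩ := hp t ht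
    refine ⟨σ, fun τ => l * f τ, l * f', h1, h2, ?_, h4.const_mul l, ?_⟩
    · filter_upwards [h3] with τ hτ
      rw [hτ, mul_smul]
      rfl
    · rw [mul_smul, mul_smul, ← smul_add, h5, smul_zero]

/-- The holonomy along a rectifiable path is the parallel transport. -/
lemma isParallelTransport_hol [FiniteDimensional ℝ E] [T2Space M] (V : UnitaryLineBundle I M)
    (h : IsRectifiablePath I c a b) {x y : M} (hx : c a = x) (hy : c b = y) :
    V.IsParallelTransport c a b (V.hol c a b x y) := by
  subst hx hy
  have hex : ∃ T : V.fiber (c a) ≃ₗ[ℂ] V.fiber (c b), V.IsParallelTransport c a b T := by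
    set v₀ := V.frame (c a) (c a)
    have hv₀ : v₀ ≠ 0 := frame_ne_zero (mem_dom_self _)
    obtain ⟨⟨y, w⟩, hw, hw0⟩ := par_exists h (u := (⟨c a, v₀⟩ : TotalSpace ℂ V.fiber)) rfl
    obtain rfl : y = c b := hw.proj_right h.le
    replace hw0 : w ≠ 0 := hw0 hv₀
    -- Any linear isomorphism of the two lines becomes the parallel transport after rescaling: it
    -- only has to take the one vector `v₀` to its transport `w`.
    set e₀ := (V.nonempty_equiv (c a) (c b)).some
    have hlin : ∃ m : ℂ, e₀ v₀ = m • w := by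
      refine ⟨V.coord (c b) ⟨c b, e₀ v₀⟩ / V.coord (c b) ⟨c b, w⟩, ?_⟩
      refine coord_injective (mem_dom_self _) ?_
      rw [coord_smul (mem_dom_self _), div_mul_cancel₀]
      intro h0
      refine hw0 (coord_injective (mem_dom_self (c b)) ?_)
      rw [h0, ← zero_smul ℂ (0 : V.fiber (c b)), coord_smul (mem_dom_self _), zero_mul]
    obtain ⟨m, hm⟩ := hlin
    have hm0 : m ≠ 0 := by
      rintro rfl
      rw [zero_smul] at hm
      exact hv₀ (e₀.map_eq_zero_iff.1 hm)
    refine ⟨e₀.trans (LinearEquiv.smulOfNeZero ℂ _ m⁻¹ (inv_ne_zero hm0)), fun v => ?_⟩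
    have hv : v = V.coord (c a) ⟨c a, v⟩ • v₀ := (coord_smul_frame (mem_dom_self _) v).symm
    have hpar := hw.scale (V.coord (c a) ⟨c a, v⟩)
    obtain ⟨s, hs, hsa, hsb⟩ := hpar
    refine ⟨s, hs, hsa.trans ?_, hsb.trans ?_⟩
    · simp only [UnitaryLineBundle.scale]
      rw [← hv]
    · simp only [UnitaryLineBundle.scale]
      congr 1
      conv_rhs => rw [hv]
      rw [map_smul]
      congr 1
      simp only [LinearEquiv.trans_apply, hm]
      change w = m⁻¹ • m • w
      rw [inv_smul_smul₀ hm0]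
  rw [hol, dif_pos hex]
  exact hex.choose_spec

lemma par_hol [FiniteDimensional ℝ E] [T2Space M] (V : UnitaryLineBundle I M)
    (h : IsRectifiablePath I c a b) {x y : M} (hx : c a = x) (hy : c b = y) (v : V.fiber x) :
    V.Par c a b ⟨x, v⟩ ⟨y, V.hol c a b x y v⟩ := by
  obtain ⟨s, hs, h1, h2⟩ := V.isParallelTransport_hol h hx hy v
  exact ⟨s, hs, h1, h2⟩

end UnitaryLineBundle

/-- `f : [a', b'] → [a, b]` is injective and continuous, and smooth away from finitely many
points. -/
structure IsReparam (f : ℝ → ℝ) (a' b' a b : ℝ) : Prop where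
  le : a' ≤ b'
  continuousOn : ContinuousOn f (Icc a' b')
  injOn : InjOn f (Icc a' b')
  mapsTo : MapsTo f (Icc a' b') (Icc a b)
  smooth : ∃ S : Set ℝ, S.Finite ∧ ∀ t ∈ Ioo a' b' \ S, ContDiffAt ℝ ∞ f t

/-- The points of `[a', b']` whose image is an end point or an exceptional point are finitely
many. -/
lemma IsReparam.exists_finite {f : ℝ → ℝ} {a' b' a b : ℝ} (h : IsReparam f a' b' a b) {S : Set ℝ}
    (hS : S.Finite) : ∃ S' : Set ℝ, S'.Finite ∧ ∀ t ∈ Ioo a' b' \ S',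
      ContDiffAt ℝ ∞ f t ∧ f t ∈ Ioo a b \ S := by
  obtain ⟨S₁, hS₁, hsm⟩ := h.smooth
  have hfin : {t | t ∈ Icc a' b' ∧ f t ∈ S ∪ {a, b}}.Finite := by
    refine Set.Finite.of_finite_image (f := f) ?_ (h.injOn.mono fun t ht => ht.1)
    refine (hS.union (Set.toFinite {a, b})).subset ?_
    rintro _ ⟨t, ht, rfl⟩
    exact ht.2
  refine ⟨S₁ ∪ _, hS₁.union hfin, fun t ht => ⟨hsm t ⟨ht.1, fun hh => ht.2 (Or.inl hh)⟩, ?_⟩⟩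
  have htI := Ioo_subset_Icc_self ht.1
  have hn : f t ∉ S ∪ {a, b} := fun hh => ht.2 (Or.inr ⟨htI, hh⟩)
  have hm := h.mapsTo htI
  refine ⟨⟨lt_of_le_of_ne hm.1 fun e => hn (Or.inr (Or.inl e.symm)),
    lt_of_le_of_ne hm.2 fun e => hn (Or.inr (Or.inr e))⟩, fun hh => hn (Or.inl hh)⟩

omit [IsManifold I ∞ M] in
lemma velocity_comp {c : ℝ → M} {f : ℝ → ℝ} {t : ℝ} (hc : MDifferentiableAt 𝓘(ℝ, ℝ) I c (f t))
    (hf : DifferentiableAt ℝ f t) :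
    velocity I (fun τ => c (f τ)) t = deriv f t • velocity I c (f t) := by
  have h := (hc.hasMFDerivAt.comp t hf.hasFDerivAt.hasMFDerivAt).mfderiv
  have h1 : velocity I (fun τ => c (f τ)) t =
      (mfderiv 𝓘(ℝ, ℝ) I c (f t)).comp (fderiv ℝ f t) (1 : ℝ) :=
    congrArg (fun L : ℝ →L[ℝ] E => L 1) h
  rw [h1]
  have h2 : fderiv ℝ f t (1 : ℝ) = deriv f t • (1 : ℝ) := by simp
  change mfderiv 𝓘(ℝ, ℝ) I c (f t) (fderiv ℝ f t (1 : ℝ)) = _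
  rw [h2]
  exact (mfderiv 𝓘(ℝ, ℝ) I c (f t)).map_smul _ _

namespace UnitaryLineBundle

variable {V : UnitaryLineBundle I M} {q : M} {c : ℝ → M} {a b : ℝ}

/-- Horizontal lifts of a reparametrized path. The parametrization need not preserve the
orientation. -/
lemma IsHorizontalLift.comp {s : ℝ → TotalSpace ℂ V.fiber} (hs : V.IsHorizontalLift c a b s)
    {S : Set ℝ} (hS : S.Finite) (hc : ∀ t ∈ Ioo a b \ S, MDifferentiableAt 𝓘(ℝ, ℝ) I c t)
    {f : ℝ → ℝ} {a' b' : ℝ} (hf : IsReparam f a' b' a b) :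
    V.IsHorizontalLift (fun t => c (f t)) a' b' (fun t => s (f t)) where
  lift t ht := hs.lift _ (hf.mapsTo ht)
  continuousOn := hs.continuousOn.comp hf.continuousOn hf.mapsTo
  parallel := by
    obtain ⟨S₂, hS₂, hp⟩ := hs.parallel
    obtain ⟨S', hS', h'⟩ := hf.exists_finite (hS.union hS₂)
    refine ⟨S', hS', fun t ht => ?_⟩
    obtain ⟨hft, hI, hn⟩ := h' t ht
    obtain ⟨σ, g, g', h1, h2, h3, h4, h5⟩ := hp (f t) ⟨hI, fun hh => hn (Or.inr hh)⟩
    have hfd : DifferentiableAt ℝ f t := hft.differentiableAt (by simp)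
    refine ⟨σ, fun τ => g (f τ), deriv f t • g', h1, h2, hfd.continuousAt.eventually h3,
      h4.scomp t hfd.hasDerivAt, ?_⟩
    rw [velocity_comp (hc _ ⟨hI, fun hh => hn (Or.inl hh)⟩) hfd, map_smul,
      smul_comm (g (f t)), smul_assoc, ← smul_add, h5, smul_zero]

/-- Reparametrization by an increasing function does not change the parallel transport. -/
lemma Par.comp {u w : TotalSpace ℂ V.fiber} (h : V.Par c a b u w)
    {S : Set ℝ} (hS : S.Finite) (hc : ∀ t ∈ Ioo a b \ S, MDifferentiableAt 𝓘(ℝ, ℝ) I c t)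
    {f : ℝ → ℝ} {a' b' : ℝ} (hf : IsReparam f a' b' a b) (ha : f a' = a) (hb : f b' = b) :
    V.Par (fun t => c (f t)) a' b' u w := by
  obtain ⟨s, hs, rfl, rfl⟩ := h
  exact ⟨_, hs.comp hS hc hf, by rw [ha], by rw [hb]⟩

/-- Reparametrization by a decreasing function inverts the parallel transport. -/
lemma Par.comp_reverse {u w : TotalSpace ℂ V.fiber} (h : V.Par c a b u w)
    {S : Set ℝ} (hS : S.Finite) (hc : ∀ t ∈ Ioo a b \ S, MDifferentiableAt 𝓘(ℝ, ℝ) I c t)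
    {f : ℝ → ℝ} {a' b' : ℝ} (hf : IsReparam f a' b' a b) (ha : f a' = b) (hb : f b' = a) :
    V.Par (fun t => c (f t)) a' b' w u := by
  obtain ⟨s, hs, rfl, rfl⟩ := h
  exact ⟨_, hs.comp hS hc hf, by rw [ha], by rw [hb]⟩

lemma Par.congr {c' : ℝ → M} {u w : TotalSpace ℂ V.fiber} (h : V.Par c a b u w)
    (hc : EqOn c c' (Icc a b)) : V.Par c' a b u w := by
  obtain ⟨s, hs, rfl, rfl⟩ := h
  exact ⟨s, hs.congr hc, rfl, rfl⟩

/-- Parallel transport in a pulled back bundle. -/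
lemma PullbackIso.par {f : M → M'} {V' : UnitaryLineBundle I' M'}
    (e : V.PullbackIso f V') {S : Set ℝ} (hS : S.Finite)
    (hc : ContinuousOn c (Icc a b)) (hcd : ∀ t ∈ Ioo a b \ S, MDifferentiableAt 𝓘(ℝ, ℝ) I c t)
    (hf : ∀ t ∈ Ioo a b \ S, MDifferentiableAt I I' f (c t))
    {x y : M} (hx : c a = x) (hy : c b = y)
    {w : V'.fiber (f x)} {w' : V'.fiber (f y)}
    (h : V'.Par (fun t => f (c t)) a b ⟨f x, w⟩ ⟨f y, w'⟩) :
    V.Par c a b ⟨x, (e.equiv x).symm w⟩ ⟨y, (e.equiv y).symm w'⟩ := by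
  classical
  subst hx hy
  obtain ⟨s, hs, hsa, hsb⟩ := h
  -- A lift `s` of `f ∘ c` is pulled back fibrewise. The value `0` of `P x u` for `u` not over `f x`
  -- is never used, as `s t` lies over `f (c t)`.
  set P : ∀ (x : M) (u : TotalSpace ℂ V'.fiber), TotalSpace ℂ V.fiber := fun x u =>
    if h : u.proj = f x then ⟨x, (e.equiv x).symm (h ▸ u.2)⟩ else ⟨x, 0⟩ with hP
  have hPe : ∀ (x : M) (v : V'.fiber (f x)), P x ⟨f x, v⟩ = ⟨x, (e.equiv x).symm v⟩ :=
    fun x v => dif_pos rfl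
  refine ⟨fun t => P (c t) (s t), ⟨?_, fun t ht => ?_, ?_⟩, ?_, ?_⟩
  · intro t ht
    simp only [hP]
    split_ifs <;> rfl
  · set q' := f (c t)
    have hst : (s t).proj = q' := hs.lift t ht
    have hpc : ContinuousWithinAt (fun τ => (s τ).proj) (Icc a b) t :=
      continuousOn_proj hs.continuousOn t ht
    have hdom : ∀ᶠ τ in 𝓝[Icc a b] t, (s τ).proj ∈ V'.dom q' :=
      hpc.eventually_mem ((isOpen_dom _).mem_nhds (by
        show (s t).proj ∈ V'.dom q'
        rw [hst]
        exact mem_dom_self _))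
    -- Near `t` the pulled back lift is the pullback of the frame at `f (c t)`, multiplied by the
    -- coordinate of `s`.
    set τσ : ∀ x, V.fiber x := fun x => (e.equiv x).symm (V'.frame q' (f x)) with hτσ
    have hsmooth : SmoothSectionAt I τσ (c t) :=
      e.smooth (V'.frame q') (c t) (smoothSectionAt_frame (mem_dom_self _))
    have hform : ∀ τ ∈ Icc a b, (s τ).proj ∈ V'.dom q' →
        P (c τ) (s τ) = ⟨c τ, V'.coord q' (s τ) • τσ (c τ)⟩ := by
      intro τ hτ hd
      have hl := hs.lift τ hτ
      generalize hsτ : s τ = u at hl hd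
      obtain ⟨x', v⟩ := u
      obtain rfl : x' = f (c τ) := hl
      rw [hPe, hτσ]
      simp only
      rw [← map_smul, coord_smul_frame hd]
    have hproj : ∀ τ, (P (c τ) (s τ)).proj = c τ := by
      intro τ
      simp only [hP]
      split_ifs <;> rfl
    refine continuousWithinAt_of_coord ((hc t ht).congr (fun τ _ => hproj τ) (hproj t)) ?_
    rw [hproj t]
    have hcd : ∀ᶠ τ in 𝓝[Icc a b] t, c τ ∈ V.dom (c t) :=
      (hc t ht).eventually_mem ((isOpen_dom _).mem_nhds (mem_dom_self _))
    have hcoord : ContinuousWithinAt (fun τ => V'.coord q' (s τ)) (Icc a b) t := by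
      have := ((FiberBundle.continuousWithinAt_totalSpace ℂ _).1 (hs.continuousOn t ht)).2
      rw [hst] at this
      exact this
    have hτc : ContinuousWithinAt (fun τ => V.coord (c t) ⟨c τ, τσ (c τ)⟩) (Icc a b) t :=
      (contMDiffAt_coord hsmooth (mem_dom_self _)).continuousAt.comp_continuousWithinAt
        (f := c) (hc t ht)
    refine (hcoord.mul hτc).congr_of_eventuallyEq_of_mem ?_ ht
    filter_upwards [hdom, hcd, self_mem_nhdsWithin] with τ h1 h2 h3
    rw [hform τ h3 h1, coord_smul h2]
    rfl
  · obtain ⟨S', hS', hp⟩ := hs.parallel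
    refine ⟨S ∪ S', hS.union hS', fun t ht => ?_⟩
    obtain ⟨σ, g, g', h1, h2, h3, h4, h5⟩ := hp t ⟨ht.1, fun hh => ht.2 (Or.inr hh)⟩
    have htS : t ∈ Ioo a b \ S := ⟨ht.1, fun hh => ht.2 (Or.inl hh)⟩
    refine ⟨fun x => (e.equiv x).symm (σ (f x)), g, g', e.smooth σ (c t) h1, ?_, ?_, h4, ?_⟩
    · exact fun h0 => h2 ((e.equiv (c t)).symm.map_eq_zero_iff.1 h0)
    · filter_upwards [h3] with τ hτ
      rw [hτ, hPe, map_smul]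
    · rw [e.cov_eq σ (c t) h1]
      have hv : mfderiv I I' f (c t) (velocity I c t) = velocity I' (fun τ => f (c τ)) t := by
        have := ((hf t htS).hasMFDerivAt.comp t (hcd t htS).hasMFDerivAt).mfderiv
        exact (congrArg (fun L : ℝ →L[ℝ] E' => L 1) this).symm
      rw [hv, ← map_smul, ← map_smul, ← map_add, h5, map_zero]
  · simp only [hsa, hPe]
  · simp only [hsb, hPe]

end UnitaryLineBundle

end Transport

/-! ### Differential forms along maps -/

section FormsAlong

/-- Evaluation of alternating maps is jointly continuous. -/
lemma continuousWithinAt_alternating_apply {α F : Type*} [TopologicalSpace α]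
    [NormedAddCommGroup F] [NormedSpace ℝ F] {d : ℕ} {f : α → F [⋀^Fin d]→L[ℝ] ℝ}
    {w : α → Fin d → F} {s : Set α} {x : α} (hf : ContinuousWithinAt f s x)
    (hw : ContinuousWithinAt w s x) : ContinuousWithinAt (fun y => f y (w y)) s x := by
  have h1 : Filter.Tendsto (fun y => (f y - f x) (w y)) (𝓝[s] x) (𝓝 0) := by
    refine squeeze_zero_norm (a := fun y => ‖f y - f x‖ * ∏ i, ‖w y i‖)
      (fun y => (f y - f x).le_opNorm (w y)) ?_
    have h2 : Filter.Tendsto (fun y => ‖f y - f x‖) (𝓝[s] x) (𝓝 0) := by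
      have := (hf.sub (continuousWithinAt_const (b := f x))).norm
      simpa [ContinuousWithinAt] using this
    have h3 : Filter.Tendsto (fun y => ∏ i, ‖w y i‖) (𝓝[s] x) (𝓝 (∏ i, ‖w x i‖)) :=
      tendsto_finsetProd _ fun i _ => ((continuousWithinAt_pi.1 hw i).norm).tendsto
    simpa using h2.mul h3
  have h4 : Filter.Tendsto (fun y => f x (w y)) (𝓝[s] x) (𝓝 (f x (w x))) :=
    ((f x).cont.continuousAt.comp_continuousWithinAt hw).tendsto
  have h5 := h1.add h4
  rw [zero_add] at h5
  refine h5.congr fun y => ?_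
  simp

variable {E H : Type*} [NormedAddCommGroup E] [NormedSpace ℝ E] [TopologicalSpace H]
  {I : ModelWithCorners ℝ E H} {M : Type*} [TopologicalSpace M] [ChartedSpace H M]
  {F : Type*} [NormedAddCommGroup F] [NormedSpace ℝ F] {d : ℕ}

/-- The pullback of a form by a map `Ξ` from a subset `D` of a vector space, evaluated on constant
vectors. -/
def Form.along (σ : Form I M d) (Ξ : F → M) (D : Set F) (z : F) (v : Fin d → F) : ℝ :=
  σ (Ξ z) (fun i => mfderivWithin 𝓘(ℝ, F) I Ξ D z (v i))

/-- The pullback by `Ξ` is computed in the chart at `x₀`: this reduces its regularity to that of the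
local expression of the form. -/
lemma Form.along_eq_inChart [IsManifold I ∞ M] (σ : Form I M d) {Ξ : F → M} {D : Set F}
    (hΞ : ContMDiffOn 𝓘(ℝ, F) I ∞ Ξ D) (hD : UniqueDiffOn ℝ D) {x₀ : M} {z : F} (hz : z ∈ D)
    (hx : Ξ z ∈ (chartAt H x₀).source) (v : Fin d → F) :
    σ.along Ξ D z v = σ.inChart x₀ (extChartAt I x₀ (Ξ z))
      (fun i => fderivWithin ℝ (fun y => extChartAt I x₀ (Ξ y)) D z (v i)) := by
  have hx' : Ξ z ∈ (extChartAt I x₀).source := by rwa [extChartAt_source]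
  have hleft : (extChartAt I x₀).symm (extChartAt I x₀ (Ξ z)) = Ξ z := (extChartAt I x₀).left_inv hx'
  have hζ : MDifferentiableWithinAt 𝓘(ℝ, F) 𝓘(ℝ, E) (fun y => extChartAt I x₀ (Ξ y)) D z :=
    ((contMDiffAt_extChartAt' (n := ∞) hx).comp_contMDiffWithinAt z
      (hΞ z hz)).mdifferentiableWithinAt (by simp)
  have hsymm : MDifferentiableWithinAt 𝓘(ℝ, E) I (extChartAt I x₀).symm (range I)
      (extChartAt I x₀ (Ξ z)) :=
    (contMDiffWithinAt_extChartAt_symm_range (n := ∞) x₀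
      ((extChartAt I x₀).map_source hx')).mdifferentiableWithinAt (by simp)
  have hev : ∀ᶠ y in 𝓝[D] z, Ξ y ∈ (extChartAt I x₀).source :=
    (hΞ z hz).continuousWithinAt.eventually_mem
      ((isOpen_extChartAt_source x₀).mem_nhds hx')
  have hcomp : mfderivWithin 𝓘(ℝ, F) I ((extChartAt I x₀).symm ∘ fun y => extChartAt I x₀ (Ξ y)) D z
      = (mfderivWithin 𝓘(ℝ, E) I (extChartAt I x₀).symm (range I) (extChartAt I x₀ (Ξ z))).comp
        (mfderivWithin 𝓘(ℝ, F) 𝓘(ℝ, E) (fun y => extChartAt I x₀ (Ξ y)) D z) := by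
    refine mfderivWithin_comp z hsymm hζ ?_ (hD.uniqueMDiffOn z hz)
    intro y _
    exact mem_range_self (chartAt H x₀ (Ξ y))
  have hcongr : mfderivWithin 𝓘(ℝ, F) I ((extChartAt I x₀).symm ∘ fun y => extChartAt I x₀ (Ξ y)) D z
      = mfderivWithin 𝓘(ℝ, F) I Ξ D z := by
    refine Filter.EventuallyEq.mfderivWithin_eq ?_ hleft
    filter_upwards [hev] with y hy using (extChartAt I x₀).left_inv hy
  rw [hcomp, mfderivWithin_eq_fderivWithin] at hcongr
  have key : ∀ y, y = Ξ z → ∀ L : F →L[ℝ] E, L = mfderivWithin 𝓘(ℝ, F) I Ξ D z →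
      σ y (fun i => L (v i)) = σ (Ξ z) (fun i => mfderivWithin 𝓘(ℝ, F) I Ξ D z (v i)) := by
    rintro _ rfl _ rfl
    rfl
  exact (key _ hleft _ hcongr).symm

/-- The coefficients of the pullback of a smooth form by a smooth map are continuous. -/
lemma Form.continuousWithinAt_along [IsManifold I ∞ M] {σ : Form I M d} (hσ : σ.IsSmooth)
    {Ξ : F → M} {D : Set F} (hΞ : ContMDiffOn 𝓘(ℝ, F) I ∞ Ξ D) (hD : UniqueDiffOn ℝ D)
    {z : F} (hz : z ∈ D) (v : Fin d → F) :
    ContinuousWithinAt (fun y => σ.along Ξ D y v) D z := by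
  set x₀ := Ξ z
  set D' := D ∩ Ξ ⁻¹' (extChartAt I x₀).source
  have hD' : D' ∈ 𝓝[D] z := Filter.inter_mem self_mem_nhdsWithin
    ((hΞ z hz).continuousWithinAt ((isOpen_extChartAt_source x₀).mem_nhds
      (mem_extChartAt_source x₀)))
  have hζ : ContDiffOn ℝ ∞ (fun y => extChartAt I x₀ (Ξ y)) D' := by
    rw [← contMDiffOn_iff_contDiffOn]
    exact (contMDiffOn_extChartAt (n := ∞)).comp (hΞ.mono inter_subset_left)
      fun y hy => by simpa [extChartAt_source] using hy.2
  have hζz : ContDiffWithinAt ℝ ∞ (fun y => extChartAt I x₀ (Ξ y)) D z :=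
    (hζ z ⟨hz, mem_extChartAt_source x₀⟩).mono_of_mem_nhdsWithin hD'
  have hζc : ContinuousWithinAt (fun y => extChartAt I x₀ (Ξ y)) D' z :=
    hζz.continuousWithinAt.mono inter_subset_left
  have hder : ContinuousWithinAt (fderivWithin ℝ (fun y => extChartAt I x₀ (Ξ y)) D) D z :=
    (hζz.fderivWithin_right (m := 0) hD (by simp) hz).continuousWithinAt
  have h1 : ContinuousWithinAt (fun y => σ.inChart x₀ (extChartAt I x₀ (Ξ y))) D' z :=
    ContinuousWithinAt.comp (t := (extChartAt I x₀).target) (f := fun y => extChartAt I x₀ (Ξ y))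
      ((hσ x₀).continuousOn _ (mem_extChartAt_target x₀)) hζc
      fun y hy => (extChartAt I x₀).map_source hy.2
  have h2 : ContinuousWithinAt (fun y i => fderivWithin ℝ (fun y => extChartAt I x₀ (Ξ y)) D y (v i))
      D' z := by
    refine continuousWithinAt_pi.2 fun i => ?_
    exact (hder.mono inter_subset_left).clm_apply continuousWithinAt_const
  refine ((continuousWithinAt_alternating_apply h1 h2).congr ?_ ?_).mono_of_mem_nhdsWithin hD'
  · intro y hy
    exact σ.along_eq_inChart hΞ hD hy.1 (by simpa [extChartAt_source] using hy.2) v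
  · exact σ.along_eq_inChart hΞ hD hz (mem_chart_source H x₀) v

/-- The exterior derivative of a smooth function is a smooth 1-form. -/
lemma exists_isSmooth_differential [IsManifold I ∞ M] {g : M → ℝ} (hg : ContMDiff I 𝓘(ℝ, ℝ) ∞ g) :
    ∃ α : Form I M 1, α.IsSmooth ∧ ∀ (x : M) (v : TangentSpace I x),
      α x ![v] = mfderiv I 𝓘(ℝ, ℝ) g x v := by
  refine ⟨fun x => ContinuousAlternatingMap.ofSubsingleton ℝ (TangentSpace I x) ℝ 0
    (mfderiv I 𝓘(ℝ, ℝ) g x), ?_, fun x v => rfl⟩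
  intro x₀
  have h1 : ContDiffOn ℝ ∞ (g ∘ (extChartAt I x₀).symm) (extChartAt I x₀).target := by
    rw [← contMDiffOn_iff_contDiffOn]
    exact hg.comp_contMDiffOn (contMDiffOn_extChartAt_symm x₀)
  have h2 : ContDiffOn ℝ ∞ (fderivWithin ℝ (g ∘ (extChartAt I x₀).symm) (range I))
      (extChartAt I x₀).target := by
    intro y hy
    have h3 : ContDiffWithinAt ℝ ∞ (g ∘ (extChartAt I x₀).symm) (range I) y :=
      (h1 y hy).mono_of_mem_nhdsWithin (extChartAt_target_mem_nhdsWithin_of_mem hy)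
    exact (h3.fderivWithin_right (m := ∞) I.uniqueDiffOn (by simp)
      (extChartAt_target_subset_range x₀ hy)).mono (extChartAt_target_subset_range x₀)
  have h4 : ContDiffOn ℝ ∞ (fun y => ContinuousAlternatingMap.ofSubsingletonLIE (𝕜 := ℝ) (E := E) (F := ℝ) (0 : Fin 1)
      (fderivWithin ℝ (g ∘ (extChartAt I x₀).symm) (range I) y)) (extChartAt I x₀).target :=
    (ContinuousLinearEquiv.contDiff
      (ContinuousAlternatingMap.ofSubsingletonLIE (𝕜 := ℝ) (E := E) (F := ℝ) (0 : Fin 1)).toContinuousLinearEquiv).comp_contDiffOn h2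
  refine h4.congr fun y hy => ?_
  ext v
  have h5 : mfderivWithin 𝓘(ℝ, E) 𝓘(ℝ, ℝ) (g ∘ (extChartAt I x₀).symm) (range I) y =
      (mfderiv I 𝓘(ℝ, ℝ) g ((extChartAt I x₀).symm y)).comp
        (mfderivWithin 𝓘(ℝ, E) I (extChartAt I x₀).symm (range I) y) :=
    mfderiv_comp_mfderivWithin y ((hg _).mdifferentiableAt (by simp))
      (mdifferentiableWithinAt_extChartAt_symm hy)
      (I.uniqueDiffOn.uniqueMDiffOn y (extChartAt_target_subset_range x₀ hy))
  rw [mfderivWithin_eq_fderivWithin] at h5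
  have := congrArg (fun L : E →L[ℝ] ℝ => L (v 0)) h5
  exact this.symm

end FormsAlong

/-! ### Piecewise smooth paths -/

section Paths

variable {E H : Type*} [NormedAddCommGroup E] [NormedSpace ℝ E] [TopologicalSpace H]
  {I : ModelWithCorners ℝ E H} {M : Type*} [TopologicalSpace M] [ChartedSpace H M]
  {E' H' : Type*} [NormedAddCommGroup E'] [NormedSpace ℝ E'] [TopologicalSpace H']
  {I' : ModelWithCorners ℝ E' H'} {M' : Type*} [TopologicalSpace M'] [ChartedSpace H' M']
  {c c' : ℝ → M} {a b : ℝ}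

/-- The differential of a smooth function is a smooth 1-form, hence integrable along the path. -/
lemma IsPiecewiseSmoothPath.isRectifiablePath [IsManifold I ∞ M]
    (h : IsPiecewiseSmoothPath I c a b) (hab : a ≤ b) : IsRectifiablePath I c a b where
  le := hab
  continuousOn := h.continuousOn
  smooth := h.smooth
  integrable g hg := by
    obtain ⟨α, hα, hαg⟩ := exists_isSmooth_differential hg
    obtain ⟨S, hS, hsm⟩ := h.smooth
    refine intervalIntegrable_congr_off_finite hab hS (fun t ht => ?_) (h.rectifiable α hα)
    rw [hαg]
    have h1 := ((hg (c t)).mdifferentiableAt (by simp)).hasMFDerivAt.comp t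
      ((hsm t ht).mdifferentiableAt (by simp)).hasMFDerivAt
    have h2 := h1.mfderiv
    rw [mfderiv_eq_fderiv] at h2
    have h3 : fderiv ℝ (g ∘ c) t 1 = mfderiv I 𝓘(ℝ, ℝ) g (c t) (velocity I c t) :=
      congrArg (fun L : ℝ →L[ℝ] ℝ => L 1) h2
    rw [← h3, fderiv_apply_one_eq_deriv]
    rfl

lemma velocity_congr {t : ℝ} (h : c =ᶠ[𝓝 t] c') :
    (velocity I c t : E) = velocity I c' t := by
  have : (mfderiv 𝓘(ℝ, ℝ) I c t : ℝ →L[ℝ] E) = mfderiv 𝓘(ℝ, ℝ) I c' t := h.mfderiv_eq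
  exact congrArg (fun L : ℝ →L[ℝ] E => L 1) this

lemma form_one_congr {x y : M} (α : Form I M 1) (h : x = y) {v w : E} (hv : v = w) :
    α x ![v] = α y ![w] := by
  subst h hv
  rfl

lemma form_two_congr {x y : M} (α : Form I M 2) (h : x = y) {v w v' w' : E} (hv : v = v')
    (hw : w = w') : α x ![v, w] = α y ![v', w'] := by
  subst h hv hw
  rfl

lemma form_one_smul (α : Form I M 1) (x : M) (r : ℝ) (v : TangentSpace I x) :
    α x ![r • v] = r * α x ![v] := by
  have h := (α x).map_update_smul ![v] 0 r v
  have e : ∀ w : TangentSpace I x, update ![v] 0 w = ![w] := fun w => by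
    ext i
    fin_cases i
    rfl
  rwa [e, e] at h

lemma form_velocity_congr {t : ℝ} (α : Form I M 1) (h : c =ᶠ[𝓝 t] c') :
    α (c t) ![velocity I c t] = α (c' t) ![velocity I c' t] :=
  form_one_congr α h.eq_of_nhds (velocity_congr h)

lemma eventuallyEq_of_eqOn_Icc {α : Type*} {f g : ℝ → α} {t : ℝ} (h : EqOn f g (Icc a b))
    (ht : t ∈ Ioo a b) : f =ᶠ[𝓝 t] g := by
  filter_upwards [Icc_mem_nhds ht.1 ht.2] with τ hτ using h hτ

lemma IsPiecewiseSmoothPath.congr (h : IsPiecewiseSmoothPath I c a b) (hab : a ≤ b)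
    (hc : EqOn c c' (Icc a b)) : IsPiecewiseSmoothPath I c' a b where
  continuousOn := h.continuousOn.congr hc.symm
  smooth := by
    obtain ⟨S, hS, hsm⟩ := h.smooth
    exact ⟨S, hS, fun t ht =>
      (hsm t ht).congr_of_eventuallyEq (eventuallyEq_of_eqOn_Icc hc ht.1).symm⟩
  rectifiable α hα := intervalIntegrable_congr_off_finite hab finite_empty
    (fun _ ht => form_velocity_congr α (eventuallyEq_of_eqOn_Icc hc ht.1)) (h.rectifiable α hα)

lemma IsPiecewiseSmoothPath.trans {m : ℝ} (h : IsPiecewiseSmoothPath I c a m)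
    (h' : IsPiecewiseSmoothPath I c m b) (ham : a ≤ m) (hmb : m ≤ b) :
    IsPiecewiseSmoothPath I c a b where
  continuousOn := by
    rw [← Icc_union_Icc_eq_Icc ham hmb]
    exact h.continuousOn.union_of_isClosed h'.continuousOn isClosed_Icc isClosed_Icc
  smooth := by
    obtain ⟨S, hS, hsm⟩ := h.smooth
    obtain ⟨S', hS', hsm'⟩ := h'.smooth
    refine ⟨S ∪ S' ∪ {m}, (hS.union hS').union (finite_singleton m), fun t ht => ?_⟩
    simp only [mem_sdiff, mem_union, mem_singleton_iff, not_or] at ht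
    obtain ⟨⟨h1, h2⟩, ⟨h3, h4⟩, h5⟩ := ht
    rcases lt_or_gt_of_ne h5 with h6 | h6
    · exact hsm t ⟨⟨h1, h6⟩, h3⟩
    · exact hsm' t ⟨⟨h6, h2⟩, h4⟩
  rectifiable α hα := (h.rectifiable α hα).trans (h'.rectifiable α hα)

/-- A path which is smooth up to the end points. -/
lemma IsRectifiablePath.of_contMDiffOn (hab : a < b) (hc : ContMDiffOn 𝓘(ℝ, ℝ) I ∞ c (Icc a b)) :
    IsRectifiablePath I c a b where
  le := hab.le
  continuousOn := hc.continuousOn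
  smooth := ⟨∅, finite_empty, fun t ht => hc.contMDiffAt (Icc_mem_nhds ht.1.1 ht.1.2)⟩
  integrable g hg := by
    have h1 : ContDiffOn ℝ ∞ (fun t => g (c t)) (Icc a b) := by
      rw [← contMDiffOn_iff_contDiffOn]
      exact hg.comp_contMDiffOn hc
    have h2 : ContinuousOn (derivWithin (fun t => g (c t)) (Icc a b)) (Icc a b) :=
      h1.continuousOn_derivWithin (uniqueDiffOn_Icc hab) (by simp)
    refine intervalIntegrable_congr_off_finite hab.le finite_empty (fun t ht => ?_)
      (h2.intervalIntegrable_of_Icc hab.le)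
    exact derivWithin_of_mem_nhds (Icc_mem_nhds ht.1.1 ht.1.2)

lemma IsPiecewiseSmoothPath.of_contMDiffOn [IsManifold I ∞ M] (hab : a < b)
    (hc : ContMDiffOn 𝓘(ℝ, ℝ) I ∞ c (Icc a b)) : IsPiecewiseSmoothPath I c a b where
  continuousOn := hc.continuousOn
  smooth := ⟨∅, finite_empty, fun t ht => hc.contMDiffAt (Icc_mem_nhds ht.1.1 ht.1.2)⟩
  rectifiable α hα := by
    have h1 : ContinuousOn (fun t => α.along c (Icc a b) t ![1]) (Icc a b) := fun t ht =>
      Form.continuousWithinAt_along hα hc (uniqueDiffOn_Icc hab) ht _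
    refine intervalIntegrable_congr_off_finite hab.le finite_empty (fun t ht => ?_)
      (h1.intervalIntegrable_of_Icc hab.le)
    simp only [Form.along, velocity]
    rw [mfderivWithin_of_mem_nhds (Icc_mem_nhds ht.1.1 ht.1.2)]
    congr 1
    ext i
    fin_cases i
    rfl

/-- The image of a rectifiable path under a smooth map. -/
lemma IsRectifiablePath.comp_left (h : IsRectifiablePath I c a b) {f : M → M'}
    (hf : ContMDiff I I' ∞ f) : IsRectifiablePath I' (fun t => f (c t)) a b where
  le := h.le
  continuousOn := hf.continuous.comp_continuousOn h.continuousOn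
  smooth := by
    obtain ⟨S, hS, hsm⟩ := h.smooth
    exact ⟨S, hS, fun t ht => (hf _).comp t (hsm t ht)⟩
  integrable g hg := h.integrable (fun x => g (f x)) (hg.comp hf)

/-- An injective reparametrization, smooth away from finitely many points, of a piecewise smooth
path is piecewise smooth. -/
lemma IsPiecewiseSmoothPath.comp (h : IsPiecewiseSmoothPath I c a b) (hab : a ≤ b) {f : ℝ → ℝ}
    {a' b' : ℝ} (hf : IsReparam f a' b' a b) :
    IsPiecewiseSmoothPath I (fun t => c (f t)) a' b' where
  continuousOn := h.continuousOn.comp hf.continuousOn hf.mapsTo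
  smooth := by
    obtain ⟨S, hS, hsm⟩ := h.smooth
    obtain ⟨S', hS', h'⟩ := hf.exists_finite hS
    exact ⟨S', hS', fun t ht => ContMDiffAt.comp t (hsm _ (h' t ht).2) (h' t ht).1.contMDiffAt⟩
  rectifiable α hα := by
    obtain ⟨S, hS, hsm⟩ := h.smooth
    obtain ⟨S', hS', h'⟩ := hf.exists_finite hS
    set s := Ioo a' b' \ S'
    have hs : MeasurableSet s := measurableSet_Ioo.diff hS'.measurableSet
    have hsub : f '' s ⊆ Ioc a b := by
      rintro _ ⟨t, ht, rfl⟩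
      exact ⟨(h' t ht).2.1.1, (h' t ht).2.1.2.le⟩
    -- The change of variables formula gives the integrability of the pulled back 1-form multiplied
    -- by the sign of the derivative of `f`.
    have hint := ((intervalIntegrable_iff_integrableOn_Ioc_of_le hab).1 (h.rectifiable α hα)).mono_set
      hsub
    have hder : ∀ t ∈ s, HasDerivWithinAt f (deriv f t) s t := fun t ht =>
      ((h' t ht).1.differentiableAt (by simp)).hasDerivAt.hasDerivWithinAt
    have hinj : InjOn f s := hf.injOn.mono (sdiff_subset.trans Ioo_subset_Icc_self)
    rw [MeasureTheory.integrableOn_image_iff_integrableOn_abs_deriv_smul hs hder hinj] at hint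
    -- multiplication by the sign of the derivative
    have hvel : ∀ t ∈ s, α (c (f t)) ![velocity I (fun t => c (f t)) t] =
        deriv f t * α (c (f t)) ![velocity I c (f t)] := by
      intro t ht
      have e1 := velocity_comp (I := I) (c := c)
        ((hsm _ (h' t ht).2).mdifferentiableAt (by simp))
        ((h' t ht).1.differentiableAt (by simp))
      rw [form_one_congr α rfl e1]
      exact form_one_smul α _ _ _
    have hmeas : MeasureTheory.AEStronglyMeasurable (fun t => (SignType.sign (deriv f t) : ℝ))
        (MeasureTheory.volume.restrict s) := by
      refine Measurable.aestronglyMeasurable ?_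
      have h1 : Measurable (deriv f) := measurable_deriv f
      have h2 : (fun t => (SignType.sign (deriv f t) : ℝ)) =
          fun t => if 0 < deriv f t then 1 else if deriv f t < 0 then -1 else 0 := by
        ext t
        simp only [sign_apply]
        split_ifs <;> simp
      rw [h2]
      exact Measurable.ite (measurableSet_lt measurable_const h1) measurable_const
        (Measurable.ite (measurableSet_lt h1 measurable_const) measurable_const measurable_const)
    have hint2 : MeasureTheory.IntegrableOn (fun t => (SignType.sign (deriv f t) : ℝ) *
        (|deriv f t| • α (c (f t)) ![velocity I c (f t)])) s := by
      refine MeasureTheory.Integrable.bdd_mul hint hmeas (c := 1) ?_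
      refine Filter.Eventually.of_forall fun t => ?_
      rcases lt_trichotomy (deriv f t) 0 with h0 | h0 | h0 <;> simp [h0]
    have hint3 : MeasureTheory.IntegrableOn
        (fun t => α (c (f t)) ![velocity I (fun t => c (f t)) t]) s := by
      refine hint2.congr_fun (fun t ht => ?_) hs
      simp only [smul_eq_mul]
      rw [← mul_assoc, sign_mul_abs, hvel t ht]
    rw [intervalIntegrable_iff_integrableOn_Ioo_of_le hf.le]
    refine hint3.congr_set_ae ?_
    refine Filter.EventuallyEq.symm (MeasureTheory.sdiff_null_ae_eq_self (hS'.measure_zero _))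

end Paths

/-! ### The curvature in coordinates -/

section Curvature

variable {E H : Type*} [NormedAddCommGroup E] [NormedSpace ℝ E] [FiniteDimensional ℝ E]
  [TopologicalSpace H]
  {I : ModelWithCorners ℝ E H} {M : Type*} [TopologicalSpace M] [ChartedSpace H M]
  [IsManifold I ∞ M] [T2Space M] {F : Type*} [NormedAddCommGroup F] [NormedSpace ℝ F]
  [FiniteDimensional ℝ F]

/-- The constant vector field on a vector space. -/
def constField (v : F) : ∀ z : F, TangentSpace 𝓘(ℝ, F) z := fun _ => v

omit [FiniteDimensional ℝ F] in
lemma mlieBracket_constField (v w : F) (z : F) :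
    VectorField.mlieBracket 𝓘(ℝ, F) (constField v) (constField w) z = 0 := by
  rw [← VectorField.mlieBracketWithin_univ, VectorField.mlieBracketWithin_eq_lieBracketWithin]
  change VectorField.lieBracketWithin ℝ (fun _ : F => v) (fun _ => w) univ z = 0
  simp [VectorField.lieBracketWithin]

omit [FiniteDimensional ℝ F] in
lemma contMDiffAt_constField (v z : F) : CMDiffAt ∞ (T% (constField v)) z := by
  refine (contMDiffAt_section _).2 ?_
  simpa [constField] using contMDiffAt_const

/-- In coordinates around a point where the base has no boundary, the exterior derivative of the
connection form of a local frame is the curvature form. -/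
lemma UnitaryLineBundle.HasCurvature.fderiv_pullConn {V : UnitaryLineBundle I M} {β : Form I M 2}
    (hV : V.HasCurvature β) {q : M} {Φ : F → M} {Ψ : M → F} {D : Set F}
    (hD : IsOpen D) (hΦ : ContMDiffOn 𝓘(ℝ, F) I ∞ Φ D) {z₀ : F} (hz₀ : z₀ ∈ D)
    (hq : Φ z₀ ∈ V.dom q) (hΨ : ContMDiffAt I 𝓘(ℝ, F) ∞ Ψ (Φ z₀))
    (hΨΦ : ∀ᶠ z in 𝓝 z₀, Ψ (Φ z) = z) (hΦΨ : ∀ᶠ y in 𝓝 (Φ z₀), Φ (Ψ y) = y) (v w : F) :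
    fderiv ℝ (fun z => V.pullConn q Φ D z w) z₀ v - fderiv ℝ (fun z => V.pullConn q Φ D z v) z₀ w =
      2 * Real.pi * Complex.I * (β (Φ z₀) ![mfderiv 𝓘(ℝ, F) I Φ z₀ v, mfderiv 𝓘(ℝ, F) I Φ z₀ w] : ℂ)
      := by
  have : CompleteSpace E := FiniteDimensional.complete ℝ E
  have : CompleteSpace F := FiniteDimensional.complete ℝ F
  have : IsManifold I (minSmoothness ℝ 3) M := by
    rw [minSmoothness_of_isRCLikeNormedField]
    exact IsManifold.of_le (n := ∞) (by norm_cast)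
  have : IsManifold I (∞ + 1) M := by
    simpa using (inferInstance : IsManifold I ∞ M)
  set y₀ := Φ z₀ with hy₀
  have hz : Ψ y₀ = z₀ := hΨΦ.self_of_nhds
  -- the vector fields on the base which are constant in the coordinates
  set X : F → ∀ y : M, TangentSpace I y := fun v =>
    VectorField.mpullback I 𝓘(ℝ, F) Ψ (constField v) with hX
  have hΦat : ∀ z ∈ D, ContMDiffAt 𝓘(ℝ, F) I ∞ Φ z := fun z hz => hΦ.contMDiffAt (hD.mem_nhds hz)
  have hinv : ∀ᶠ z in 𝓝 z₀, (mfderiv I 𝓘(ℝ, F) Ψ (Φ z)).IsInvertible ∧ ∀ v : F,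
      X v (Φ z) = mfderiv 𝓘(ℝ, F) I Φ z v := by
    have e1 : ∀ᶠ y in 𝓝 y₀, ContMDiffAt I 𝓘(ℝ, F) 1 Ψ y :=
      (contMDiffAt_iff_contMDiffAt_nhds (by simp)).1
        (ContMDiffAt.of_le hΨ (by norm_cast))
    have hΦc : ContinuousAt Φ z₀ := (hΦat z₀ hz₀).continuousAt
    filter_upwards [hΨΦ.eventually_nhds, hΦc.eventually hΦΨ.eventually_nhds, hΦc.eventually e1,
      hD.mem_nhds hz₀] with z h1 h2 h3 h4
    have hzz : Ψ (Φ z) = z := h1.self_of_nhds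
    have d1 : MDifferentiableAt I 𝓘(ℝ, F) Ψ (Φ z) := h3.mdifferentiableAt (by simp)
    have d2 : MDifferentiableAt 𝓘(ℝ, F) I Φ z := (hΦat z h4).mdifferentiableAt (by simp)
    have c1 : (mfderiv I 𝓘(ℝ, F) Ψ (Φ z)).comp (mfderiv 𝓘(ℝ, F) I Φ z) =
        ContinuousLinearMap.id ℝ F := by
      have h := mfderiv_comp z d1 d2
      have h' : mfderiv 𝓘(ℝ, F) 𝓘(ℝ, F) (Ψ ∘ Φ) z = mfderiv 𝓘(ℝ, F) 𝓘(ℝ, F) id z :=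
        Filter.EventuallyEq.mfderiv_eq h1
      rw [h', mfderiv_id] at h
      exact h.symm
    have c2 : (mfderiv 𝓘(ℝ, F) I Φ z).comp (mfderiv I 𝓘(ℝ, F) Ψ (Φ z)) =
        ContinuousLinearMap.id ℝ E := by
      have h := mfderiv_comp_of_eq d2 d1 hzz
      have h' : mfderiv I I (Φ ∘ Ψ) (Φ z) = mfderiv I I id (Φ z) :=
        Filter.EventuallyEq.mfderiv_eq h2
      rw [h', mfderiv_id] at h
      have hzz' : (mfderiv 𝓘(ℝ, F) I Φ (Ψ (Φ z)) : F →L[ℝ] E) = mfderiv 𝓘(ℝ, F) I Φ z := by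
        have : ∀ y, y = z → (mfderiv 𝓘(ℝ, F) I Φ y : F →L[ℝ] E) = mfderiv 𝓘(ℝ, F) I Φ z := by
          rintro _ rfl
          rfl
        exact this _ hzz
      exact (h.trans (congrArg (fun L : F →L[ℝ] E => L.comp
        (mfderiv I 𝓘(ℝ, F) Ψ (Φ z) : E →L[ℝ] F)) hzz')).symm
    have hi : (mfderiv I 𝓘(ℝ, F) Ψ (Φ z)).IsInvertible :=
      ContinuousLinearMap.IsInvertible.of_inverse c1 c2
    have haux : ∀ (L : E →L[ℝ] F) (L' : F →L[ℝ] E), L.comp L' = ContinuousLinearMap.id ℝ F →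
        L'.comp L = ContinuousLinearMap.id ℝ E → L.inverse = L' := fun L L' e e' =>
      ContinuousLinearMap.inverse_eq e e'
    exact ⟨hi, fun v => congrArg (fun L : F →L[ℝ] E => L v) (haux _ _ c1 c2)⟩
  have hXΦ : ∀ᶠ z in 𝓝 z₀, ∀ v, X v (Φ z) = mfderiv 𝓘(ℝ, F) I Φ z v := by
    filter_upwards [hinv] with z hz v
    exact hz.2 v
  have hXsm : ∀ v, CMDiffAt ∞ (T% (X v)) y₀ := by
    intro v
    have hc : CMDiffAt[univ] ∞ (T% (constField v)) (Ψ y₀) :=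
      contMDiffWithinAt_univ.2 (contMDiffAt_constField v _)
    have := ContMDiffWithinAt.mpullback_vectorField_preimage (n := ∞) (m := ∞) hc hΨ
      hinv.self_of_nhds.1 (by simp)
    rwa [preimage_univ, contMDiffWithinAt_univ] at this
  -- The fields are pulled back from constant ones, so they commute.
  have hbr : VectorField.mlieBracket I (X v) (X w) y₀ = 0 := by
    have hc : ∀ v : F, MDiffAt (T% (constField v)) (Ψ y₀) := fun v =>
      (contMDiffAt_constField v _).mdifferentiableAt (by simp)
    have := VectorField.mpullback_mlieBracket (n := ∞) (hc v) (hc w) hΨ (by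
      rw [minSmoothness_of_isRCLikeNormedField]; norm_cast)
    rw [hX, ← this, VectorField.mpullback_apply, mlieBracket_constField, map_zero]
  -- the connection form evaluated on these fields
  set h : F → M → ℂ := fun v y => V.connForm q y (X v y) with hh
  have hhΦ : ∀ v, (fun z => h v (Φ z)) =ᶠ[𝓝 z₀] fun z => V.pullConn q Φ D z v := by
    intro v
    filter_upwards [hXΦ, hD.mem_nhds hz₀] with z h1 h2
    rw [hh]
    simp only [UnitaryLineBundle.pullConn]
    rw [h1 v, mfderivWithin_of_mem_nhds (hD.mem_nhds h2)]
    rfl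
  have hA : ∀ v, ContDiffAt ℝ ∞ (fun z => V.pullConn q Φ D z v) z₀ := fun v =>
    (V.contDiffWithinAt_pullConn_apply hΦ hD.uniqueDiffOn hz₀ hq v).contDiffAt (hD.mem_nhds hz₀)
  have hhsm : ∀ v, ContMDiffAt I 𝓘(ℝ, ℂ) ∞ (h v) y₀ := by
    intro v
    have h1 : ContMDiffAt I 𝓘(ℝ, ℂ) ∞ (fun y => V.pullConn q Φ D (Ψ y) v) y₀ :=
      ContMDiffAt.comp_of_eq (hA v).contMDiffAt hΨ hz
    refine h1.congr_of_eventuallyEq ?_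
    have hΨc : Filter.Tendsto Ψ (𝓝 y₀) (𝓝 z₀) := by
      have := hΨ.continuousAt.tendsto
      rwa [hz] at this
    filter_upwards [hΦΨ, hΨc.eventually (hhΦ v)] with y h2 h3
    rw [← h3, h2]
  have hdh : ∀ v w, mvfderiv I (h w) y₀ (X v y₀) =
      fderiv ℝ (fun z => V.pullConn q Φ D z w) z₀ v := by
    intro v w
    have h1 := mfderiv_comp z₀ ((hhsm w).mdifferentiableAt (by simp))
      ((hΦat z₀ hz₀).mdifferentiableAt (by simp))
    have h2 : mfderiv 𝓘(ℝ, F) 𝓘(ℝ, ℂ) (h w ∘ Φ) z₀ = mfderiv 𝓘(ℝ, F) 𝓘(ℝ, ℂ)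
      (fun z => V.pullConn q Φ D z w) z₀ := Filter.EventuallyEq.mfderiv_eq (hhΦ w)
    rw [h1, mfderiv_eq_fderiv] at h2
    rw [hXΦ.self_of_nhds v]
    exact congrArg (fun L : F →L[ℝ] ℂ => L v) h2
  have hcovev : ∀ v, ∀ᶠ y in 𝓝 y₀, V.cov (V.frame q) y (X v y) = h v y • V.frame q y := by
    intro v
    filter_upwards [(isOpen_dom (V := V) q).mem_nhds hq] with y hy
    exact cov_frame hy _
  have hs := smoothSectionAt_frame (V := V) hq
  have hcov : ∀ v w, V.cov (fun y => V.cov (V.frame q) y (X w y)) y₀ (X v y₀) =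
      (mvfderiv I (h w) y₀ (X v y₀) + h w y₀ * h v y₀) • V.frame q y₀ := by
    intro v w
    rw [← cov_congr (smul_smoothSectionAt (hhsm w) hs)
      (by filter_upwards [hcovev w] with y hy using hy.symm), cov_smul (hhsm w) hs, cov_frame hq, smul_smul, ← add_smul]
  -- Since the fields commute, the curvature equation for the frame reads `dΘ = 2πi β`; the terms
  -- `Θ(X) Θ(Y)` cancel as the bundle has rank one.
  have key := hV (X v) (X w) (V.frame q) y₀ (hXsm v) (hXsm w) hs
  rw [curvature, hcov, hcov, hbr, map_zero, sub_zero, ← sub_smul] at key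
  have key2 := congrArg (fun u => V.coord q ⟨y₀, u⟩) key
  simp only [coord_smul hq, coord_frame hq, mul_one, hdh] at key2
  rw [hXΦ.self_of_nhds, hXΦ.self_of_nhds] at key2
  rw [← key2]
  ring

end Curvature

/-! ### Coordinates on the cylinder over a chart -/

section Cylinder

variable {n : ℕ} {M : Type*} [TopologicalSpace M] [ChartedSpace (EuclideanSpace ℝ (Fin n)) M]
  {E' H' : Type*} [NormedAddCommGroup E'] [NormedSpace ℝ E'] [TopologicalSpace H']
  {J : ModelWithCorners ℝ E' H'} {X : Type*} [TopologicalSpace X] [ChartedSpace H' X]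

/-- The inverse of the product chart of `M × [0, 1]` given by the chart at `x₀` and the inclusion
`[0, 1] → ℝ`. -/
def cyl (x₀ : M) (z : EuclideanSpace ℝ (Fin n) × ℝ) : M × Icc (0 : ℝ) 1 :=
  ((extChartAt (𝓡 n) x₀).symm z.1, projIcc 0 1 zero_le_one z.2)

/-- The domain on which `cyl` is a parametrization. -/
def cylDom (x₀ : M) : Set (EuclideanSpace ℝ (Fin n) × ℝ) :=
  (extChartAt (𝓡 n) x₀).target ×ˢ Icc 0 1

lemma uniqueDiffOn_cylDom (x₀ : M) : UniqueDiffOn ℝ (cylDom (n := n) x₀) :=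
  ((isOpen_extChartAt_target x₀).uniqueDiffOn).prod (uniqueDiffOn_Icc zero_lt_one)

variable [IsManifold (𝓡 n) ∞ M] [IsManifold J ∞ X]

lemma contMDiffOn_cyl (x₀ : M) : ContMDiffOn 𝓘(ℝ, EuclideanSpace ℝ (Fin n) × ℝ)
    ((𝓡 n).prod (𝓡∂ 1)) ∞ (cyl (n := n) x₀) (cylDom x₀) := by
  refine ContMDiffOn.prodMk ?_ ?_
  · exact (contMDiffOn_extChartAt_symm x₀).comp contDiff_fst.contMDiff.contMDiffOn fun z hz => hz.1
  · exact contMDiffOn_projIcc.comp contDiff_snd.contMDiff.contMDiffOn fun z hz => hz.2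

/-- The product chart inverse to `cyl` is smooth, also at the boundary. -/
lemma contMDiffAt_cyl_inverse (x₀ : M) {y : M × Icc (0 : ℝ) 1}
    (hy : y.1 ∈ (chartAt (EuclideanSpace ℝ (Fin n)) x₀).source) :
    ContMDiffAt ((𝓡 n).prod (𝓡∂ 1)) 𝓘(ℝ, EuclideanSpace ℝ (Fin n) × ℝ) ∞
      (fun y : M × Icc (0 : ℝ) 1 => (extChartAt (𝓡 n) x₀ y.1, (y.2 : ℝ))) y := by
  refine ContMDiffAt.prodMk_space ?_ ?_
  · exact ContMDiffAt.comp y (contMDiffAt_extChartAt' hy) contMDiffAt_fst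
  · exact ContMDiffAt.comp y (contMDiff_subtypeVal_Icc _) contMDiffAt_snd

/-- The density of `σ` on the trace `(w, t) ↦ ψ (c w, t)` of the path `c` under `ψ`. -/
def traceDensity {m : ℕ} {X : Type*} [TopologicalSpace X]
    [ChartedSpace (EuclideanSpace ℝ (Fin (2 * m))) X] {M : Type*} [TopologicalSpace M]
    [ChartedSpace (EuclideanSpace ℝ (Fin m)) M]
    (σ : Form (𝓡 (2 * m)) X 2) (ψ : M × Icc (0 : ℝ) 1 → X) (c : ℝ → M) (p : ℝ × ℝ) : ℝ :=
  isotopyForm σ ψ p.2 (c p.1) (velocity (𝓡 m) c p.1)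

/-- If the path is `x` in the chart at `x₀`, the density on its trace is the pullback of `σ` to
`cylDom x₀`, evaluated on `(x', 0)` and `∂/∂t`. -/
lemma traceDensity_eq_along {X : Type*} [TopologicalSpace X]
    [ChartedSpace (EuclideanSpace ℝ (Fin (2 * n))) X]
    (σ : Form (𝓡 (2 * n)) X 2) {ψ : M × Icc (0 : ℝ) 1 → X}
    (hψ : ContMDiff ((𝓡 n).prod (𝓡∂ 1)) (𝓡 (2 * n)) ∞ ψ) {c : ℝ → M} {x₀ : M}
    {x : ℝ → EuclideanSpace ℝ (Fin n)} {w t : ℝ} (hx : DifferentiableAt ℝ x w)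
    (hmem : ∀ᶠ τ in 𝓝 w, x τ ∈ (extChartAt (𝓡 n) x₀).target)
    (hc : ∀ᶠ τ in 𝓝 w, c τ = (extChartAt (𝓡 n) x₀).symm (x τ)) (ht : t ∈ Icc (0 : ℝ) 1) :
    traceDensity σ ψ c (w, t) = σ.along (ψ ∘ cyl x₀) (cylDom x₀) (x w, t)
      ![(deriv x w, 0), (0, 1)] := by
  have hz : (x w, t) ∈ cylDom (n := n) x₀ := ⟨hmem.self_of_nhds, ht⟩
  have hΞ : MDifferentiableWithinAt 𝓘(ℝ, EuclideanSpace ℝ (Fin n) × ℝ) (𝓡 (2 * n))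
      (ψ ∘ cyl x₀) (cylDom x₀) (x w, t) :=
    (hψ.comp_contMDiffOn (contMDiffOn_cyl x₀) _ hz).mdifferentiableWithinAt (by simp)
  have hcd : MDifferentiableAt 𝓘(ℝ, ℝ) (𝓡 n) c w :=
    (hasMFDerivAt_of_coordinates (D := (extChartAt (𝓡 n) x₀).target) (z := x)
      ((contMDiffOn_extChartAt_symm (n := ∞) x₀ _ hmem.self_of_nhds).mdifferentiableWithinAt
        (by simp)) hx hmem hc).mdifferentiableAt
  have hbase : ψ (c w, projIcc 0 1 zero_le_one t) = (ψ ∘ cyl x₀) (x w, t) := by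
    simp only [comp_apply, cyl]
    rw [hc.self_of_nhds]
  have hslice : MDifferentiableAt (𝓡 n) (𝓡 (2 * n))
      (fun q => ψ (q, projIcc 0 1 zero_le_one t)) (c w) :=
    ((hψ.comp (contMDiff_id.prodMk contMDiff_const)) (c w)).mdifferentiableAt (by simp)
  -- The horizontal slice `t = const`.
  have h1 : (mfderiv (𝓡 n) (𝓡 (2 * n)) (fun q => ψ (q, projIcc 0 1 zero_le_one t)) (c w)
      (velocity (𝓡 n) c w) : EuclideanSpace ℝ (Fin (2 * n))) =
      mfderivWithin 𝓘(ℝ, EuclideanSpace ℝ (Fin n) × ℝ) (𝓡 (2 * n)) (ψ ∘ cyl x₀) (cylDom x₀)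
        (x w, t) (deriv x w, 0) := by
    have hzd : HasDerivAt (fun τ => (x τ, t)) (deriv x w, (0 : ℝ)) w :=
      hx.hasDerivAt.prodMk (hasDerivAt_const w t)
    have := velocity_of_coordinates (c := fun τ => ψ (c τ, projIcc 0 1 zero_le_one t))
      (z := fun τ => (x τ, t)) (t := w) hΞ hzd.differentiableAt
      (by filter_upwards [hmem] with τ hτ using ⟨hτ, ht⟩)
      (by filter_upwards [hc] with τ hτ; simp only [comp_apply, cyl]; rw [hτ])
    refine Eq.trans ?_ (this.trans (congrArg (fun u : EuclideanSpace ℝ (Fin n) × ℝ =>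
      (mfderivWithin 𝓘(ℝ, EuclideanSpace ℝ (Fin n) × ℝ) (𝓡 (2 * n)) (ψ ∘ cyl x₀) (cylDom x₀)
        (x w, t) u : EuclideanSpace ℝ (Fin (2 * n)))) hzd.deriv))
    have h2 := mfderiv_comp w hslice hcd
    exact (congrArg (fun L : ℝ →L[ℝ] EuclideanSpace ℝ (Fin (2 * n)) => L 1) h2).symm
  -- The vertical slice `w = const`; at the ends of `[0, 1]` the derivative is one-sided.
  have h2 : (isotopyVelocity ψ (c w) t : EuclideanSpace ℝ (Fin (2 * n))) =
      mfderivWithin 𝓘(ℝ, EuclideanSpace ℝ (Fin n) × ℝ) (𝓡 (2 * n)) (ψ ∘ cyl x₀) (cylDom x₀)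
        (x w, t) (0, 1) := by
    have hzd : HasFDerivWithinAt (fun τ : ℝ => (x w, τ))
        (ContinuousLinearMap.inr ℝ (EuclideanSpace ℝ (Fin n)) ℝ) (Icc 0 1) t :=
      (hasFDerivAt_prodMk_right (x w) t).hasFDerivWithinAt
    have hu : UniqueMDiffWithinAt 𝓘(ℝ, ℝ) (Icc (0 : ℝ) 1) t :=
      (uniqueDiffOn_Icc zero_lt_one).uniqueMDiffOn t ht
    have h3 := (hΞ.hasMFDerivWithinAt.comp t hzd.hasMFDerivWithinAt
      (fun τ hτ => (⟨hmem.self_of_nhds, hτ⟩ : (x w, τ) ∈ cylDom x₀))).mfderivWithin hu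
    have h4 : (fun τ : ℝ => ψ (c w, projIcc 0 1 zero_le_one τ)) =
        (ψ ∘ cyl x₀) ∘ fun τ : ℝ => (x w, τ) := by
      funext τ
      simp only [comp_apply, cyl]
      rw [hc.self_of_nhds]
    rw [← h4] at h3
    have := congrArg (fun L : ℝ →L[ℝ] EuclideanSpace ℝ (Fin (2 * n)) => L 1) h3
    exact this
  have h3 := form_two_congr σ hbase h1 h2
  refine h3.trans ?_
  simp only [Form.along]
  congr 1
  ext i
  fin_cases i <;> rfl

/-- The curvature form pulled back by `ψ`, in cylinder coordinates. -/
lemma pullback_cyl {X : Type*} [TopologicalSpace X]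
    [ChartedSpace (EuclideanSpace ℝ (Fin (2 * n))) X]
    (σ : Form (𝓡 (2 * n)) X 2) {ψ : M × Icc (0 : ℝ) 1 → X}
    (hψ : ContMDiff ((𝓡 n).prod (𝓡∂ 1)) (𝓡 (2 * n)) ∞ ψ) {x₀ : M}
    {z : EuclideanSpace ℝ (Fin n) × ℝ} (hz : cylDom x₀ ∈ 𝓝 z)
    (v w : EuclideanSpace ℝ (Fin n) × ℝ) :
    Form.pullback ((𝓡 n).prod (𝓡∂ 1)) ψ σ (cyl x₀ z)
      ![mfderiv 𝓘(ℝ, EuclideanSpace ℝ (Fin n) × ℝ) ((𝓡 n).prod (𝓡∂ 1)) (cyl x₀) z v,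
        mfderiv 𝓘(ℝ, EuclideanSpace ℝ (Fin n) × ℝ) ((𝓡 n).prod (𝓡∂ 1)) (cyl x₀) z w] =
      σ.along (ψ ∘ cyl x₀) (cylDom x₀) z ![v, w] := by
  have h1 := mfderiv_comp z ((hψ (cyl x₀ z)).mdifferentiableAt (by simp))
    (((contMDiffOn_cyl x₀).contMDiffAt hz).mdifferentiableAt (by simp))
  simp only [Form.along, Form.pullback]
  rw [mfderivWithin_of_mem_nhds hz, h1, ContinuousAlternatingMap.compContinuousLinearMap_apply]
  congr 1
  ext i
  fin_cases i <;> rfl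

end Cylinder

/-! ### Green's formula on a rectangle with a rough side -/

section Green

open MeasureTheory

lemma ae_prod_of_Ioo_diff_finite {a b : ℝ} {S : Set ℝ} (hS : S.Finite) (T : Set ℝ) {p : ℝ × ℝ → Prop}
    (h : ∀ w ∈ Ioo a b \ S, ∀ t ∈ T, p (w, t)) (hT : MeasurableSet T) :
    ∀ᵐ z ∂(volume.restrict (Ioc a b ×ˢ T)), p z := by
  rw [ae_restrict_iff' (measurableSet_Ioc.prod hT)]
  have h0 : ((S ∪ {b}) ×ˢ (univ : Set ℝ))ᶜ ∈ ae (volume : Measure (ℝ × ℝ)) := by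
    refine compl_mem_ae_iff.2 ?_
    rw [Measure.volume_eq_prod, Measure.prod_prod,
      (hS.union (finite_singleton b)).measure_zero, zero_mul]
  filter_upwards [h0] with z hz hzm
  refine h z.1 ⟨⟨hzm.1.1, lt_of_le_of_ne hzm.1.2 fun hb => hz ⟨Or.inr hb, mem_univ _⟩⟩,
    fun hs => hz ⟨Or.inl hs, mem_univ _⟩⟩ z.2 hzm.2

lemma integrableOn_comp_fst {G : Type*} [NormedAddCommGroup G] {f : ℝ → G} {a b : ℝ} (hab : a ≤ b)
    (hf : IntervalIntegrable f volume a b) {T : Set ℝ} (hT : volume T ≠ ⊤) :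
    IntegrableOn (fun p : ℝ × ℝ => f p.1) (Ioc a b ×ˢ T) := by
  rw [intervalIntegrable_iff_integrableOn_Ioc_of_le hab] at hf
  have : IsFiniteMeasure (volume.restrict T) := ⟨by simpa using hT.lt_top⟩
  rw [IntegrableOn, Measure.volume_eq_prod, ← Measure.prod_restrict]
  exact Integrable.comp_fst hf _

lemma integrableOn_prod_clm_apply {G G' : Type*} [NormedAddCommGroup G] [NormedSpace ℝ G]
    [NormedAddCommGroup G'] [NormedSpace ℝ G'] {a b t₀ t₁ : ℝ} (hab : a ≤ b)
    {L : ℝ × ℝ → G →L[ℝ] G'} {f : ℝ → G} (hL : ContinuousOn L (Icc a b ×ˢ Icc t₀ t₁))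
    (hf : IntervalIntegrable f volume a b) :
    IntegrableOn (fun p => L p (f p.1)) (Ioc a b ×ˢ Icc t₀ t₁) :=
  integrableOn_clm_apply (isCompact_Icc.prod isCompact_Icc)
    (prod_mono Ioc_subset_Icc_self subset_rfl) (measurableSet_Ioc.prod measurableSet_Icc) hL
    (integrableOn_comp_fst hab hf (by simp))

variable {E : Type*} [NormedAddCommGroup E] [NormedSpace ℝ E]

lemma hasDerivAt_clm_along {A : E × ℝ → (E × ℝ →L[ℝ] ℂ)} {L : E × ℝ →L[ℝ] (E × ℝ →L[ℝ] ℂ)}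
    {D : Set (E × ℝ)} {g : ℝ → E × ℝ} {g' v : E × ℝ} {w : ℝ} (hd : HasFDerivWithinAt A L D (g w))
    (h1 : HasDerivAt g g' w) (hev : ∀ᶠ w' in 𝓝 w, g w' ∈ D) :
    HasDerivAt (fun w' => A (g w') v) (L g' v) w := by
  have h2 := (hd.comp_hasDerivAt w h1 hev).clm_apply (hasDerivAt_const w v)
  rw [map_zero, add_zero] at h2
  exact h2

/-- Green's formula for a 1-form `A` on `E × ℝ` and the surface `(w, t) ↦ (x w, t)`, where `x` is
smooth away from finitely many points and of finite length. -/
lemma green_rectangle {A : E × ℝ → (E × ℝ →L[ℝ] ℂ)} {U : Set E} {K : Set ℝ} (hU : IsOpen U)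
    (hK : UniqueDiffOn ℝ K) (hA : ContDiffOn ℝ 1 A (U ×ˢ K)) {x : ℝ → E} {w₀ w₁ t₀ t₁ : ℝ}
    (hw : w₀ ≤ w₁) (ht : t₀ ≤ t₁) (hxc : ContinuousOn x (Icc w₀ w₁)) {S : Set ℝ} (hS : S.Finite)
    (hxd : ∀ w ∈ Ioo w₀ w₁ \ S, DifferentiableAt ℝ x w)
    (hxi : IntervalIntegrable (deriv x) volume w₀ w₁) (hxU : MapsTo x (Icc w₀ w₁) U)
    (htK : Icc t₀ t₁ ⊆ K) {κ : ℝ × ℝ → ℂ}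
    (hκ : ∀ w ∈ Ioo w₀ w₁ \ S, ∀ t ∈ Ioo t₀ t₁, κ (w, t) =
      fderiv ℝ (fun z => A z (0, 1)) (x w, t) (deriv x w, 0) -
        fderiv ℝ (fun z => A z (deriv x w, 0)) (x w, t) (0, 1)) :
    ∫ p in Ioc w₀ w₁ ×ˢ Ioc t₀ t₁, κ p =
      (∫ w in w₀..w₁, A (x w, t₀) (deriv x w, 0)) + (∫ t in t₀..t₁, A (x w₁, t) (0, 1)) -
      (∫ w in w₀..w₁, A (x w, t₁) (deriv x w, 0)) - ∫ t in t₀..t₁, A (x w₀, t) (0, 1) := by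
  set D : Set (E × ℝ) := U ×ˢ K
  have hD : UniqueDiffOn ℝ D := hU.uniqueDiffOn.prod hK
  set DA := fderivWithin ℝ A D
  have hDA : ContinuousOn DA D := hA.continuousOn_fderivWithin hD (by simp)
  have hDAd : ∀ z ∈ D, HasFDerivWithinAt A (DA z) D z := fun z hz =>
    (hA.differentiableOn (by simp) z hz).hasFDerivWithinAt
  have hmaps : MapsTo (fun p : ℝ × ℝ => (x p.1, p.2)) (Icc w₀ w₁ ×ˢ Icc t₀ t₁) D :=
    fun p hp => ⟨hxU hp.1, htK hp.2⟩
  have hcont : ContinuousOn (fun p : ℝ × ℝ => (x p.1, p.2)) (Icc w₀ w₁ ×ˢ Icc t₀ t₁) :=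
    (hxc.comp continuousOn_fst fun p hp => hp.1).prodMk continuousOn_snd
  have hDAc : ContinuousOn (fun p : ℝ × ℝ => DA (x p.1, p.2)) (Icc w₀ w₁ ×ˢ Icc t₀ t₁) :=
    hDA.comp hcont hmaps
  -- The two terms of `dA` are integrated separately. Their derivatives are taken within `D`, so
  -- that they are continuous up to the top and bottom of the rectangle.
  set f₁ : ℝ × ℝ → ℂ := fun p => DA (x p.1, p.2) (deriv x p.1, 0) (0, 1) with hf₁
  set f₂ : ℝ × ℝ → ℂ := fun p => DA (x p.1, p.2) (0, 1) (deriv x p.1, 0) with hf₂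
  have hsub : Ioc w₀ w₁ ×ˢ Ioc t₀ t₁ ⊆ Ioc w₀ w₁ ×ˢ Icc t₀ t₁ :=
    prod_mono subset_rfl Ioc_subset_Icc_self
  have hi₁ : IntegrableOn f₁ (Ioc w₀ w₁ ×ˢ Ioc t₀ t₁) := by
    refine IntegrableOn.mono_set ?_ hsub
    have hL : ContinuousOn (fun p : ℝ × ℝ => ((ContinuousLinearMap.apply ℝ ℂ ((0, 1) : E × ℝ)).comp
        (DA (x p.1, p.2))).comp (ContinuousLinearMap.inl ℝ E ℝ)) (Icc w₀ w₁ ×ˢ Icc t₀ t₁) :=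
      (continuousOn_const.clm_comp hDAc).clm_comp continuousOn_const
    exact integrableOn_prod_clm_apply hw hL hxi
  have hi₂ : IntegrableOn f₂ (Ioc w₀ w₁ ×ˢ Ioc t₀ t₁) := by
    refine IntegrableOn.mono_set ?_ hsub
    have hL : ContinuousOn (fun p : ℝ × ℝ => (DA (x p.1, p.2) (0, 1)).comp
        (ContinuousLinearMap.inl ℝ E ℝ)) (Icc w₀ w₁ ×ˢ Icc t₀ t₁) :=
      (hDAc.clm_apply continuousOn_const).clm_comp continuousOn_const
    exact integrableOn_prod_clm_apply hw hL hxi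
  have hκ' : ∫ p in Ioc w₀ w₁ ×ˢ Ioc t₀ t₁, κ p =
      (∫ p in Ioc w₀ w₁ ×ˢ Ioc t₀ t₁, f₁ p) - ∫ p in Ioc w₀ w₁ ×ˢ Ioc t₀ t₁, f₂ p := by
    rw [← integral_sub hi₁ hi₂]
    have hae : ∀ᵐ p ∂(volume.restrict (Ioc w₀ w₁ ×ˢ Ioo t₀ t₁)), κ p = f₁ p - f₂ p := by
      refine ae_prod_of_Ioo_diff_finite hS _ (fun w hw t ht => ?_) measurableSet_Ioo
      have hzD : D ∈ 𝓝 (x w, t) := prod_mem_nhds (hU.mem_nhds (hxU (Ioo_subset_Icc_self hw.1)))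
        (Filter.mem_of_superset (Icc_mem_nhds ht.1 ht.2) htK)
      have hd := (hDAd (x w, t) (mem_of_mem_nhds hzD)).hasFDerivAt hzD
      have hd' : ∀ v : E × ℝ, fderiv ℝ (fun z => A z v) (x w, t) = (DA (x w, t)).flip v := by
        intro v
        have := hd.clm_apply (hasFDerivAt_const v (x w, t))
        rw [this.fderiv]
        simp
      rw [hκ w hw t ht, hd', hd']
      rfl
    have hset : (Ioc w₀ w₁ ×ˢ Ioo t₀ t₁ : Set (ℝ × ℝ)) =ᵐ[volume] Ioc w₀ w₁ ×ˢ Ioc t₀ t₁ := by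
      rw [Measure.volume_eq_prod]
      exact Measure.set_prod_ae_eq Filter.EventuallyEq.rfl Ioo_ae_eq_Ioc
    rw [Measure.restrict_congr_set hset] at hae
    exact integral_congr_ae hae
  -- the integral of `f₂`, first along the height
  have hI₂ : ∫ p in Ioc w₀ w₁ ×ˢ Ioc t₀ t₁, f₂ p =
      (∫ w in w₀..w₁, A (x w, t₁) (deriv x w, 0)) - ∫ w in w₀..w₁, A (x w, t₀) (deriv x w, 0) := by
    have hsl : ∀ t ∈ Icc t₀ t₁, IntervalIntegrable (fun w => A (x w, t) (deriv x w, 0))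
        volume w₀ w₁ := by
      intro t ht
      have hL : ContinuousOn (fun w => (A (x w, t)).comp (ContinuousLinearMap.inl ℝ E ℝ))
          (Icc w₀ w₁) :=
        (hA.continuousOn.comp (hxc.prodMk continuousOn_const)
          fun w hw => ⟨hxU hw, htK ht⟩).clm_comp continuousOn_const
      exact intervalIntegrable_clm_apply (f := deriv x) hw hL hxi
    rw [← intervalIntegral.integral_sub (hsl t₁ (right_mem_Icc.2 ht)) (hsl t₀ (left_mem_Icc.2 ht)),
      intervalIntegral.integral_of_le hw, Measure.volume_eq_prod,
      setIntegral_prod _ (by rwa [Measure.volume_eq_prod] at hi₂)]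
    refine setIntegral_congr_fun measurableSet_Ioc fun w hwI => ?_
    have hwI' := Ioc_subset_Icc_self hwI
    change ∫ t in Ioc t₀ t₁, f₂ (w, t) = _
    rw [← intervalIntegral.integral_of_le ht]
    refine intervalIntegral.integral_eq_sub_of_hasDerivAt_of_le ht
      (f := fun t => A (x w, t) (deriv x w, 0)) ?_ (fun t htI => ?_) ?_
    · exact (hA.continuousOn.comp (continuousOn_const.prodMk continuousOn_id)
        fun t ht => ⟨hxU hwI', htK ht⟩).clm_apply continuousOn_const
    · have hzD : D ∈ 𝓝 (x w, t) := prod_mem_nhds (hU.mem_nhds (hxU hwI'))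
        (Filter.mem_of_superset (Icc_mem_nhds htI.1 htI.2) htK)
      have hd := hDAd (x w, t) (mem_of_mem_nhds hzD)
      have h1 : HasDerivAt (fun t : ℝ => (x w, t)) ((0 : E), (1 : ℝ)) t :=
        (hasDerivAt_const t (x w)).prodMk (hasDerivAt_id t)
      exact hasDerivAt_clm_along hd h1 (h1.continuousAt.eventually hzD)
    · change IntervalIntegrable (fun t => DA (x w, t) (0, 1) (deriv x w, 0)) volume t₀ t₁
      refine ContinuousOn.intervalIntegrable_of_Icc ht ?_
      exact ((hDA.comp (continuousOn_const.prodMk continuousOn_id)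
        fun t ht => ⟨hxU hwI', htK ht⟩).clm_apply continuousOn_const).clm_apply continuousOn_const
  -- the integral of `f₁`, first along the path
  have hI₁ : ∫ p in Ioc w₀ w₁ ×ˢ Ioc t₀ t₁, f₁ p =
      (∫ t in t₀..t₁, A (x w₁, t) (0, 1)) - ∫ t in t₀..t₁, A (x w₀, t) (0, 1) := by
    have hsl : ∀ w ∈ Icc w₀ w₁, IntervalIntegrable (fun t => A (x w, t) (0, 1)) volume t₀ t₁ := by
      intro w hw
      refine ContinuousOn.intervalIntegrable_of_Icc ht ?_
      exact (hA.continuousOn.comp (continuousOn_const.prodMk continuousOn_id)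
        fun t ht => ⟨hxU hw, htK ht⟩).clm_apply continuousOn_const
    rw [← intervalIntegral.integral_sub (hsl w₁ (right_mem_Icc.2 hw)) (hsl w₀ (left_mem_Icc.2 hw)),
      intervalIntegral.integral_of_le ht, Measure.volume_eq_prod, ← Measure.prod_restrict,
      integral_prod_symm _ (by
        rwa [IntegrableOn, Measure.volume_eq_prod, ← Measure.prod_restrict] at hi₁)]
    refine setIntegral_congr_fun measurableSet_Ioc fun t htI => ?_
    have htI' := Ioc_subset_Icc_self htI
    change ∫ w in Ioc w₀ w₁, f₁ (w, t) = _
    rw [← intervalIntegral.integral_of_le hw]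
    refine integral_eq_sub_of_hasDerivAt_off_finite hw hS
      (f := fun w => A (x w, t) (0, 1)) ?_ (fun w hwI => ?_) ?_
    · exact (hA.continuousOn.comp (hxc.prodMk continuousOn_const)
        fun w hw => ⟨hxU hw, htK htI'⟩).clm_apply continuousOn_const
    · have hwI' := Ioo_subset_Icc_self hwI.1
      have hd := hDAd (x w, t) ⟨hxU hwI', htK htI'⟩
      have h1 : HasDerivAt (fun w : ℝ => (x w, t)) (deriv x w, (0 : ℝ)) w :=
        (hxd w hwI).hasDerivAt.prodMk (hasDerivAt_const w t)
      have hev : ∀ᶠ w' in 𝓝 w, (x w', t) ∈ D := by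
        filter_upwards [Icc_mem_nhds hwI.1.1 hwI.1.2] with w' hw' using ⟨hxU hw', htK htI'⟩
      exact hasDerivAt_clm_along hd h1 hev
    · have hL : ContinuousOn (fun w => ((ContinuousLinearMap.apply ℝ ℂ ((0, 1) : E × ℝ)).comp
          (DA (x w, t))).comp (ContinuousLinearMap.inl ℝ E ℝ)) (Icc w₀ w₁) :=
        (continuousOn_const.clm_comp (hDA.comp (hxc.prodMk continuousOn_const)
          fun w hw => ⟨hxU hw, htK htI'⟩)).clm_comp continuousOn_const
      exact intervalIntegrable_clm_apply (f := deriv x) hw hL hxi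
  rw [hκ', hI₁, hI₂]
  ring

end Green

/-! ### Integrability of forms on the trace of a path -/

section TraceIntegrable

open MeasureTheory

lemma form_two_map_add_left {E H M : Type*} [NormedAddCommGroup E] [NormedSpace ℝ E]
    [TopologicalSpace H] {I : ModelWithCorners ℝ E H} [TopologicalSpace M] [ChartedSpace H M]
    (σ : Form I M 2) (x : M) (v v' w : TangentSpace I x) :
    σ x ![v + v', w] = σ x ![v, w] + σ x ![v', w] := by
  have h := (σ x).map_update_add ![v, w] 0 v v'
  have e : ∀ u : TangentSpace I x, update ![v, w] 0 u = ![u, w] := fun u => by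
    ext i
    fin_cases i <;> rfl
  rwa [e, e, e] at h

lemma form_two_map_smul_left {E H M : Type*} [NormedAddCommGroup E] [NormedSpace ℝ E]
    [TopologicalSpace H] {I : ModelWithCorners ℝ E H} [TopologicalSpace M] [ChartedSpace H M]
    (σ : Form I M 2) (x : M) (r : ℝ) (v w : TangentSpace I x) :
    σ x ![r • v, w] = r * σ x ![v, w] := by
  have h := (σ x).map_update_smul ![v, w] 0 r v
  have e : ∀ u : TangentSpace I x, update ![v, w] 0 u = ![u, w] := fun u => by
    ext i
    fin_cases i <;> rfl
  rwa [e, e] at h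

variable {E H : Type*} [NormedAddCommGroup E] [NormedSpace ℝ E] [TopologicalSpace H]
  {I : ModelWithCorners ℝ E H} {M : Type*} [TopologicalSpace M] [ChartedSpace H M]
  {F : Type*} [NormedAddCommGroup F] [NormedSpace ℝ F]

lemma Form.along_two (σ : Form I M 2) (Ξ : F → M) (D : Set F) (z v w : F) :
    σ.along Ξ D z ![v, w] =
      σ (Ξ z) ![mfderivWithin 𝓘(ℝ, F) I Ξ D z v, mfderivWithin 𝓘(ℝ, F) I Ξ D z w] := by
  simp only [Form.along]
  congr 1
  ext i
  fin_cases i <;> rfl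

/-- The functional `v ↦ (Ξ^* σ)(v, w)`. -/
def Form.alongCLM [FiniteDimensional ℝ F] (σ : Form I M 2) (Ξ : F → M) (D : Set F) (w z : F) :
    F →L[ℝ] ℝ :=
  LinearMap.toContinuousLinearMap
    { toFun := fun v => σ.along Ξ D z ![v, w]
      map_add' := fun v v' => by
        rw [Form.along_two, Form.along_two, Form.along_two]
        exact (form_two_congr σ rfl
          (ContinuousLinearMap.map_add (mfderivWithin 𝓘(ℝ, F) I Ξ D z : F →L[ℝ] E) v v') rfl).trans
          (form_two_map_add_left σ _ _ _ _)
      map_smul' := fun r v => by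
        rw [Form.along_two, Form.along_two]
        exact (form_two_congr σ rfl
          (ContinuousLinearMap.map_smul (mfderivWithin 𝓘(ℝ, F) I Ξ D z : F →L[ℝ] E) r v) rfl).trans
          (form_two_map_smul_left σ _ _ _ _) }

lemma Form.continuousOn_alongCLM [FiniteDimensional ℝ F] [IsManifold I ∞ M] {σ : Form I M 2}
    (hσ : σ.IsSmooth) {Ξ : F → M} {D : Set F} (hΞ : ContMDiffOn 𝓘(ℝ, F) I ∞ Ξ D)
    (hD : UniqueDiffOn ℝ D) (w : F) : ContinuousOn (σ.alongCLM Ξ D w) D :=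
  continuousOn_clm_apply.2 fun _ _ hz => Form.continuousWithinAt_along hσ hΞ hD hz _

/-- A rectifiable path in a chart. -/
structure IsChartPath {n : ℕ} {M : Type*} [TopologicalSpace M]
    [ChartedSpace (EuclideanSpace ℝ (Fin n)) M] (c : ℝ → M) (x₀ : M)
    (x : ℝ → EuclideanSpace ℝ (Fin n)) (a b : ℝ) (S : Set ℝ) : Prop where
  le : a ≤ b
  finite : S.Finite
  mapsTo : MapsTo x (Icc a b) (extChartAt (𝓡 n) x₀).target
  continuousOn : ContinuousOn x (Icc a b)
  smooth : ∀ t ∈ Ioo a b \ S, ContDiffAt ℝ ∞ x t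
  integrable : IntervalIntegrable (deriv x) volume a b
  eq : ∀ t ∈ Icc a b, c t = (extChartAt (𝓡 n) x₀).symm (x t)

variable {n : ℕ} {M : Type*} [TopologicalSpace M] [ChartedSpace (EuclideanSpace ℝ (Fin n)) M]
  [IsManifold (𝓡 n) ∞ M] [T2Space M] {c : ℝ → M} {a b : ℝ}

/-- Short pieces of rectifiable paths lie in a chart. -/
lemma IsRectifiablePath.exists_isChartPath (h : IsRectifiablePath (𝓡 n) c a b) {t₀ : ℝ}
    (ht₀ : t₀ ∈ Icc a b) {U : Set M} (hU : U ∈ 𝓝 (c t₀)) :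
    ∃ ε > 0, ∀ x y, a ≤ x → x ≤ y → y ≤ b → |x - t₀| < ε → |y - t₀| < ε →
      (∃ S, IsChartPath c (c t₀) (fun t => extChartAt (𝓡 n) (c t₀) (c t)) x y S) ∧
      MapsTo c (Icc x y) U := by
  obtain ⟨ε, hε, hmem, hint⟩ := h.exists_chart ht₀ hU
  obtain ⟨S, hS, hsm⟩ := h.smooth
  refine ⟨ε, hε, fun x y hx hxy hy hxε hyε => ?_⟩
  have hsub : ∀ t ∈ Icc x y, t ∈ Icc a b ∧ |t - t₀| < ε := by
    intro t ht
    rw [abs_lt] at hxε hyε ⊢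
    exact ⟨⟨hx.trans ht.1, ht.2.trans hy⟩, by linarith [ht.1], by linarith [ht.2]⟩
  have hm : ∀ t ∈ Icc x y, c t ∈ U ∩ (chartAt _ (c t₀)).source := fun t ht =>
    hmem t (hsub t ht).1 (hsub t ht).2
  have hsrc : ∀ t ∈ Icc x y, c t ∈ (extChartAt (𝓡 n) (c t₀)).source := fun t ht => by
    rw [extChartAt_source]
    exact (hm t ht).2
  refine ⟨⟨S, hxy, hS, fun t ht => (extChartAt (𝓡 n) (c t₀)).map_source (hsrc t ht),
    (continuousOn_extChartAt (c t₀)).comp (h.continuousOn.mono (Icc_subset_Icc hx hy)) hsrc,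
    fun t ht => ?_, hint x y hx hxy hy hxε hyε,
    fun t ht => ((extChartAt (𝓡 n) (c t₀)).left_inv (hsrc t ht)).symm⟩, fun t ht => (hm t ht).1⟩
  exact contMDiffAt_iff_contDiffAt.1 (ContMDiffAt.comp t
    (contMDiffAt_extChartAt' (hm t (Ioo_subset_Icc_self ht.1)).2)
    (hsm t ⟨Ioo_subset_Ioo hx hy ht.1, ht.2⟩))

variable {X : Type*} [TopologicalSpace X] [ChartedSpace (EuclideanSpace ℝ (Fin (2 * n))) X]
  [IsManifold (𝓡 (2 * n)) ∞ X] {ψ : M × Icc (0 : ℝ) 1 → X}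

omit [T2Space M] [IsManifold (𝓡 (2 * n)) ∞ X] in
lemma IsChartPath.traceDensity_eq (σ : Form (𝓡 (2 * n)) X 2)
    (hψ : ContMDiff ((𝓡 n).prod (𝓡∂ 1)) (𝓡 (2 * n)) ∞ ψ) {x₀ : M}
    {x : ℝ → EuclideanSpace ℝ (Fin n)} {S : Set ℝ} (h : IsChartPath c x₀ x a b S) {w t : ℝ}
    (hw : w ∈ Ioo a b \ S) (ht : t ∈ Icc (0 : ℝ) 1) :
    traceDensity σ ψ c (w, t) = σ.along (ψ ∘ cyl x₀) (cylDom x₀) (x w, t)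
      ![(deriv x w, 0), (0, 1)] := by
  have hn := Icc_mem_nhds hw.1.1 hw.1.2
  exact traceDensity_eq_along σ hψ ((h.smooth w hw).differentiableAt (by simp))
    (by filter_upwards [hn] with τ hτ using h.mapsTo hτ)
    (by filter_upwards [hn] with τ hτ using h.eq τ hτ) ht

/-- A smooth 2-form is integrable over the trace of a rectifiable path. -/
lemma integrableOn_traceDensity {σ : Form (𝓡 (2 * n)) X 2} (hσ : σ.IsSmooth)
    (hψ : ContMDiff ((𝓡 n).prod (𝓡∂ 1)) (𝓡 (2 * n)) ∞ ψ) (h : IsRectifiablePath (𝓡 n) c a b) :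
    IntegrableOn (traceDensity σ ψ c) (Ioc a b ×ˢ Icc 0 1) := by
  refine interval_subdivision
    (Q := fun x y => IntegrableOn (traceDensity σ ψ c) (Ioc x y ×ˢ Icc 0 1)) h.le ?_ ?_
  · intro x y z _ hxy hyz _ h1 h2
    rw [← Ioc_union_Ioc_eq_Ioc hxy hyz, union_prod]
    exact h1.union h2
  · intro t₀ ht₀
    obtain ⟨ε, hε, hloc⟩ := h.exists_isChartPath ht₀ Filter.univ_mem
    refine ⟨ε, hε, fun x y hx hxy hy hxε hyε => ?_⟩
    obtain ⟨⟨S, hp⟩, -⟩ := hloc x y hx hxy hy hxε hyε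
    set ξ := fun t => extChartAt (𝓡 n) (c t₀) (c t)
    have hΞ : ContMDiffOn 𝓘(ℝ, EuclideanSpace ℝ (Fin n) × ℝ) (𝓡 (2 * n)) ∞
        (ψ ∘ cyl (c t₀)) (cylDom (c t₀)) := hψ.comp_contMDiffOn (contMDiffOn_cyl _)
    have hc := Form.continuousOn_alongCLM hσ hΞ (uniqueDiffOn_cylDom _) (0, 1)
    have hL : ContinuousOn (fun p : ℝ × ℝ =>
        (σ.alongCLM (ψ ∘ cyl (c t₀)) (cylDom (c t₀)) (0, 1) (ξ p.1, p.2)).comp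
          (ContinuousLinearMap.inl ℝ (EuclideanSpace ℝ (Fin n)) ℝ)) (Icc x y ×ˢ Icc 0 1) := by
      refine ContinuousOn.clm_comp (hc.comp ?_ ?_) continuousOn_const
      · exact (hp.continuousOn.comp continuousOn_fst fun p hp => hp.1).prodMk continuousOn_snd
      · exact fun p hpp => ⟨hp.mapsTo hpp.1, hpp.2⟩
    refine Integrable.congr (integrableOn_prod_clm_apply hxy hL hp.integrable) ?_
    refine ae_prod_of_Ioo_diff_finite hp.finite _ (fun w hw t ht => ?_) measurableSet_Icc
    exact (hp.traceDensity_eq σ hψ hw ht).symm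

end TraceIntegrable

/-! ### Holonomy around the trace of a path -/

section Rectangle

open MeasureTheory UnitaryLineBundle

lemma intervalIntegral_congr_off_finite {F : Type*} [NormedAddCommGroup F] [NormedSpace ℝ F]
    {f g : ℝ → F} {a b : ℝ} (hab : a ≤ b) {S : Set ℝ} (hS : S.Finite)
    (h : ∀ t ∈ Ioo a b \ S, f t = g t) : ∫ t in a..b, f t = ∫ t in a..b, g t := by
  rw [intervalIntegral.integral_of_le hab, intervalIntegral.integral_of_le hab]
  exact integral_congr_ae (ae_Ioc_of_Ioo_diff_finite hS h)

lemma IsRectifiablePath.mono {E H : Type*} [NormedAddCommGroup E] [NormedSpace ℝ E]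
    [TopologicalSpace H] {I : ModelWithCorners ℝ E H} {M : Type*} [TopologicalSpace M]
    [ChartedSpace H M] {c : ℝ → M} {a b a' b' : ℝ} (h : IsRectifiablePath I c a b) (ha : a ≤ a')
    (hab : a' ≤ b') (hb : b' ≤ b) : IsRectifiablePath I c a' b' where
  le := hab
  continuousOn := h.continuousOn.mono (Icc_subset_Icc ha hb)
  smooth := by
    obtain ⟨S, hS, hsm⟩ := h.smooth
    exact ⟨S, hS, fun t ht => hsm t ⟨Ioo_subset_Ioo ha hb ht.1, ht.2⟩⟩
  integrable g hg := (h.integrable g hg).mono_set (by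
    rw [uIcc_of_le hab, uIcc_of_le h.le]
    exact Icc_subset_Icc ha hb)

variable {n : ℕ} {M : Type*} [TopologicalSpace M] [ChartedSpace (EuclideanSpace ℝ (Fin n)) M]
  [IsManifold (𝓡 n) ∞ M]

omit [IsManifold (𝓡 n) ∞ M] in
lemma isRectifiablePath_horizontal {c : ℝ → M} {a b : ℝ} (h : IsRectifiablePath (𝓡 n) c a b)
    (t : ℝ) : IsRectifiablePath ((𝓡 n).prod (𝓡∂ 1))
      (fun w => (c w, projIcc (0 : ℝ) 1 zero_le_one t)) a b :=
  h.comp_left (f := fun p => (p, projIcc (0 : ℝ) 1 zero_le_one t))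
    (contMDiff_id.prodMk contMDiff_const)

omit [IsManifold (𝓡 n) ∞ M] in
lemma contMDiffOn_vertical (p : M) : ContMDiffOn 𝓘(ℝ, ℝ) ((𝓡 n).prod (𝓡∂ 1)) ∞
    (fun t => (p, projIcc (0 : ℝ) 1 zero_le_one t)) (Icc 0 1) :=
  contMDiffOn_const.prodMk contMDiffOn_projIcc

omit [IsManifold (𝓡 n) ∞ M] in
lemma isRectifiablePath_vertical (p : M) {t₀ t₁ : ℝ} (h₀ : 0 ≤ t₀) (h : t₀ ≤ t₁) (h₁ : t₁ ≤ 1) :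
    IsRectifiablePath ((𝓡 n).prod (𝓡∂ 1)) (fun t => (p, projIcc (0 : ℝ) 1 zero_le_one t)) t₀ t₁ :=
  (IsRectifiablePath.of_contMDiffOn zero_lt_one (contMDiffOn_vertical p)).mono h₀ h h₁

variable [T2Space M]
  {X : Type*} [TopologicalSpace X] [ChartedSpace (EuclideanSpace ℝ (Fin (2 * n))) X]
  {ψ : M × Icc (0 : ℝ) 1 → X} {σ : Form (𝓡 (2 * n)) X 2} {c : ℝ → M}
  {V : UnitaryLineBundle ((𝓡 n).prod (𝓡∂ 1)) (M × Icc (0 : ℝ) 1)}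

/-- The parallel transports along the two ways around the rectangle `[w₀, w₁] × [t₀, t₁]` differ by
the exponential of the integral of the curvature. -/
def RectangleHolonomy (V : UnitaryLineBundle ((𝓡 n).prod (𝓡∂ 1)) (M × Icc (0 : ℝ) 1))
    (σ : Form (𝓡 (2 * n)) X 2) (ψ : M × Icc (0 : ℝ) 1 → X) (c : ℝ → M) (w₀ w₁ t₀ t₁ : ℝ) : Prop :=
  ∀ u u₁ u₂ u₃ u₄ : TotalSpace ℂ V.fiber,
    V.Par (fun w => (c w, projIcc (0 : ℝ) 1 zero_le_one t₀)) w₀ w₁ u u₁ →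
    V.Par (fun t => (c w₁, projIcc (0 : ℝ) 1 zero_le_one t)) t₀ t₁ u₁ u₂ →
    V.Par (fun t => (c w₀, projIcc (0 : ℝ) 1 zero_le_one t)) t₀ t₁ u u₃ →
    V.Par (fun w => (c w, projIcc (0 : ℝ) 1 zero_le_one t₁)) w₀ w₁ u₃ u₄ →
    u₄ = scale (Complex.exp (2 * Real.pi * Complex.I *
      ((∫ p in Ioc w₀ w₁ ×ˢ Ioc t₀ t₁, traceDensity σ ψ c p : ℝ) : ℂ))) u₂

omit [T2Space M] in
/-- The pulled back connection form at an interior point does not depend on the domain. -/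
lemma pullConn_of_mem_nhds {q : M × Icc (0 : ℝ) 1} {Φ : EuclideanSpace ℝ (Fin n) × ℝ → M × Icc (0 : ℝ) 1}
    {D D' : Set (EuclideanSpace ℝ (Fin n) × ℝ)} {z : EuclideanSpace ℝ (Fin n) × ℝ}
    (hD : D ∈ 𝓝 z) (hD' : D' ∈ 𝓝 z) : V.pullConn q Φ D z = V.pullConn q Φ D' z := by
  simp only [pullConn]
  rw [mfderivWithin_of_mem_nhds hD, mfderivWithin_of_mem_nhds hD']

/-- The case of a rectangle over which the bundle is trivialized. -/
lemma rectangleHolonomy_of_frame (hV : V.HasCurvature (Form.pullback ((𝓡 n).prod (𝓡∂ 1)) ψ σ))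
    (hψ : ContMDiff ((𝓡 n).prod (𝓡∂ 1)) (𝓡 (2 * n)) ∞ ψ) {x₀ : M}
    {x : ℝ → EuclideanSpace ℝ (Fin n)} {w₀ w₁ t₀ t₁ : ℝ} {S : Set ℝ}
    (hp : IsChartPath c x₀ x w₀ w₁ S) (ht : t₀ ≤ t₁) {q : M × Icc (0 : ℝ) 1}
    {U : Set (EuclideanSpace ℝ (Fin n))} (hU : IsOpen U) (hUt : U ⊆ (extChartAt (𝓡 n) x₀).target)
    {O : Set ℝ} (hO : IsOpen O) (hq : MapsTo (cyl x₀) (U ×ˢ (Icc 0 1 ∩ O)) (V.dom q))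
    (hxU : MapsTo x (Icc w₀ w₁) U) (htO : Icc t₀ t₁ ⊆ Icc 0 1 ∩ O) :
    RectangleHolonomy V σ ψ c w₀ w₁ t₀ t₁ := by
  set K : Set ℝ := Icc 0 1 ∩ O
  have hK : UniqueDiffOn ℝ K := (uniqueDiffOn_Icc zero_lt_one).inter hO
  set D := U ×ˢ K
  have hD : UniqueDiffOn ℝ D := hU.uniqueDiffOn.prod hK
  have hDcyl : D ⊆ cylDom x₀ := prod_mono hUt inter_subset_left
  have hΦ : ContMDiffOn 𝓘(ℝ, EuclideanSpace ℝ (Fin n) × ℝ) ((𝓡 n).prod (𝓡∂ 1)) ∞ (cyl x₀) D :=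
    (contMDiffOn_cyl x₀).mono hDcyl
  set A := V.pullConn q (cyl x₀) D with hAdef
  have hA : ContDiffOn ℝ 1 A D := fun z hz =>
    (V.contDiffWithinAt_pullConn hΦ hD hz (hq hz)).of_le (by norm_cast)
  -- the frame along the horizontal sides
  have hhor : ∀ t ∈ Icc t₀ t₁, V.IsFramed q (fun w => (c w, projIcc (0 : ℝ) 1 zero_le_one t)) w₀ w₁
      (fun w => A (x w, t) (deriv (fun w => (x w, t)) w)) := by
    intro t htI
    have hder : ∀ w ∈ Ioo w₀ w₁ \ S, (deriv x w, (0 : ℝ)) = deriv (fun w => (x w, t)) w :=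
      fun w hw => (((hp.smooth w hw).differentiableAt (by simp)).hasDerivAt.prodMk
        (hasDerivAt_const w t)).deriv.symm
    refine V.isFramed_of_coordinates (z := fun w => (x w, t)) hp.le hΦ hD hq
      (fun w hw => ⟨hxU hw, htO htI⟩) (hp.continuousOn.prodMk continuousOn_const) hp.finite
      (fun w hw => (hp.smooth w hw).prodMk contDiffAt_const) ?_ (fun w hw => ?_)
    · refine intervalIntegrable_congr_off_finite hp.le hp.finite hder ?_
      exact ⟨(ContinuousLinearMap.inl ℝ (EuclideanSpace ℝ (Fin n)) ℝ).integrable_comp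
        hp.integrable.1, (ContinuousLinearMap.inl ℝ (EuclideanSpace ℝ (Fin n)) ℝ).integrable_comp
        hp.integrable.2⟩
    · simp only [cyl]
      rw [hp.eq w hw]
  have hhorint : ∀ t ∈ Icc t₀ t₁, ∫ w in w₀..w₁, A (x w, t) (deriv (fun w => (x w, t)) w) =
      ∫ w in w₀..w₁, A (x w, t) (deriv x w, 0) := by
    intro t htI
    refine intervalIntegral_congr_off_finite hp.le hp.finite fun w hw => ?_
    rw [(((hp.smooth w hw).differentiableAt (by simp)).hasDerivAt.prodMk
        (hasDerivAt_const w t)).deriv]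
  -- the frame along the vertical sides
  have hverder : ∀ w t : ℝ, deriv (fun t => (x w, t)) t = ((0 : EuclideanSpace ℝ (Fin n)), (1 : ℝ)) :=
    fun w t => ((hasDerivAt_const t (x w)).prodMk (hasDerivAt_id t)).deriv
  have hver : ∀ w ∈ Icc w₀ w₁, V.IsFramed q (fun t => (c w, projIcc (0 : ℝ) 1 zero_le_one t)) t₀ t₁
      (fun t => A (x w, t) (0, 1)) := by
    intro w hw
    have h := V.isFramed_of_coordinates (c := fun t => (c w, projIcc (0 : ℝ) 1 zero_le_one t))
      (z := fun t => (x w, t)) ht hΦ hD hq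
      (fun t htI => ⟨hxU hw, htO htI⟩) (continuousOn_const.prodMk continuousOn_id) finite_empty
      (fun t _ => contDiffAt_const.prodMk contDiffAt_id) ?_ (fun t htI => ?_)
    · simpa only [hverder] using h
    · rw [show deriv (fun t : ℝ => (x w, t)) = fun _ => (0, 1) from funext (hverder w)]
      exact intervalIntegrable_const
    · simp only [cyl]
      rw [hp.eq w hw]
  -- Green's formula
  have hgreen := green_rectangle hU hK hA hp.le ht hp.continuousOn hp.finite
    (fun w hw => (hp.smooth w hw).differentiableAt (by simp)) hp.integrable hxU htO
    (κ := fun p => 2 * Real.pi * Complex.I * (traceDensity σ ψ c p : ℂ)) (by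
      intro w hw t htI
      -- The curvature computation needs an open set, so the boundary points `t = 0` and `t = 1` of
      -- the cylinder are removed.
      have htO' : t ∈ O := (htO (Ioo_subset_Icc_self htI)).2
      have ht01 : t ∈ Ioo (0 : ℝ) 1 :=
        ⟨(htO (left_mem_Icc.2 ht)).1.1.trans_lt htI.1, htI.2.trans_le (htO (right_mem_Icc.2 ht)).1.2⟩
      set D' : Set (EuclideanSpace ℝ (Fin n) × ℝ) := U ×ˢ (Ioo 0 1 ∩ O)
      have hD'D : D' ⊆ D := prod_mono subset_rfl (inter_subset_inter_left _ Ioo_subset_Icc_self)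
      have hD'o : IsOpen D' := hU.prod (isOpen_Ioo.inter hO)
      have hz : (x w, t) ∈ D' := ⟨hxU (Ioo_subset_Icc_self hw.1), ht01, htO'⟩
      have hsrc : (cyl x₀ (x w, t)).1 ∈ (chartAt (EuclideanSpace ℝ (Fin n)) x₀).source := by
        have := (extChartAt (𝓡 n) x₀).map_target (hUt hz.1)
        rwa [extChartAt_source] at this
      have hcurv := hV.fderiv_pullConn (q := q) (Φ := cyl x₀)
        (Ψ := fun y => (extChartAt (𝓡 n) x₀ y.1, (y.2 : ℝ))) hD'o (hΦ.mono hD'D) hz (hq (hD'D hz))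
        (contMDiffAt_cyl_inverse x₀ hsrc) (by
          filter_upwards [hD'o.mem_nhds hz] with z hz
          simp only [cyl]
          rw [(extChartAt (𝓡 n) x₀).right_inv (hUt hz.1),
            projIcc_of_mem _ (Ioo_subset_Icc_self hz.2.1)]) (by
          have : ∀ᶠ y : M × Icc (0 : ℝ) 1 in 𝓝 (cyl x₀ (x w, t)), y.1 ∈ (extChartAt (𝓡 n) x₀).source :=
            continuousAt_fst.eventually_mem ((isOpen_extChartAt_source x₀).mem_nhds (by
              rwa [extChartAt_source]))
          filter_upwards [this] with y hy
          simp only [cyl]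
          rw [(extChartAt (𝓡 n) x₀).left_inv hy, projIcc_val]) (deriv x w, 0) (0, 1)
      have hev : ∀ v, (fun z => A z v) =ᶠ[𝓝 (x w, t)] fun z => V.pullConn q (cyl x₀) D' z v := by
        intro v
        filter_upwards [hD'o.mem_nhds hz] with z hz
        rw [hAdef, pullConn_of_mem_nhds (Filter.mem_of_superset (hD'o.mem_nhds hz) hD'D)
          (hD'o.mem_nhds hz)]
      rw [(hev _).fderiv_eq, (hev _).fderiv_eq, hcurv,
        hp.traceDensity_eq σ hψ hw (Ioo_subset_Icc_self ht01),
        pullback_cyl σ hψ (Filter.mem_of_superset (hD'o.mem_nhds hz) (hD'D.trans hDcyl))])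
  have hl := left_mem_Icc.2 hp.le
  have hr := right_mem_Icc.2 hp.le
  have hb := left_mem_Icc.2 ht
  have hT := right_mem_Icc.2 ht
  intro u u₁ u₂ u₃ u₄ h1 h2 h3 h4
  have e1 := (hhor t₀ hb).par_coord h1
  have e2 := (hver w₁ hr).par_coord h2
  have e3 := (hver w₀ hl).par_coord h3
  have e4 := (hhor t₁ hT).par_coord h4
  rw [hhorint _ hb] at e1
  rw [hhorint _ hT] at e4
  have hpr2 := h2.proj_right ht
  have hpr4 := h4.proj_right hp.le
  have hd2 : u₂.proj ∈ V.dom q := by rw [hpr2]; exact (hver w₁ hr).mapsTo hT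
  refine totalSpace_eq_of_coord (q := q) (hpr4.trans hpr2.symm) ?_ ?_
  · rw [hpr4]
    exact (hhor t₁ hT).mapsTo hr
  · rw [coord_scale _ hd2, e4, e3, e2, e1, ← mul_assoc, ← mul_assoc, ← mul_assoc, ← Complex.exp_add,
      ← Complex.exp_add, ← Complex.exp_add]
    congr 2
    rw [integral_const_mul, integral_complex_ofReal] at hgreen
    rw [hgreen]
    ring

end Rectangle

section RectangleGlobal

open MeasureTheory UnitaryLineBundle

variable {n : ℕ} {M : Type*} [TopologicalSpace M] [ChartedSpace (EuclideanSpace ℝ (Fin n)) M]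
  [IsManifold (𝓡 n) ∞ M] [T2Space M]
  {X : Type*} [TopologicalSpace X] [ChartedSpace (EuclideanSpace ℝ (Fin (2 * n))) X]
  {ψ : M × Icc (0 : ℝ) 1 → X} {σ : Form (𝓡 (2 * n)) X 2} {c : ℝ → M} {a b : ℝ}
  {V : UnitaryLineBundle ((𝓡 n).prod (𝓡∂ 1)) (M × Icc (0 : ℝ) 1)}

lemma scale_scale {E H : Type*} [NormedAddCommGroup E] [NormedSpace ℝ E] [TopologicalSpace H]
    {I : ModelWithCorners ℝ E H} {M : Type*} [TopologicalSpace M] [ChartedSpace H M]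
    [IsManifold I ∞ M] {V : UnitaryLineBundle I M} (l m : ℂ) (u : TotalSpace ℂ V.fiber) :
    scale l (scale m u) = scale (l * m) u :=
  congrArg (TotalSpace.mk u.proj) (smul_smul l m u.2)

lemma exp_integral_union {f : ℝ × ℝ → ℝ} {s t : Set (ℝ × ℝ)} (hst : Disjoint s t)
    (ht : MeasurableSet t) (hfs : IntegrableOn f s) (hft : IntegrableOn f t) :
    Complex.exp (2 * Real.pi * Complex.I * ((∫ p in s ∪ t, f p : ℝ) : ℂ)) =
      Complex.exp (2 * Real.pi * Complex.I * ((∫ p in s, f p : ℝ) : ℂ)) *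
        Complex.exp (2 * Real.pi * Complex.I * ((∫ p in t, f p : ℝ) : ℂ)) := by
  rw [setIntegral_union hst ht hfs hft, ← Complex.exp_add]
  push_cast
  ring_nf

/-- Two rectangles side by side. -/
lemma RectangleHolonomy.trans_horizontal (hc : IsRectifiablePath (𝓡 n) c a b)
    (hint : IntegrableOn (traceDensity σ ψ c) (Ioc a b ×ˢ Icc 0 1)) {x y z t₀ t₁ : ℝ}
    (hax : a ≤ x) (hxy : x ≤ y) (hyz : y ≤ z) (hzb : z ≤ b) (h₀ : 0 ≤ t₀) (ht : t₀ ≤ t₁)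
    (h₁ : t₁ ≤ 1) (h : RectangleHolonomy V σ ψ c x y t₀ t₁)
    (h' : RectangleHolonomy V σ ψ c y z t₀ t₁) : RectangleHolonomy V σ ψ c x z t₀ t₁ := by
  intro u u₁ u₂ u₃ u₄ hb hr hl ht'
  obtain ⟨m, hb1, hb2⟩ := hb.split hxy hyz
  obtain ⟨p, ht1, ht2⟩ := ht'.split hxy hyz
  -- Transport along the common vertical side, then along the top of the second rectangle.
  obtain ⟨m', hm', -⟩ := par_exists (V := V) (isRectifiablePath_vertical (c y) h₀ ht h₁)
    (u := m) (hb1.proj_right hxy)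
  have e1 := h _ _ _ _ _ hb1 hm' hl ht1
  have hrec : IsRectifiablePath ((𝓡 n).prod (𝓡∂ 1))
      (fun w => (c w, projIcc (0 : ℝ) 1 zero_le_one t₁)) y z :=
    (isRectifiablePath_horizontal hc t₁).mono (hax.trans hxy) hyz hzb
  obtain ⟨r, hr', -⟩ := par_exists (V := V) hrec (u := m') (hm'.proj_right ht)
  have e2 := h' _ _ _ _ _ hb2 hr hm' hr'
  rw [e1] at ht2
  have e3 := par_unique hrec ht2 (hr'.scale _)
  rw [e3, e2, scale_scale]
  have hsub : ∀ v w, a ≤ v → w ≤ b → IntegrableOn (traceDensity σ ψ c) (Ioc v w ×ˢ Ioc t₀ t₁) :=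
    fun v w hv hw => hint.mono_set (prod_mono (Ioc_subset_Ioc hv hw)
      (Ioc_subset_Icc_self.trans (Icc_subset_Icc h₀ h₁)))
  rw [← exp_integral_union _ (measurableSet_Ioc.prod measurableSet_Ioc)
    (hsub x y hax (hyz.trans hzb)) (hsub y z (hax.trans hxy) hzb), ← union_prod,
    Ioc_union_Ioc_eq_Ioc hxy hyz]
  exact Disjoint.set_prod_left (Ioc_disjoint_Ioc_of_le le_rfl) _ _

/-- Two rectangles on top of each other. -/
lemma RectangleHolonomy.trans_vertical (hc : IsRectifiablePath (𝓡 n) c a b)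
    (hint : IntegrableOn (traceDensity σ ψ c) (Ioc a b ×ˢ Icc 0 1)) {x y r s t : ℝ}
    (hax : a ≤ x) (hxy : x ≤ y) (hyb : y ≤ b) (h₀ : 0 ≤ r) (hrs : r ≤ s) (hst : s ≤ t)
    (h₁ : t ≤ 1) (h : RectangleHolonomy V σ ψ c x y r s)
    (h' : RectangleHolonomy V σ ψ c x y s t) : RectangleHolonomy V σ ψ c x y r t := by
  intro u u₁ u₂ u₃ u₄ hb hr hl ht'
  obtain ⟨m₁, hr1, hr2⟩ := hr.split hrs hst
  obtain ⟨m₀, hl1, hl2⟩ := hl.split hrs hst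
  have hrec : IsRectifiablePath ((𝓡 n).prod (𝓡∂ 1))
      (fun w => (c w, projIcc (0 : ℝ) 1 zero_le_one s)) x y :=
    (isRectifiablePath_horizontal hc s).mono hax hxy hyb
  -- Transport along the common horizontal side, then along the right side of the upper rectangle.
  obtain ⟨m, hm, -⟩ := par_exists (V := V) hrec (u := m₀) (hl1.proj_right hrs)
  have e1 := h _ _ _ _ _ hb hr1 hl1 hm
  obtain ⟨v, hv, -⟩ := par_exists (V := V)
    (isRectifiablePath_vertical (c y) (h₀.trans hrs) hst h₁) (u := m) (hm.proj_right hxy)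
  have e2 := h' _ _ _ _ _ hm hv hl2 ht'
  rw [e1] at hv
  have e3 := par_unique (isRectifiablePath_vertical (c y) (h₀.trans hrs) hst h₁) hv (hr2.scale _)
  rw [e2, e3, scale_scale, mul_comm]
  have hsub : ∀ v w, 0 ≤ v → w ≤ 1 → IntegrableOn (traceDensity σ ψ c) (Ioc x y ×ˢ Ioc v w) :=
    fun v w hv hw => hint.mono_set (prod_mono (Ioc_subset_Ioc hax hyb)
      (Ioc_subset_Icc_self.trans (Icc_subset_Icc hv hw)))
  rw [← exp_integral_union _ (measurableSet_Ioc.prod measurableSet_Ioc)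
    (hsub r s h₀ (hst.trans h₁)) (hsub s t (h₀.trans hrs) h₁), ← prod_union,
    Ioc_union_Ioc_eq_Ioc hrs hst]
  exact Disjoint.set_prod_right (Ioc_disjoint_Ioc_of_le le_rfl) _ _

/-- The holonomy of a line bundle of curvature `2πi ψ^* σ` around the trace of a path. The
rectangle is subdivided until the bundle is trivialized over the pieces. -/
theorem rectangleHolonomy [IsManifold (𝓡 (2 * n)) ∞ X]
    (hV : V.HasCurvature (Form.pullback ((𝓡 n).prod (𝓡∂ 1)) ψ σ)) (hσ : σ.IsSmooth)
    (hψ : ContMDiff ((𝓡 n).prod (𝓡∂ 1)) (𝓡 (2 * n)) ∞ ψ) (hc : IsRectifiablePath (𝓡 n) c a b) :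
    RectangleHolonomy V σ ψ c a b 0 1 := by
  have hint := integrableOn_traceDensity hσ hψ hc
  refine interval_subdivision (Q := fun r s => RectangleHolonomy V σ ψ c a b r s) zero_le_one
    (fun r s t h1 h2 h3 h4 h5 h6 => h5.trans_vertical hc hint le_rfl hc.le le_rfl h1 h2 h3 h4 h6) ?_
  intro τ₀ hτ₀
  -- uniformity in the path parameter of the size of the intervals around `τ₀`
  have key : ∃ ε > 0, ∀ r s, 0 ≤ r → r ≤ s → s ≤ 1 → |r - τ₀| < ε → |s - τ₀| < ε →
      RectangleHolonomy V σ ψ c a b r s := by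
    refine interval_subdivision (Q := fun x y => ∃ ε > 0, ∀ r s, 0 ≤ r → r ≤ s → s ≤ 1 →
      |r - τ₀| < ε → |s - τ₀| < ε → RectangleHolonomy V σ ψ c x y r s) hc.le ?_ ?_
    · rintro x y z hx hxy hyz hz ⟨ε, hε, h⟩ ⟨ε', hε', h'⟩
      refine ⟨min ε ε', lt_min hε hε', fun r s h1 h2 h3 h4 h5 => ?_⟩
      exact RectangleHolonomy.trans_horizontal hc hint hx hxy hyz hz h1 h2 h3
        (h r s h1 h2 h3 (h4.trans_le (min_le_left _ _)) (h5.trans_le (min_le_left _ _)))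
        (h' r s h1 h2 h3 (h4.trans_le (min_le_right _ _)) (h5.trans_le (min_le_right _ _)))
    · intro w₀ hw₀
      set q : M × Icc (0 : ℝ) 1 := (c w₀, projIcc 0 1 zero_le_one τ₀)
      obtain ⟨U, hU, W, hW, hUW⟩ := mem_nhds_prod_iff.1
        ((isOpen_dom (V := V) q).mem_nhds (mem_dom_self q))
      have hW' : projIcc (0 : ℝ) 1 zero_le_one ⁻¹' W ∈ 𝓝 τ₀ :=
        continuous_projIcc.continuousAt.preimage_mem_nhds hW
      obtain ⟨δ, hδ, hball⟩ := Metric.mem_nhds_iff.1 hW'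
      obtain ⟨ε, hε, hloc⟩ := hc.exists_isChartPath hw₀ (interior_mem_nhds.2 hU)
      refine ⟨ε, hε, fun x y hx hxy hy hxε hyε => ⟨δ, hδ, fun r s hr hrs hs hrδ hsδ => ?_⟩⟩
      obtain ⟨⟨S, hp⟩, hmU⟩ := hloc x y hx hxy hy hxε hyε
      have hsymm : ContinuousOn (extChartAt (𝓡 n) (c w₀)).symm (extChartAt (𝓡 n) (c w₀)).target :=
        continuousOn_extChartAt_symm _
      refine rectangleHolonomy_of_frame hV hψ hp hrs (q := q)
        (U := (extChartAt (𝓡 n) (c w₀)).target ∩ (extChartAt (𝓡 n) (c w₀)).symm ⁻¹' interior U)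
        (hsymm.isOpen_inter_preimage (isOpen_extChartAt_target _) isOpen_interior)
        inter_subset_left (O := Metric.ball τ₀ δ) Metric.isOpen_ball ?_ ?_ ?_
      · rintro z ⟨⟨hz1, hz2⟩, -, hz3⟩
        exact hUW ⟨interior_subset hz2, hball hz3⟩
      · intro w hw
        refine ⟨hp.mapsTo hw, ?_⟩
        rw [mem_preimage, ← hp.eq w hw]
        exact hmU hw
      · intro t ht
        refine ⟨⟨hr.trans ht.1, ht.2.trans hs⟩, ?_⟩
        rw [abs_lt] at hrδ hsδ
        rw [Metric.mem_ball, Real.dist_eq, abs_lt]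
        exact ⟨by linarith [ht.1], by linarith [ht.2]⟩
  exact key

end RectangleGlobal

/-! ### Diffeomorphisms of plane domains -/

section Plane

open MeasureTheory

/-- The Jacobian determinant of a map of the plane. -/
def planeJac (f : ℂ → ℂ) (z : ℂ) : ℝ :=
  (fderiv ℝ f z 1).re * (fderiv ℝ f z Complex.I).im -
    (fderiv ℝ f z Complex.I).re * (fderiv ℝ f z 1).im

lemma det_eq_planeJac (f : ℂ → ℂ) (z : ℂ) : (fderiv ℝ f z).det = planeJac f z := by
  rw [ContinuousLinearMap.det, ← LinearMap.det_toMatrix Complex.basisOneI, Matrix.det_fin_two]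
  simp [LinearMap.toMatrix_apply, planeJac, Complex.coe_basisOneI]

variable {f : ℂ → ℂ} {U V : Set ℂ}

/-- The inverse of a smooth bijection with nonzero Jacobian is smooth. -/
lemma contDiffAt_invFunOn (hU : IsOpen U) (hf : BijOn f U V) (hs : ContDiffOn ℝ ∞ f U)
    (hJ : ∀ z ∈ U, planeJac f z ≠ 0) {y : ℂ} (hy : y ∈ V) :
    ContDiffAt ℝ ∞ (invFunOn f U) y := by
  obtain ⟨z, hz, rfl⟩ := hf.surjOn hy
  have hfz : ContDiffAt ℝ ∞ f z := hs.contDiffAt (hU.mem_nhds hz)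
  have hdet : (fderiv ℝ f z).det ≠ 0 := by
    rw [det_eq_planeJac]
    exact hJ z hz
  set f' : ℂ ≃L[ℝ] ℂ := (fderiv ℝ f z).toContinuousLinearEquivOfDetNeZero hdet
  have hf' : HasFDerivAt f (f' : ℂ →L[ℝ] ℂ) z := by
    rw [ContinuousLinearMap.coe_toContinuousLinearEquivOfDetNeZero]
    exact (hfz.differentiableAt (by simp)).hasFDerivAt
  -- Near `f z` the global inverse agrees with the local inverse of the inverse function theorem.
  have hloc := hfz.to_localInverse hf' (by simp)
  refine hloc.congr_of_eventuallyEq ?_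
  have hst := hfz.hasStrictFDerivAt' hf' (by simp)
  have h1 : ∀ᶠ y in 𝓝 (f z), f (hfz.localInverse hf' (by simp) y) = y :=
    hst.eventually_right_inverse
  have h2 : ∀ᶠ y in 𝓝 (f z), hfz.localInverse hf' (by simp) y ∈ U := by
    refine hloc.continuousAt.eventually_mem ?_
    rw [hfz.localInverse_apply_image hf' (by simp)]
    exact hU.mem_nhds hz
  filter_upwards [h1, h2] with y hy1 hy2
  refine hf.injOn (invFunOn_mem ⟨_, hy2, hy1⟩) hy2 ?_
  rw [invFunOn_eq ⟨_, hy2, hy1⟩, hy1]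

/-- Preimages of null sets are null, as they are images under the differentiable inverse. -/
lemma volume_preimage_eq_zero (hU : IsOpen U) (hf : BijOn f U V) (hs : ContDiffOn ℝ ∞ f U)
    (hJ : ∀ z ∈ U, planeJac f z ≠ 0) {N : Set ℂ} (hN : volume N = 0) (hNV : N ⊆ V) :
    volume (U ∩ f ⁻¹' N) = 0 := by
  have himg : U ∩ f ⁻¹' N ⊆ invFunOn f U '' N := by
    rintro z ⟨hz, hzN⟩
    exact ⟨f z, hzN, hf.injOn (invFunOn_mem ⟨z, hz, rfl⟩) hz (invFunOn_eq ⟨z, hz, rfl⟩)⟩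
  refine measure_mono_null himg (addHaar_image_eq_zero_of_differentiableOn_of_addHaar_eq_zero _
    (fun y hy => ?_) hN)
  exact ((contDiffAt_invFunOn hU hf hs hJ (hNV hy)).differentiableAt
    (by simp)).differentiableWithinAt

/-- A smooth arc has measure zero. -/
lemma volume_arc_eq_zero {c : ℝ → ℂ} (hc : ContDiffOn ℝ ∞ c (Ioo 0 1)) :
    volume (c '' Ioo 0 1) = 0 := by
  -- The arc is the image of a strip under `z ↦ c (Re z)`, whose differential has rank at most one.
  have himg : c '' Ioo 0 1 ⊆ (fun z : ℂ => c z.re) '' (Complex.re ⁻¹' Ioo 0 1) := by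
    rintro _ ⟨s, hs, rfl⟩
    exact ⟨(s : ℂ), by simpa using hs, by simp⟩
  refine measure_mono_null himg (addHaar_image_eq_zero_of_det_fderivWithin_eq_zero _
    (f' := fun z => (fderiv ℝ c z.re).comp Complex.reCLM) (fun z hz => ?_) (fun z hz => ?_))
  · have h1 := (hc.contDiffAt (isOpen_Ioo.mem_nhds hz)).differentiableAt (by simp)
    exact (h1.hasFDerivAt.comp z Complex.reCLM.hasFDerivAt).hasFDerivWithinAt
  · rw [ContinuousLinearMap.det, LinearMap.det_eq_zero_iff_ker_ne_bot]
    intro h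
    have h2 : Complex.I ∈ LinearMap.ker
        ((((fderiv ℝ c z.re).comp Complex.reCLM : ℂ →L[ℝ] ℂ)) : ℂ →ₗ[ℝ] ℂ) := by
      simp
    rw [h] at h2
    exact Complex.I_ne_zero h2

/-- Change of variables for 2-forms of the plane. -/
lemma integral_planeJac_smul (hU : IsOpen U) (hf : BijOn f U V) (hs : ContDiffOn ℝ ∞ f U) {ε : ℝ}
    (hε : ε = 1 ∨ ε = -1) (hJ : ∀ z ∈ U, 0 < ε * planeJac f z) {g : ℂ → ℝ} (hg : IntegrableOn g V) :
    IntegrableOn (fun z => planeJac f z * g (f z)) U ∧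
      ∫ z in U, planeJac f z * g (f z) = ε * ∫ z in V, g z := by
  have hder : ∀ z ∈ U, HasFDerivWithinAt f (fderiv ℝ f z) U z := fun z hz =>
    ((hs.contDiffAt (hU.mem_nhds hz)).differentiableAt (by simp)).hasFDerivAt.hasFDerivWithinAt
  have habs : ∀ z ∈ U, |(fderiv ℝ f z).det| • g (f z) = ε * (planeJac f z * g (f z)) := by
    intro z hz
    have h1 := hJ z hz
    rw [det_eq_planeJac, smul_eq_mul, ← mul_assoc]
    congr 1
    rcases hε with rfl | rfl
    · rw [one_mul] at h1 ⊢
      exact abs_of_pos h1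
    · rw [neg_one_mul] at h1 ⊢
      exact abs_of_neg (by linarith)
  have hεε : ε * ε = 1 := by rcases hε with rfl | rfl <;> norm_num
  have hi : IntegrableOn (fun z => ε * (planeJac f z * g (f z))) U := by
    rw [← hf.image_eq, integrableOn_image_iff_integrableOn_abs_det_fderiv_smul volume
      hU.measurableSet hder hf.injOn] at hg
    exact hg.congr_fun habs hU.measurableSet
  have he : ∀ z, planeJac f z * g (f z) = ε * (ε * (planeJac f z * g (f z))) := fun z => by
    rw [← mul_assoc ε, hεε, one_mul]
  refine ⟨?_, ?_⟩
  · have := hi.const_mul ε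
    exact this.congr (Filter.Eventually.of_forall fun z => (he z).symm)
  · have h2 : ∫ z in V, g z = ∫ z in U, ε * (planeJac f z * g (f z)) := by
      rw [← hf.image_eq, integral_image_eq_integral_abs_det_fderiv_smul volume hU.measurableSet hder
        hf.injOn]
      exact setIntegral_congr_fun hU.measurableSet habs
    rw [h2, integral_const_mul, ← mul_assoc, hεε, one_mul]

section Density

variable {E H : Type*} [NormedAddCommGroup E] [NormedSpace ℝ E] [TopologicalSpace H]
  {I : ModelWithCorners ℝ E H} {M : Type*} [TopologicalSpace M] [ChartedSpace H M]

lemma form_two_swap (σ : Form I M 2) (x : M) (v w : TangentSpace I x) :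
    σ x ![w, v] = - σ x ![v, w] := by
  have h := (σ x).map_swap ![v, w] (i := 0) (j := 1) (by decide)
  refine Eq.trans ?_ h
  change (σ x) ![w, v] = (σ x) (![v, w] ∘ Equiv.swap 0 1)
  congr 1
  funext i
  fin_cases i <;> rfl

lemma form_two_self (σ : Form I M 2) (x : M) (v : TangentSpace I x) : σ x ![v, v] = 0 :=
  (σ x).map_eq_zero_of_eq ![v, v] (i := 0) (j := 1) rfl (by decide)

/-- A 2-form on linear combinations of two vectors is multiplied by the determinant. -/
lemma form_two_det (σ : Form I M 2) (x : M) (v w : TangentSpace I x) (a b c d : ℝ) :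
    σ x ![a • v + b • w, c • v + d • w] = (a * d - c * b) * σ x ![v, w] := by
  have hr : ∀ p : TangentSpace I x, σ x ![p, c • v + d • w] = c * σ x ![p, v] + d * σ x ![p, w] := by
    intro p
    rw [form_two_swap, form_two_map_add_left, form_two_map_smul_left, form_two_map_smul_left,
      form_two_swap σ x p v, form_two_swap σ x p w]
    ring
  rw [form_two_map_add_left, form_two_map_smul_left, form_two_map_smul_left, hr, hr, form_two_self,
    form_two_self, form_two_swap σ x v w]
  ring

/-- Pullback by a map of the plane multiplies the density by the Jacobian determinant. -/
lemma discDensity_comp (σ : Form I M 2) {u : ℂ → M} {z : ℂ}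
    (hu : MDifferentiableAt 𝓘(ℝ, ℂ) I u (f z)) (hf : DifferentiableAt ℝ f z) :
    discDensity σ (fun z => u (f z)) z = planeJac f z * discDensity σ u (f z) := by
  have h := mfderiv_comp z hu hf.mdifferentiableAt
  rw [mfderiv_eq_fderiv] at h
  have haux : ∀ (L : ℂ →L[ℝ] E) (p : ℂ), L p = p.re • L 1 + p.im • L Complex.I := by
    intro L p
    have h2 : p = p.re • (1 : ℂ) + p.im • Complex.I := by
      simp [Complex.re_add_im]
    conv_lhs => rw [h2]
    rw [map_add, map_smul, map_smul]
  have hv : ∀ v : ℂ, (mfderiv 𝓘(ℝ, ℂ) I (fun z => u (f z)) z v : E) =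
      (fderiv ℝ f z v).re • (mfderiv 𝓘(ℝ, ℂ) I u (f z) (1 : ℂ) : E) +
        (fderiv ℝ f z v).im • (mfderiv 𝓘(ℝ, ℂ) I u (f z) Complex.I : E) := by
    intro v
    have h1 : (mfderiv 𝓘(ℝ, ℂ) I (fun z => u (f z)) z v : E) =
        (mfderiv 𝓘(ℝ, ℂ) I u (f z) : ℂ →L[ℝ] E) (fderiv ℝ f z v) :=
      congrArg (fun L : ℂ →L[ℝ] E => L v) h
    exact h1.trans (haux _ _)
  simp only [discDensity]
  rw [form_two_congr σ rfl (hv 1) (hv Complex.I)]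
  exact form_two_det σ _ _ _ _ _ _ _

lemma discDensity_congr (σ : Form I M 2) {u v : ℂ → M} {z : ℂ} (h : u =ᶠ[𝓝 z] v) :
    discDensity σ u z = discDensity σ v z := by
  have h1 : (mfderiv 𝓘(ℝ, ℂ) I u z : ℂ →L[ℝ] E) = mfderiv 𝓘(ℝ, ℂ) I v z := h.mfderiv_eq
  exact form_two_congr σ h.eq_of_nhds (congrArg (fun L : ℂ →L[ℝ] E => L 1) h1)
    (congrArg (fun L : ℂ →L[ℝ] E => L Complex.I) h1)

end Density

end Plane

/-! ### The two regions of the disc -/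

section Regions

variable {α β : ℝ}

/-- The real linear functional whose level `cos ((β - α) / 2)` is the line through `exp (iα)` and
`exp (iβ)`. -/
def chordHeight (α β : ℝ) : ℂ →L[ℝ] ℝ :=
  Complex.reCLM.comp
    ((ContinuousLinearMap.mul ℝ ℂ).flip (Complex.exp (-((α + β) / 2 : ℝ) * Complex.I)))

lemma chordHeight_apply (z : ℂ) :
    chordHeight α β z = (z * Complex.exp (-((α + β) / 2 : ℝ) * Complex.I)).re := rfl

lemma chordHeight_mul_exp (w : ℂ) :
    chordHeight α β (w * Complex.exp (((α + β) / 2 : ℝ) * Complex.I)) = w.re := by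
  rw [chordHeight_apply, mul_assoc, ← Complex.exp_add]
  simp

lemma isOpenMap_chordHeight : IsOpenMap (chordHeight α β) := by
  refine (chordHeight α β).isOpenMap fun r =>
    ⟨r * Complex.exp (((α + β) / 2 : ℝ) * Complex.I), ?_⟩
  rw [chordHeight_mul_exp, Complex.ofReal_re]

lemma mainRegion_eq : mainRegion α β =
    Metric.closedBall 0 1 ∩ chordHeight α β ⁻¹' Iic (Real.cos ((β - α) / 2)) := by
  ext z
  simp [mainRegion, chordHeight_apply]

lemma segmentRegion_eq : segmentRegion α β =
    Metric.closedBall 0 1 ∩ chordHeight α β ⁻¹' Ici (Real.cos ((β - α) / 2)) := by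
  ext z
  simp [segmentRegion, chordHeight_apply]

lemma isClosed_mainRegion : IsClosed (mainRegion α β) := by
  rw [mainRegion_eq]
  exact Metric.isClosed_closedBall.inter (isClosed_Iic.preimage (chordHeight α β).continuous)

lemma isClosed_segmentRegion : IsClosed (segmentRegion α β) := by
  rw [segmentRegion_eq]
  exact Metric.isClosed_closedBall.inter (isClosed_Ici.preimage (chordHeight α β).continuous)

lemma union_regions : mainRegion α β ∪ segmentRegion α β = Metric.closedBall 0 1 := by
  rw [mainRegion_eq, segmentRegion_eq, ← inter_union_distrib_left, ← preimage_union,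
    Iic_union_Ici, preimage_univ, inter_univ]

lemma interior_mainRegion : interior (mainRegion α β) =
    Metric.ball 0 1 ∩ chordHeight α β ⁻¹' Iio (Real.cos ((β - α) / 2)) := by
  rw [mainRegion_eq, interior_inter, interior_closedBall _ one_ne_zero,
    ← isOpenMap_chordHeight.preimage_interior_eq_interior_preimage (chordHeight α β).continuous,
    interior_Iic]

lemma interior_segmentRegion : interior (segmentRegion α β) =
    Metric.ball 0 1 ∩ chordHeight α β ⁻¹' Ioi (Real.cos ((β - α) / 2)) := by
  rw [segmentRegion_eq, interior_inter, interior_closedBall _ one_ne_zero,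
    ← isOpenMap_chordHeight.preimage_interior_eq_interior_preimage (chordHeight α β).continuous,
    interior_Ici]

lemma disjoint_interior_regions :
    Disjoint (interior (mainRegion α β)) (interior (segmentRegion α β)) := by
  rw [interior_mainRegion, interior_segmentRegion, Set.disjoint_left]
  rintro z ⟨_, h1⟩ ⟨_, h2⟩
  exact lt_asymm (show chordHeight α β z < _ from h1) (show _ < chordHeight α β z from h2)

lemma chordHeight_exp (s : ℝ) :
    chordHeight α β (Complex.exp (s * Complex.I)) = Real.cos (s - (α + β) / 2) := by
  rw [chordHeight_apply, ← Complex.exp_add, ← Complex.exp_ofReal_mul_I_re]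
  congr 2
  push_cast
  ring

lemma exp_mem_segmentRegion (hβ : β < α + 2 * Real.pi) {s : ℝ} (hs : s ∈ Icc α β) :
    Complex.exp (s * Complex.I) ∈ segmentRegion α β := by
  rw [segmentRegion_eq]
  refine ⟨by simp [Complex.norm_exp_ofReal_mul_I], ?_⟩
  rw [mem_preimage, chordHeight_exp, mem_Ici, ← Real.cos_abs (s - _)]
  refine Real.cos_le_cos_of_nonneg_of_le_pi (abs_nonneg _) (by linarith) (abs_le.2 ⟨?_, ?_⟩) <;>
    linarith [hs.1, hs.2]

lemma exp_mem_mainRegion_right (hαβ : α < β) {s : ℝ} (hs : s ∈ Icc β (α + 2 * Real.pi)) :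
    Complex.exp (s * Complex.I) ∈ mainRegion α β := by
  rw [mainRegion_eq]
  refine ⟨by simp [Complex.norm_exp_ofReal_mul_I], ?_⟩
  rw [mem_preimage, chordHeight_exp, mem_Iic]
  rcases le_total (s - (α + β) / 2) Real.pi with h | h
  · exact Real.cos_le_cos_of_nonneg_of_le_pi (by linarith) h (by linarith [hs.1])
  · rw [← Real.cos_two_pi_sub]
    exact Real.cos_le_cos_of_nonneg_of_le_pi (by linarith) (by linarith) (by linarith [hs.2])

lemma exp_mem_mainRegion_left (hαβ : α < β) {s : ℝ} (hs : s ∈ Icc (β - 2 * Real.pi) α) :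
    Complex.exp (s * Complex.I) ∈ mainRegion α β := by
  have h := exp_mem_mainRegion_right hαβ (s := s + 2 * Real.pi)
    ⟨by linarith [hs.1], by linarith [hs.2]⟩
  rwa [show ((s + 2 * Real.pi : ℝ) : ℂ) * Complex.I = s * Complex.I + 2 * Real.pi * Complex.I by
    push_cast; ring, Complex.exp_periodic] at h

lemma exp_injOn (hβ : β < α + 2 * Real.pi) :
    InjOn (fun s : ℝ => Complex.exp (s * Complex.I)) (Icc α β) := by
  intro s hs s' hs' h
  obtain ⟨N, hN⟩ := Complex.exp_eq_exp_iff_exists_int.1 h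
  have h1 : s = s' + N * (2 * Real.pi) := by
    have := congrArg Complex.im hN
    simpa using this
  have hpi := Real.pi_pos
  have h2 : N = 0 := by
    have h3 : (N : ℝ) < 1 := by
      by_contra! h4
      nlinarith [hs.1, hs.2, hs'.1, hs'.2]
    have h4 : (-1 : ℝ) < N := by
      by_contra! h5
      nlinarith [hs.1, hs.2, hs'.1, hs'.2]
    have h5 : N < 1 := by exact_mod_cast h3
    have h6 : -1 < N := by exact_mod_cast h4
    omega
  rw [h1, h2]
  simp

lemma chordPoint_eq (s : ℝ) : chordPoint α β s =
    (Real.cos ((β - α) / 2) + ((2 * s - 1) * Real.sin ((β - α) / 2) : ℝ) * Complex.I) *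
      Complex.exp (((α + β) / 2 : ℝ) * Complex.I) := by
  have h1 : Complex.exp (α * Complex.I) = Complex.exp ((-((β - α) / 2) : ℝ) * Complex.I) *
      Complex.exp (((α + β) / 2 : ℝ) * Complex.I) := by
    rw [← Complex.exp_add]
    congr 1
    push_cast
    ring
  have h2 : Complex.exp (β * Complex.I) = Complex.exp (((β - α) / 2 : ℝ) * Complex.I) *
      Complex.exp (((α + β) / 2 : ℝ) * Complex.I) := by
    rw [← Complex.exp_add]
    congr 1
    push_cast
    ring
  have h3 : ∀ x : ℝ, Complex.exp (x * Complex.I) = Real.cos x + Real.sin x * Complex.I := fun x => by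
    rw [Complex.exp_mul_I, Complex.ofReal_cos, Complex.ofReal_sin]
  rw [chordPoint, h1, h2, h3 (-((β - α) / 2)), h3 ((β - α) / 2), Real.cos_neg, Real.sin_neg]
  push_cast
  ring

lemma contDiff_chordPoint : ContDiff ℝ ∞ (chordPoint α β) := by
  have h : ContDiff ℝ ∞ (fun s : ℝ => (s : ℂ)) := Complex.ofRealCLM.contDiff
  exact ((contDiff_const.sub h).mul contDiff_const).add (h.mul contDiff_const)

lemma chordPoint_zero : chordPoint α β 0 = Complex.exp (α * Complex.I) := by
  simp [chordPoint]

lemma chordPoint_one : chordPoint α β 1 = Complex.exp (β * Complex.I) := by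
  simp [chordPoint]

lemma chordHeight_chordPoint (s : ℝ) :
    chordHeight α β (chordPoint α β s) = Real.cos ((β - α) / 2) := by
  rw [chordPoint_eq, chordHeight_mul_exp, Complex.add_re, Complex.ofReal_re, Complex.re_ofReal_mul,
    Complex.I_re, mul_zero, add_zero]

/-- A point on the line through the end points of the chord, at signed distance
`(2 s - 1) sin ((β - α) / 2)` from its middle. -/
lemma exists_chordPoint_of_chordHeight (hαβ : α < β) (hβ : β < α + 2 * Real.pi) {z : ℂ}
    (hz : chordHeight α β z = Real.cos ((β - α) / 2)) :
    ∃ s, z = chordPoint α β s ∧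
      ‖z‖ ^ 2 = 1 - 4 * (s * (1 - s)) * Real.sin ((β - α) / 2) ^ 2 := by
  have hsin : 0 < Real.sin ((β - α) / 2) := Real.sin_pos_of_pos_of_lt_pi (by linarith) (by linarith)
  set e := Complex.exp (((α + β) / 2 : ℝ) * Complex.I)
  set w := z * Complex.exp (-((α + β) / 2 : ℝ) * Complex.I) with hw
  have hzw : z = w * e := by
    rw [hw, mul_assoc, ← Complex.exp_add]
    simp
  have hre : w.re = Real.cos ((β - α) / 2) := by rw [← hz, chordHeight_apply]
  have hs : (2 * ((w.im / Real.sin ((β - α) / 2) + 1) / 2) - 1) * Real.sin ((β - α) / 2) =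
      w.im := by
    field_simp
    ring
  refine ⟨(w.im / Real.sin ((β - α) / 2) + 1) / 2, ?_, ?_⟩
  · rw [chordPoint_eq, hs, ← hre, Complex.re_add_im]
    exact hzw
  · have h1 : ‖z‖ ^ 2 = w.re ^ 2 + w.im ^ 2 := by
      rw [hzw, norm_mul, Complex.norm_exp_ofReal_mul_I, mul_one, Complex.sq_norm,
        Complex.normSq_apply]
      ring
    rw [h1, hre, Real.cos_sq']
    field_simp
    ring

lemma mem_chord_of_mem_ball (hαβ : α < β) (hβ : β < α + 2 * Real.pi) {z : ℂ}
    (hz : z ∈ Metric.ball (0 : ℂ) 1) (h : chordHeight α β z = Real.cos ((β - α) / 2)) :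
    z ∈ chordPoint α β '' Ioo 0 1 := by
  obtain ⟨s, hs, hn⟩ := exists_chordPoint_of_chordHeight hαβ hβ h
  have hsin : 0 < Real.sin ((β - α) / 2) := Real.sin_pos_of_pos_of_lt_pi (by linarith) (by linarith)
  rw [mem_ball_zero_iff] at hz
  have h1 : ‖z‖ ^ 2 < 1 := by nlinarith [norm_nonneg z]
  have h2 : 0 < s * (1 - s) := by
    by_contra! h3
    nlinarith [sq_pos_of_pos hsin]
  refine ⟨s, ⟨?_, ?_⟩, hs.symm⟩ <;> nlinarith

lemma mem_chord_of_mem_closedBall (hαβ : α < β) (hβ : β < α + 2 * Real.pi) {z : ℂ}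
    (hz : ‖z‖ ≤ 1) (h : chordHeight α β z = Real.cos ((β - α) / 2)) :
    z ∈ chordPoint α β '' Icc 0 1 := by
  obtain ⟨s, hs, hn⟩ := exists_chordPoint_of_chordHeight hαβ hβ h
  have hsin : 0 < Real.sin ((β - α) / 2) := Real.sin_pos_of_pos_of_lt_pi (by linarith) (by linarith)
  have h1 : ‖z‖ ^ 2 ≤ 1 := by nlinarith [norm_nonneg z]
  have h2 : 0 ≤ s * (1 - s) := by
    by_contra! h3
    nlinarith [sq_pos_of_pos hsin]
  refine ⟨s, ⟨?_, ?_⟩, hs.symm⟩ <;> nlinarith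

lemma chordPoint_mem_ball (hαβ : α < β) (hβ : β < α + 2 * Real.pi) {s : ℝ} (hs : s ∈ Ioo (0 : ℝ) 1) :
    chordPoint α β s ∈ Metric.ball (0 : ℂ) 1 := by
  have hsin : 0 < Real.sin ((β - α) / 2) := Real.sin_pos_of_pos_of_lt_pi (by linarith) (by linarith)
  rw [mem_ball_zero_iff, chordPoint_eq, norm_mul, Complex.norm_exp_ofReal_mul_I, mul_one]
  have h1 : ‖(Real.cos ((β - α) / 2) +
      ((2 * s - 1) * Real.sin ((β - α) / 2) : ℝ) * Complex.I : ℂ)‖ ^ 2 =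
      1 - 4 * (s * (1 - s)) * Real.sin ((β - α) / 2) ^ 2 := by
    rw [Complex.sq_norm, Complex.normSq_add_mul_I, Real.cos_sq']
    ring
  have h2 : 0 < s * (1 - s) := mul_pos hs.1 (by linarith [hs.2])
  by_contra! h3
  nlinarith [sq_pos_of_pos hsin, mul_pos h2 (sq_pos_of_pos hsin)]

lemma inter_regions (hαβ : α < β) (hβ : β < α + 2 * Real.pi) {z : ℂ} (h : z ∈ mainRegion α β)
    (h' : z ∈ segmentRegion α β) : z ∈ chordPoint α β '' Icc 0 1 :=
  mem_chord_of_mem_closedBall hαβ hβ h.1 (le_antisymm h.2 h'.2)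

lemma ball_cases (hαβ : α < β) (hβ : β < α + 2 * Real.pi) {z : ℂ} (hz : z ∈ Metric.ball (0 : ℂ) 1) :
    z ∈ interior (mainRegion α β) ∨ z ∈ interior (segmentRegion α β) ∨
      z ∈ chordPoint α β '' Ioo 0 1 := by
  rw [interior_mainRegion, interior_segmentRegion]
  rcases lt_trichotomy (chordHeight α β z) (Real.cos ((β - α) / 2)) with h | h | h
  · exact Or.inl ⟨hz, h⟩
  · exact Or.inr (Or.inr (mem_chord_of_mem_ball hαβ hβ hz h))
  · exact Or.inr (Or.inl ⟨hz, h⟩)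

end Regions

/-! ### The boundary of the glued disc -/

namespace GluingMaps

variable {α β : ℝ} (G : GluingMaps α β)

lemma exists_finite_contDiffAt_arc : ∃ S : Set ℝ, S.Finite ∧ ∀ s ∈ Ioo α β \ S,
    ContDiffAt ℝ ∞ (fun s : ℝ => G.φ₂ (Complex.exp (s * Complex.I))) s := by
  obtain ⟨S, hS, h⟩ := G.φ₂_arc.smooth
  exact ⟨S, hS, fun s hs => (h s hs).contDiffAt⟩

/-- On the first third of the arc, the height of `φ₂` is a reparametrization: it is injective
because `φ₂` is injective and its first coordinate is constant there. -/
lemma isReparam_left (hαβ : α < β) (hβ : β < α + 2 * Real.pi) :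
    IsReparam (fun s : ℝ => (G.φ₂ (Complex.exp (s * Complex.I))).2) α ((2 * α + β) / 3) 0 1 := by
  have hsub : Icc α ((2 * α + β) / 3) ⊆ Icc α β := Icc_subset_Icc_right (by linarith)
  obtain ⟨S, hS, h⟩ := G.exists_finite_contDiffAt_arc
  refine ⟨by linarith, ?_, fun s hs s' hs' he => ?_, fun s hs => ?_, S, hS, fun s hs => ?_⟩
  · exact continuous_snd.comp_continuousOn (G.φ₂_arc.continuousOn.mono hsub)
  · refine exp_injOn hβ (hsub hs) (hsub hs') (G.φ₂_bij.injOn (exp_mem_segmentRegion hβ (hsub hs))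
      (exp_mem_segmentRegion hβ (hsub hs')) (Prod.ext ?_ he))
    rw [G.φ₂_arc_left s hs, G.φ₂_arc_left s' hs']
  · exact (G.φ₂_bij.mapsTo (exp_mem_segmentRegion hβ (hsub hs))).2
  · exact (h s ⟨⟨hs.1.1, by linarith [hs.1.2]⟩, hs.2⟩).snd

/-- The height of `φ₂` on the last third of the arc. -/
lemma isReparam_right (hαβ : α < β) (hβ : β < α + 2 * Real.pi) :
    IsReparam (fun s : ℝ => (G.φ₂ (Complex.exp (s * Complex.I))).2) ((α + 2 * β) / 3) β 0 1 := by
  have hsub : Icc ((α + 2 * β) / 3) β ⊆ Icc α β := Icc_subset_Icc_left (by linarith)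
  obtain ⟨S, hS, h⟩ := G.exists_finite_contDiffAt_arc
  refine ⟨by linarith, ?_, fun s hs s' hs' he => ?_, fun s hs => ?_, S, hS, fun s hs => ?_⟩
  · exact continuous_snd.comp_continuousOn (G.φ₂_arc.continuousOn.mono hsub)
  · refine exp_injOn hβ (hsub hs) (hsub hs') (G.φ₂_bij.injOn (exp_mem_segmentRegion hβ (hsub hs))
      (exp_mem_segmentRegion hβ (hsub hs')) (Prod.ext ?_ he))
    rw [G.φ₂_arc_right s hs, G.φ₂_arc_right s' hs']
  · exact (G.φ₂_bij.mapsTo (exp_mem_segmentRegion hβ (hsub hs))).2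
  · exact (h s ⟨⟨by linarith [hs.1.1], hs.1.2⟩, hs.2⟩).snd

/-- The angle of `φ₂` on the middle third of the arc, where the height is constant. -/
lemma isReparam_top (hαβ : α < β) (hβ : β < α + 2 * Real.pi) :
    IsReparam (fun s : ℝ => (G.φ₂ (Complex.exp (s * Complex.I))).1)
      ((2 * α + β) / 3) ((α + 2 * β) / 3) α β := by
  have hsub : Icc ((2 * α + β) / 3) ((α + 2 * β) / 3) ⊆ Icc α β :=
    Icc_subset_Icc (by linarith) (by linarith)
  obtain ⟨S, hS, h⟩ := G.exists_finite_contDiffAt_arc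
  refine ⟨by linarith, ?_, fun s hs s' hs' he => ?_, fun s hs => ?_, S, hS, fun s hs => ?_⟩
  · exact continuous_fst.comp_continuousOn (G.φ₂_arc.continuousOn.mono hsub)
  · refine exp_injOn hβ (hsub hs) (hsub hs') (G.φ₂_bij.injOn (exp_mem_segmentRegion hβ (hsub hs))
      (exp_mem_segmentRegion hβ (hsub hs')) (Prod.ext he ?_))
    rw [G.φ₂_arc_top s hs, G.φ₂_arc_top s' hs']
  · exact (G.φ₂_bij.mapsTo (exp_mem_segmentRegion hβ (hsub hs))).1
  · exact (h s ⟨⟨by linarith [hs.1.1], by linarith [hs.1.2]⟩, hs.2⟩).fst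

lemma φ₂_exp_left : G.φ₂ (Complex.exp (α * Complex.I)) = (α, 0) := by
  rw [← chordPoint_zero (α := α) (β := β), G.φ₂_chord 0 (by simp), G.η_zero]

lemma φ₂_exp_right : G.φ₂ (Complex.exp (β * Complex.I)) = (β, 0) := by
  rw [← chordPoint_one (α := α) (β := β), G.φ₂_chord 1 (by simp), G.η_one]

end GluingMaps

/-! ### The glued disc -/

section GluedDisc

open MeasureTheory

/-- The second gluing map as a map of the plane, the rectangle being placed in `ℂ`. -/
def GluingMaps.φc {α β : ℝ} (G : GluingMaps α β) (z : ℂ) : ℂ :=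
  Complex.equivRealProdCLM.symm (G.φ₂ z)

lemma image_invFunOn {A B : Type*} [Nonempty A] {f : A → B} {U : Set A} {V N : Set B}
    (hf : BijOn f U V) (hN : N ⊆ V) : invFunOn f U '' N = U ∩ f ⁻¹' N := by
  ext z
  constructor
  · rintro ⟨y, hy, rfl⟩
    have hm : ∃ a ∈ U, f a = y := hf.surjOn (hN hy)
    exact ⟨invFunOn_mem hm, by rw [mem_preimage, invFunOn_eq hm]; exact hy⟩
  · rintro ⟨hz, hzN⟩
    exact ⟨f z, hzN, hf.injOn (invFunOn_mem ⟨z, hz, rfl⟩) hz (invFunOn_eq ⟨z, hz, rfl⟩)⟩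

/-- The vertical segment `{s} × (0, 1)` of the plane. -/
def verticalArc (s t : ℝ) : ℂ := s + t * Complex.I

lemma contDiff_verticalArc (s : ℝ) : ContDiff ℝ ∞ (verticalArc s) := by
  have h : ContDiff ℝ ∞ (fun s : ℝ => (s : ℂ)) := Complex.ofRealCLM.contDiff
  exact contDiff_const.add (h.mul contDiff_const)

variable {α β : ℝ} (G : GluingMaps α β)

namespace GluingMaps

lemma φc_re (z : ℂ) : (G.φc z).re = (G.φ₂ z).1 := rfl

lemma φc_im (z : ℂ) : (G.φc z).im = (G.φ₂ z).2 := rfl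

lemma bijOn_φc : BijOn G.φc (interior (segmentRegion α β)) (Ioo α β ×ℂ Ioo 0 1) := by
  refine ⟨fun z hz => ?_, fun z hz z' hz' h => ?_, fun w hw => ?_⟩
  · have := G.φ₂_bij_interior.mapsTo hz
    exact ⟨this.1, this.2⟩
  · exact G.φ₂_bij_interior.injOn hz hz' (Complex.equivRealProdCLM.symm.injective h)
  · obtain ⟨z, hz, h⟩ := G.φ₂_bij_interior.surjOn (show (w.re, w.im) ∈ _ from ⟨hw.1, hw.2⟩)
    refine ⟨z, hz, Complex.ext ?_ ?_⟩
    · rw [φc_re, h]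
    · rw [φc_im, h]

lemma contDiffOn_φc : ContDiffOn ℝ ∞ G.φc (interior (segmentRegion α β)) :=
  Complex.equivRealProdCLM.symm.contDiff.comp_contDiffOn G.φ₂_smooth

lemma planeJac_φc {z : ℂ} (hz : z ∈ interior (segmentRegion α β)) : planeJac G.φc z < 0 := by
  have h1 : DifferentiableAt ℝ G.φ₂ z :=
    (G.φ₂_smooth.contDiffAt (isOpen_interior.mem_nhds hz)).differentiableAt (by simp)
  have h2 : fderiv ℝ G.φc z =
      (Complex.equivRealProdCLM.symm : ℝ × ℝ →L[ℝ] ℂ).comp (fderiv ℝ G.φ₂ z) :=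
    (Complex.equivRealProdCLM.symm.hasFDerivAt.comp z h1.hasFDerivAt).fderiv
  have h3 := G.φ₂_jacobian z hz
  rw [planeJac, h2]
  exact h3

end GluingMaps

variable {n : ℕ} {X : Type*} [TopologicalSpace X]
  [ChartedSpace (EuclideanSpace ℝ (Fin (2 * n))) X]
  {M : Type*} [TopologicalSpace M] [ChartedSpace (EuclideanSpace ℝ (Fin n)) M]
  {ψ : M × Icc (0 : ℝ) 1 → X} {c : ℝ → M}

/-- The trace of the path `c` under `ψ`, as a map on a rectangle in the plane. -/
def planeTrace (ψ : M × Icc (0 : ℝ) 1 → X) (c : ℝ → M) (z : ℂ) : X :=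
  ψ (c z.re, projIcc 0 1 zero_le_one z.im)

lemma contMDiffAt_planeTrace (hψ : ContMDiff ((𝓡 n).prod (𝓡∂ 1)) (𝓡 (2 * n)) ∞ ψ) {z : ℂ}
    (hc : ContMDiffAt 𝓘(ℝ, ℝ) (𝓡 n) ∞ c z.re) (hz : z.im ∈ Ioo (0 : ℝ) 1) :
    ContMDiffAt 𝓘(ℝ, ℂ) (𝓡 (2 * n)) ∞ (planeTrace ψ c) z := by
  have h1 : ContMDiffAt 𝓘(ℝ, ℂ) 𝓘(ℝ, ℝ) ∞ Complex.re z :=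
    Complex.reCLM.contDiff.contMDiff z
  have h2 : ContMDiffAt 𝓘(ℝ, ℂ) 𝓘(ℝ, ℝ) ∞ Complex.im z :=
    Complex.imCLM.contDiff.contMDiff z
  have h3 : ContMDiffAt 𝓘(ℝ, ℝ) (𝓡∂ 1) ∞ (projIcc (0 : ℝ) 1 zero_le_one) z.im :=
    contMDiffOn_projIcc.contMDiffAt (Icc_mem_nhds hz.1 hz.2)
  exact (hψ _).comp z ((ContMDiffAt.comp z hc h1).prodMk (ContMDiffAt.comp z h3 h2))

/-- The density of the trace as a plane map: the derivatives in the directions `1` and `I` are the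
velocities of its horizontal and vertical slices. -/
lemma discDensity_planeTrace (σ : Form (𝓡 (2 * n)) X 2)
    (hψ : ContMDiff ((𝓡 n).prod (𝓡∂ 1)) (𝓡 (2 * n)) ∞ ψ) {z : ℂ}
    (hc : ContMDiffAt 𝓘(ℝ, ℝ) (𝓡 n) ∞ c z.re) (hz : z.im ∈ Ioo (0 : ℝ) 1) :
    discDensity σ (planeTrace ψ c) z = traceDensity σ ψ c (z.re, z.im) := by
  have hΨ : MDifferentiableAt 𝓘(ℝ, ℂ) (𝓡 (2 * n)) (planeTrace ψ c) z :=
    (contMDiffAt_planeTrace hψ hc hz).mdifferentiableAt (by simp)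
  have key : ∀ (w : ℂ) (γ : ℝ → X) (r : ℝ), (∀ τ, γ τ = planeTrace ψ c (z + (τ - r : ℝ) • w)) →
      (mfderiv 𝓘(ℝ, ℂ) (𝓡 (2 * n)) (planeTrace ψ c) z w : EuclideanSpace ℝ (Fin (2 * n))) =
        velocity (𝓡 (2 * n)) γ r := by
    intro w γ r hγ
    have hd : HasDerivAt (fun τ : ℝ => z + (τ - r : ℝ) • w) w r := by
      simpa using (((hasDerivAt_id r).sub_const r).smul_const w).const_add z
    have hr : z + (r - r : ℝ) • w = z := by simp
    have hΨ' : MDifferentiableAt 𝓘(ℝ, ℂ) (𝓡 (2 * n)) (planeTrace ψ c) (z + (r - r : ℝ) • w) := by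
      rw [hr]
      exact hΨ
    have h := mfderiv_comp r hΨ' hd.hasFDerivAt.hasMFDerivAt.mdifferentiableAt
    have h0 : γ = planeTrace ψ c ∘ fun τ : ℝ => z + (τ - r : ℝ) • w := funext hγ
    rw [h0]
    have h1 := congrArg (fun L : ℝ →L[ℝ] EuclideanSpace ℝ (Fin (2 * n)) => L 1) h
    refine Eq.trans ?_ h1.symm
    rw [hd.hasFDerivAt.hasMFDerivAt.mfderiv]
    have h2 : ∀ y, y = z → (mfderiv 𝓘(ℝ, ℂ) (𝓡 (2 * n)) (planeTrace ψ c) z w :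
        EuclideanSpace ℝ (Fin (2 * n))) = mfderiv 𝓘(ℝ, ℂ) (𝓡 (2 * n)) (planeTrace ψ c) y
          ((ContinuousLinearMap.toSpanSingleton ℝ w) 1) := by
      rintro _ rfl
      simp
    exact h2 _ hr
  have e1 := key 1 (fun τ => ψ (c τ, projIcc 0 1 zero_le_one z.im)) z.re
    (fun τ => by simp [planeTrace])
  have e2 := key Complex.I (fun τ => ψ (c z.re, projIcc 0 1 zero_le_one τ)) z.im
    (fun τ => by simp [planeTrace])
  have hslice : MDifferentiableAt (𝓡 n) (𝓡 (2 * n))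
      (fun q => ψ (q, projIcc 0 1 zero_le_one z.im)) (c z.re) :=
    ((hψ.comp (contMDiff_id.prodMk contMDiff_const)) (c z.re)).mdifferentiableAt (by simp)
  have e3 := congrArg (fun L : ℝ →L[ℝ] EuclideanSpace ℝ (Fin (2 * n)) => L 1)
    (mfderiv_comp z.re hslice (hc.mdifferentiableAt (by simp)))
  refine form_two_congr σ rfl (e1.trans e3) (e2.trans ?_)
  simp only [isotopyVelocity, velocity]
  rw [mfderivWithin_of_mem_nhds (Icc_mem_nhds hz.1 hz.2)]

end GluedDisc

section GluedDisc

open MeasureTheory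

variable {α β : ℝ} {G : GluingMaps α β} {n : ℕ} {X : Type*} [TopologicalSpace X]
  [ChartedSpace (EuclideanSpace ℝ (Fin (2 * n))) X]
  {M : Type*} [TopologicalSpace M] [ChartedSpace (EuclideanSpace ℝ (Fin n)) M]
  {ψ : M × Icc (0 : ℝ) 1 → X} {c : ℝ → M} {u u' : ℂ → X}

/-- `u'` is obtained from `u` by inserting the trace of the path `c` under `ψ`. -/
structure IsGluedMap (G : GluingMaps α β) (ψ : M × Icc (0 : ℝ) 1 → X) (c : ℝ → M)
    (u u' : ℂ → X) : Prop where
  on_main : ∀ z ∈ mainRegion α β, u' z = u (G.φ₁ z)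
  on_segment : ∀ z ∈ segmentRegion α β,
    u' z = ψ (c (G.φ₂ z).1, projIcc 0 1 zero_le_one (G.φ₂ z).2)

lemma IsGluedMap.eventuallyEq_main (h : IsGluedMap G ψ c u u') {z : ℂ}
    (hz : z ∈ interior (mainRegion α β)) : u' =ᶠ[𝓝 z] fun z => u (G.φ₁ z) := by
  filter_upwards [isOpen_interior.mem_nhds hz] with y hy using h.on_main y (interior_subset hy)

lemma IsGluedMap.eventuallyEq_segment (h : IsGluedMap G ψ c u u') {z : ℂ}
    (hz : z ∈ interior (segmentRegion α β)) :
    u' =ᶠ[𝓝 z] fun z => planeTrace ψ c (G.φc z) := by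
  filter_upwards [isOpen_interior.mem_nhds hz] with y hy using h.on_segment y (interior_subset hy)

lemma IsGluedMap.continuousOn (h : IsGluedMap G ψ c u u') (hψ : Continuous ψ)
    (hu : ContinuousOn u (Metric.closedBall 0 1)) (hc : ContinuousOn c (Icc α β)) :
    ContinuousOn u' (Metric.closedBall 0 1) := by
  rw [← union_regions (α := α) (β := β)]
  refine ContinuousOn.union_of_isClosed ?_ ?_ isClosed_mainRegion isClosed_segmentRegion
  · exact (hu.comp G.φ₁_cont G.φ₁_bij.mapsTo).congr h.on_main
  · refine ContinuousOn.congr ?_ h.on_segment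
    refine hψ.comp_continuousOn (ContinuousOn.prodMk ?_ ?_)
    · exact hc.comp (continuous_fst.comp_continuousOn G.φ₂_cont) fun z hz =>
        (G.φ₂_bij.mapsTo hz).1
    · exact continuous_projIcc.comp_continuousOn (continuous_snd.comp_continuousOn G.φ₂_cont)

lemma planeJac_φ₁_pos {z : ℂ} (hz : z ∈ interior (mainRegion α β)) : 0 < planeJac G.φ₁ z :=
  G.φ₁_jacobian z hz

lemma ae_sdiff_of_null {s t : Set ℂ} (hs : MeasurableSet s) (ht : volume (s ∩ t) = 0) {p : ℂ → Prop}
    (h : ∀ z ∈ s, z ∉ t → p z) : ∀ᵐ z ∂(volume.restrict s), p z := by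
  rw [ae_restrict_iff' hs]
  have h1 : ∀ᵐ z ∂(volume : Measure ℂ), z ∉ s ∩ t := measure_eq_zero_iff_ae_notMem.1 ht
  filter_upwards [h1] with z hz hzs using h z hzs fun hzt => hz ⟨hzs, hzt⟩

lemma volume_iUnion_verticalArc {S : Set ℝ} (hS : S.Finite) :
    volume (⋃ s ∈ S, verticalArc s '' Ioo 0 1) = 0 := by
  rw [measure_biUnion_null_iff hS.countable]
  exact fun s _ => volume_arc_eq_zero (contDiff_verticalArc s).contDiffOn

lemma iUnion_verticalArc {S : Set ℝ} (hSα : S ⊆ Ioo α β) :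
    ⋃ s ∈ S, verticalArc s '' Ioo 0 1 = (Ioo α β ×ℂ Ioo 0 1) ∩ Complex.re ⁻¹' S := by
  ext z
  simp only [mem_iUnion, exists_prop, mem_inter_iff, Complex.mem_reProdIm, mem_preimage]
  constructor
  · rintro ⟨s, hs, t, ht, rfl⟩
    simp only [verticalArc, Complex.add_re, Complex.ofReal_re, Complex.mul_re, Complex.I_re,
      Complex.I_im, Complex.ofReal_im, Complex.add_im, Complex.mul_im, mul_zero, mul_one,
      sub_zero, add_zero, zero_add]
    exact ⟨⟨hSα hs, ht⟩, hs⟩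
  · rintro ⟨⟨h1, h2⟩, h3⟩
    exact ⟨z.re, h3, z.im, h2, Complex.re_add_im z⟩

/-- The integral of `σ` over the trace, computed in the plane. -/
lemma integral_discDensity_planeTrace (σ : Form (𝓡 (2 * n)) X 2)
    (hψ : ContMDiff ((𝓡 n).prod (𝓡∂ 1)) (𝓡 (2 * n)) ∞ ψ)
    (hc : ∃ S : Set ℝ, S.Finite ∧ ∀ t ∈ Ioo α β \ S, ContMDiffAt 𝓘(ℝ, ℝ) (𝓡 n) ∞ c t)
    (hi : IntegrableOn (traceDensity σ ψ c) (Ioc α β ×ˢ Icc 0 1)) :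
    IntegrableOn (discDensity σ (planeTrace ψ c)) (Ioo α β ×ℂ Ioo 0 1) ∧
      ∫ z in Ioo α β ×ℂ Ioo 0 1, discDensity σ (planeTrace ψ c) z =
        ∫ p in Ioc α β ×ˢ Ioc 0 1, traceDensity σ ψ c p := by
  obtain ⟨S, hS, hsm⟩ := hc
  have hms : MeasurableSet (Ioo α β ×ℂ Ioo 0 1) :=
    (measurableSet_Ioo.preimage Complex.measurable_re).inter
      (measurableSet_Ioo.preimage Complex.measurable_im)
  have hpre : Ioo α β ×ℂ Ioo 0 1 =
      Complex.measurableEquivRealProd ⁻¹' (Ioo α β ×ˢ Ioo (0 : ℝ) 1) := rfl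
  have hnull : volume ((Ioo α β ×ℂ Ioo 0 1) ∩ Complex.re ⁻¹' (S ∩ Ioo α β)) = 0 := by
    rw [← iUnion_verticalArc inter_subset_right]
    exact volume_iUnion_verticalArc (hS.inter_of_left _)
  have hae : ∀ᵐ z ∂(volume.restrict (Ioo α β ×ℂ Ioo 0 1)), traceDensity σ ψ c
      (Complex.measurableEquivRealProd z) = discDensity σ (planeTrace ψ c) z := by
    refine ae_sdiff_of_null hms (measure_mono_null (inter_subset_inter_right _ ?_) hnull)
      (t := Complex.re ⁻¹' (S ∩ Ioo α β)) fun z hz hzS => ?_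
    · exact subset_rfl
    · exact (discDensity_planeTrace σ hψ
        (hsm z.re ⟨hz.1, fun h => hzS ⟨h, hz.1⟩⟩) hz.2).symm
  have hmp := Complex.volume_preserving_equiv_real_prod
  have hemb := Complex.measurableEquivRealProd.measurableEmbedding
  have hioo : (Ioo α β ×ˢ Ioo (0 : ℝ) 1 : Set (ℝ × ℝ)) =ᵐ[volume] Ioc α β ×ˢ Ioc (0 : ℝ) 1 :=
    Measure.set_prod_ae_eq Ioo_ae_eq_Ioc Ioo_ae_eq_Ioc
  have hi2 : IntegrableOn (traceDensity σ ψ c) (Ioo α β ×ˢ Ioo 0 1) :=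
    hi.mono_set (prod_mono Ioo_subset_Ioc_self Ioo_subset_Icc_self)
  refine ⟨?_, ?_⟩
  · have h1 := (hmp.integrableOn_comp_preimage hemb).2 hi2
    rw [← hpre] at h1
    exact Integrable.congr h1 hae
  · rw [← integral_congr_ae hae, hpre,
      hmp.setIntegral_preimage_emb hemb (fun p => traceDensity σ ψ c p)]
    exact setIntegral_congr_set hioo

variable [IsManifold (𝓡 (2 * n)) ∞ X] [IsManifold (𝓡 n) ∞ M] [T2Space M]

/-- The main region contributes the area of `u`, as `φ₁` is an orientation preserving
diffeomorphism. The exceptional set is the preimage of the singular arcs of `u`, a null set. -/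
lemma IsGluedMap.integral_main (h : IsGluedMap G ψ c u u')
    (hu : IsPiecewiseSmoothDisc (𝓡 (2 * n)) u) {σ : Form (𝓡 (2 * n)) X 2} (hσ : σ.IsSmooth) :
    IntegrableOn (discDensity σ u') (interior (mainRegion α β)) ∧
      ∫ z in interior (mainRegion α β), discDensity σ u' z = discIntegral σ u := by
  obtain ⟨N, a, ha, hab, -, hsm⟩ := hu.smooth
  have hnull : volume (⋃ i, a i '' Ioo 0 1) = 0 :=
    measure_iUnion_null fun i => volume_arc_eq_zero (ha i)
  have hJ : ∀ z ∈ interior (mainRegion α β), planeJac G.φ₁ z ≠ 0 := fun z hz =>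
    (planeJac_φ₁_pos hz).ne'
  have hsub : ⋃ i, a i '' Ioo 0 1 ⊆ Metric.ball 0 1 := iUnion_subset fun i => (hab i).image_subset
  have hnull' := volume_preimage_eq_zero isOpen_interior G.φ₁_bij_interior G.φ₁_smooth hJ hnull hsub
  have hae : ∀ᵐ z ∂(volume.restrict (interior (mainRegion α β))),
      planeJac G.φ₁ z * discDensity σ u (G.φ₁ z) = discDensity σ u' z := by
    refine ae_sdiff_of_null isOpen_interior.measurableSet hnull' fun z hz hzA => ?_
    rw [discDensity_congr σ (h.eventuallyEq_main hz)]
    refine (discDensity_comp σ ?_ ?_).symm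
    · exact (hsm _ ⟨G.φ₁_bij_interior.mapsTo hz, hzA⟩).mdifferentiableAt (by simp)
    · exact (G.φ₁_smooth.contDiffAt (isOpen_interior.mem_nhds hz)).differentiableAt (by simp)
  obtain ⟨h1, h2⟩ := integral_planeJac_smul isOpen_interior G.φ₁_bij_interior G.φ₁_smooth
    (Or.inl rfl) (fun z hz => by rw [one_mul]; exact planeJac_φ₁_pos hz) (hu.finite_area σ hσ)
  refine ⟨Integrable.congr h1 hae, ?_⟩
  rw [← integral_congr_ae hae, h2, one_mul]
  rfl

/-- The segment contributes minus the area of the trace, as `φ₂` reverses the orientation. The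
exceptional set is the preimage of the vertical segments over the singular parameters of `c`, a null
set. -/
lemma IsGluedMap.integral_segment (h : IsGluedMap G ψ c u u')
    (hψ : ContMDiff ((𝓡 n).prod (𝓡∂ 1)) (𝓡 (2 * n)) ∞ ψ)
    (hc : IsRectifiablePath (𝓡 n) c α β) {σ : Form (𝓡 (2 * n)) X 2} (hσ : σ.IsSmooth) :
    IntegrableOn (discDensity σ u') (interior (segmentRegion α β)) ∧
      ∫ z in interior (segmentRegion α β), discDensity σ u' z =
        - ∫ p in Ioc α β ×ˢ Ioc 0 1, traceDensity σ ψ c p := by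
  obtain ⟨S, hS, hsm⟩ := hc.smooth
  have hJ : ∀ z ∈ interior (segmentRegion α β), planeJac G.φc z ≠ 0 := fun z hz =>
    (G.planeJac_φc hz).ne
  have hnull : volume ((Ioo α β ×ℂ Ioo 0 1) ∩ Complex.re ⁻¹' (S ∩ Ioo α β)) = 0 := by
    rw [← iUnion_verticalArc inter_subset_right]
    exact volume_iUnion_verticalArc (hS.inter_of_left _)
  have hnull' := volume_preimage_eq_zero isOpen_interior G.bijOn_φc G.contDiffOn_φc hJ hnull
    inter_subset_left
  have hae : ∀ᵐ z ∂(volume.restrict (interior (segmentRegion α β))),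
      planeJac G.φc z * discDensity σ (planeTrace ψ c) (G.φc z) = discDensity σ u' z := by
    refine ae_sdiff_of_null isOpen_interior.measurableSet hnull' fun z hz hzA => ?_
    have hm := G.bijOn_φc.mapsTo hz
    rw [discDensity_congr σ (h.eventuallyEq_segment hz)]
    refine (discDensity_comp σ ?_ ?_).symm
    · refine (contMDiffAt_planeTrace hψ (hsm _ ⟨hm.1, fun hs => hzA ⟨hm, hs, hm.1⟩⟩)
        hm.2).mdifferentiableAt (by simp)
    · exact (G.contDiffOn_φc.contDiffAt (isOpen_interior.mem_nhds hz)).differentiableAt (by simp)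
  obtain ⟨hi, hint⟩ := integral_discDensity_planeTrace σ hψ hc.smooth
    (integrableOn_traceDensity hσ hψ hc)
  obtain ⟨h1, h2⟩ := integral_planeJac_smul isOpen_interior G.bijOn_φc G.contDiffOn_φc
    (Or.inr rfl) (fun z hz => by linarith [G.planeJac_φc hz]) hi
  refine ⟨Integrable.congr h1 hae, ?_⟩
  rw [← integral_congr_ae hae, h2, hint, neg_one_mul]

/-- The disc is, up to the null set of the chord, the union of the two open regions. -/
lemma ball_ae_eq (hαβ : α < β) (hβ : β < α + 2 * Real.pi) :
    (Metric.ball (0 : ℂ) 1) =ᵐ[volume]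
      (interior (mainRegion α β) ∪ interior (segmentRegion α β) : Set ℂ) := by
  refine ae_eq_set.2 ⟨measure_mono_null (t := chordPoint α β '' Ioo 0 1) (fun z hz => ?_)
    (volume_arc_eq_zero contDiff_chordPoint.contDiffOn), ?_⟩
  · rcases ball_cases hαβ hβ hz.1 with h | h | h
    · exact absurd (Or.inl h) hz.2
    · exact absurd (Or.inr h) hz.2
    · exact h
  · rw [sdiff_eq_empty.2, measure_empty]
    rw [interior_mainRegion, interior_segmentRegion]
    exact union_subset inter_subset_left inter_subset_left

/-- Gluing in the trace of the path `c` subtracts its area. -/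
lemma IsGluedMap.discIntegral_eq (h : IsGluedMap G ψ c u u') (hαβ : α < β)
    (hβ : β < α + 2 * Real.pi)
    (hψ : ContMDiff ((𝓡 n).prod (𝓡∂ 1)) (𝓡 (2 * n)) ∞ ψ)
    (hu : IsPiecewiseSmoothDisc (𝓡 (2 * n)) u)
    (hc : IsRectifiablePath (𝓡 n) c α β) {σ : Form (𝓡 (2 * n)) X 2} (hσ : σ.IsSmooth) :
    IntegrableOn (discDensity σ u') (Metric.ball 0 1) ∧
      discIntegral σ u' = discIntegral σ u - ∫ p in Ioc α β ×ˢ Ioc 0 1, traceDensity σ ψ c p := by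
  obtain ⟨h1, h2⟩ := h.integral_main hu hσ
  obtain ⟨h3, h4⟩ := h.integral_segment hψ hc hσ
  refine ⟨(h1.union h3).congr_set_ae (ball_ae_eq hαβ hβ), ?_⟩
  rw [discIntegral, setIntegral_congr_set (ball_ae_eq hαβ hβ),
    setIntegral_union disjoint_interior_regions isOpen_interior.measurableSet h1 h3, h2, h4,
    sub_eq_add_neg]

/-- The singular arcs of the glued map are the preimages of those of `u`, the chord, and the
preimages of the vertical segments over the singular parameters of `c`. -/
lemma IsGluedMap.exists_arcs (h : IsGluedMap G ψ c u u') (hαβ : α < β)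
    (hβ : β < α + 2 * Real.pi)
    (hψ : ContMDiff ((𝓡 n).prod (𝓡∂ 1)) (𝓡 (2 * n)) ∞ ψ)
    (hu : IsPiecewiseSmoothDisc (𝓡 (2 * n)) u) (hc : IsRectifiablePath (𝓡 n) c α β) :
    ∃ (κ : Type) (_ : Fintype κ) (a : κ → ℝ → ℂ),
      (∀ i, ContDiffOn ℝ ∞ (a i) (Ioo 0 1)) ∧
      (∀ i, MapsTo (a i) (Ioo 0 1) (Metric.ball 0 1)) ∧
      _root_.IsClosed ((⋃ i, a i '' Ioo 0 1) ∪ (Metric.ball 0 1)ᶜ) ∧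
      ∀ z ∈ Metric.ball (0 : ℂ) 1 \ ⋃ i, a i '' Ioo 0 1,
        ContMDiffAt 𝓘(ℝ, ℂ) (𝓡 (2 * n)) ∞ u' z := by
  obtain ⟨N, a, ha, hab, hcl, hsm⟩ := hu.smooth
  obtain ⟨S₀, hS₀, hcsm⟩ := hc.smooth
  set S := S₀ ∩ Ioo α β with hSdef
  have hS : S.Finite := hS₀.inter_of_left _
  have hSα : S ⊆ Ioo α β := inter_subset_right
  have : Fintype S := hS.fintype
  have hJ₁ : ∀ z ∈ interior (mainRegion α β), planeJac G.φ₁ z ≠ 0 := fun z hz =>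
    (planeJac_φ₁_pos hz).ne'
  have hJ₂ : ∀ z ∈ interior (segmentRegion α β), planeJac G.φc z ≠ 0 := fun z hz =>
    (G.planeJac_φc hz).ne
  have hsub₁ : interior (mainRegion α β) ⊆ Metric.ball 0 1 := by
    rw [interior_mainRegion]
    exact inter_subset_left
  have hsub₂ : interior (segmentRegion α β) ⊆ Metric.ball 0 1 := by
    rw [interior_segmentRegion]
    exact inter_subset_left
  have hvert : ∀ s ∈ S, MapsTo (verticalArc s) (Ioo 0 1) (Ioo α β ×ℂ Ioo 0 1) := by
    intro s hs t ht
    have h1 : verticalArc s t ∈ ⋃ s ∈ S, verticalArc s '' Ioo 0 1 :=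
      mem_biUnion hs (mem_image_of_mem _ ht)
    rw [iUnion_verticalArc hSα] at h1
    exact h1.1
  set A := ⋃ i, a i '' Ioo 0 1 with hA
  have hAball : A ⊆ Metric.ball 0 1 := iUnion_subset fun i => (hab i).image_subset
  -- The index type lists the arcs of `u`, the chord, and the singular parameters of `c`.
  set b : (Fin N ⊕ Unit) ⊕ S → ℝ → ℂ := Sum.elim
    (Sum.elim (fun i t => invFunOn G.φ₁ (interior (mainRegion α β)) (a i t))
      (fun _ => chordPoint α β))
    (fun s t => invFunOn G.φc (interior (segmentRegion α β)) (verticalArc s t)) with hb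
  have hunion : ⋃ i, b i '' Ioo 0 1 = (interior (mainRegion α β) ∩ G.φ₁ ⁻¹' A) ∪
      chordPoint α β '' Ioo 0 1 ∪ (interior (segmentRegion α β) ∩ G.φc ⁻¹'
        ((Ioo α β ×ℂ Ioo 0 1) ∩ Complex.re ⁻¹' S)) := by
    rw [← image_invFunOn G.φ₁_bij_interior hAball, ← image_invFunOn G.bijOn_φc inter_subset_left,
      ← iUnion_verticalArc hSα, hA, image_iUnion, image_iUnion₂]
    rw [iUnion_sum, iUnion_sum, iUnion_coe_set]
    simp only [hb, Sum.elim_inl, Sum.elim_inr, image_image, iUnion_const]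
  -- The complement is a disjoint union of two open sets, on which the glued map is smooth.
  have hcompl : (⋃ i, b i '' Ioo 0 1) ∪ (Metric.ball 0 1)ᶜ =
      ((interior (mainRegion α β) ∩ G.φ₁ ⁻¹' (A ∪ (Metric.ball 0 1)ᶜ)ᶜ) ∪
        (interior (segmentRegion α β) ∩ G.φc ⁻¹' (Complex.re ⁻¹' S)ᶜ))ᶜ := by
    have hch : ∀ z ∈ chordPoint α β '' Ioo 0 1, z ∉ interior (mainRegion α β) ∧
        z ∉ interior (segmentRegion α β) := by
      rintro _ ⟨s, _, rfl⟩
      rw [interior_mainRegion, interior_segmentRegion]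
      refine ⟨fun h1 => ?_, fun h1 => ?_⟩
      · exact absurd (show chordHeight α β _ < _ from h1.2) (by rw [chordHeight_chordPoint]; simp)
      · exact absurd (show _ < chordHeight α β _ from h1.2) (by rw [chordHeight_chordPoint]; simp)
    have hdis : ∀ z ∈ interior (mainRegion α β), z ∉ interior (segmentRegion α β) := fun z h1 h2 =>
      Set.disjoint_left.1 disjoint_interior_regions h1 h2
    ext z
    rw [hunion]
    by_cases hz : z ∈ Metric.ball (0 : ℂ) 1
    · have hm₁ : z ∈ interior (mainRegion α β) → G.φ₁ z ∈ Metric.ball 0 1 := fun h =>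
        G.φ₁_bij_interior.mapsTo h
      have hm₂ : z ∈ interior (segmentRegion α β) → G.φc z ∈ Ioo α β ×ℂ Ioo 0 1 := fun h =>
        G.bijOn_φc.mapsTo h
      simp only [mem_union, mem_inter_iff, mem_preimage, mem_compl_iff]
      rcases ball_cases hαβ hβ hz with hp | hq | hr
      · have hr : z ∉ chordPoint α β '' Ioo 0 1 := fun hr => (hch z hr).1 hp
        simp only [hp, hr, hdis z hp, hz, hm₁ hp, not_true_eq_false, or_false, true_and, false_and,
          not_not]
      · have hp : z ∉ interior (mainRegion α β) := fun hp => hdis z hp hq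
        have hr : z ∉ chordPoint α β '' Ioo 0 1 := fun hr => (hch z hr).2 hq
        simp only [hq, hr, hp, hz, hm₂ hq, not_true_eq_false, or_false, true_and, false_and,
          not_not, false_or]
      · simp only [hr, (hch z hr).1, (hch z hr).2, false_and, or_true, true_or, not_false_eq_true,
          or_false]
    · have h1 : z ∉ interior (mainRegion α β) := fun h => hz (hsub₁ h)
      have h2 : z ∉ interior (segmentRegion α β) := fun h => hz (hsub₂ h)
      simp only [mem_union, mem_inter_iff, mem_compl_iff, h1, h2, hz, not_false_eq_true, or_true,
        false_and, or_false]
  refine ⟨_, inferInstance, b, ?_, ?_, ?_, ?_⟩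
  · rintro ((i | _) | s) t ht
    · exact ((contDiffAt_invFunOn isOpen_interior G.φ₁_bij_interior G.φ₁_smooth hJ₁
        (hab i ht)).comp_contDiffWithinAt t (ha i t ht))
    · exact contDiff_chordPoint.contDiffOn t ht
    · exact ((contDiffAt_invFunOn isOpen_interior G.bijOn_φc G.contDiffOn_φc hJ₂
        (hvert s s.2 ht)).comp_contDiffWithinAt t (contDiff_verticalArc s).contDiffAt.contDiffWithinAt)
  · rintro ((i | _) | s) t ht
    · exact hsub₁ (invFunOn_mem (G.φ₁_bij_interior.surjOn (hab i ht)))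
    · exact chordPoint_mem_ball hαβ hβ ht
    · exact hsub₂ (invFunOn_mem (G.bijOn_φc.surjOn (hvert s s.2 ht)))
  · rw [hcompl, isClosed_compl_iff]
    refine IsOpen.union ?_ ?_
    · exact G.φ₁_smooth.continuousOn.isOpen_inter_preimage isOpen_interior hcl.isOpen_compl
    · exact G.contDiffOn_φc.continuousOn.isOpen_inter_preimage isOpen_interior
        (hS.isClosed.preimage Complex.continuous_re).isOpen_compl
  · intro z hz
    have hz' : z ∉ (⋃ i, b i '' Ioo 0 1) ∪ (Metric.ball 0 1)ᶜ := fun h1 =>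
      h1.elim hz.2 fun h2 => h2 hz.1
    rw [hcompl, notMem_compl_iff] at hz'
    rcases hz' with ⟨h1, h2⟩ | ⟨h1, h2⟩
    · refine ContMDiffAt.congr_of_eventuallyEq ?_ (h.eventuallyEq_main h1)
      refine ContMDiffAt.comp z (hsm _ ⟨G.φ₁_bij_interior.mapsTo h1, fun h3 => h2 (Or.inl h3)⟩) ?_
      exact (G.φ₁_smooth.contDiffAt (isOpen_interior.mem_nhds h1)).contMDiffAt
    · refine ContMDiffAt.congr_of_eventuallyEq ?_ (h.eventuallyEq_segment h1)
      have hm := G.bijOn_φc.mapsTo h1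
      refine ContMDiffAt.comp (g := planeTrace ψ c) z (contMDiffAt_planeTrace hψ
        (hcsm _ ⟨hm.1, fun hs => h2 ⟨hs, hm.1⟩⟩) hm.2) ?_
      exact (G.contDiffOn_φc.contDiffAt (isOpen_interior.mem_nhds h1)).contMDiffAt

/-- The glued map is a piecewise smooth disc of finite area. -/
lemma IsGluedMap.isPiecewiseSmoothDisc (h : IsGluedMap G ψ c u u') (hαβ : α < β)
    (hβ : β < α + 2 * Real.pi)
    (hψ : ContMDiff ((𝓡 n).prod (𝓡∂ 1)) (𝓡 (2 * n)) ∞ ψ)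
    (hu : IsPiecewiseSmoothDisc (𝓡 (2 * n)) u) (hc : IsRectifiablePath (𝓡 n) c α β) :
    IsPiecewiseSmoothDisc (𝓡 (2 * n)) u' where
  continuousOn := h.continuousOn hψ.continuous hu.continuousOn hc.continuousOn
  smooth := by
    obtain ⟨κ, _, a, h1, h2, h3, h4⟩ := h.exists_arcs hαβ hβ hψ hu hc
    have he : ⋃ i, a ((Fintype.equivFin κ).symm i) '' Ioo 0 1 = ⋃ i, a i '' Ioo 0 1 :=
      (Fintype.equivFin κ).symm.surjective.iUnion_comp fun i => a i '' Ioo 0 1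
    refine ⟨Fintype.card κ, fun i => a ((Fintype.equivFin κ).symm i), fun i => h1 _,
      fun i => h2 _, ?_, ?_⟩
    · rw [he]
      exact h3
    · rw [he]
      exact h4
  finite_area σ hσ := (h.discIntegral_eq hαβ hβ hψ hu hc hσ).1

end GluedDisc

/-! ### The glued polygon -/

section Lifts

variable {n : ℕ} {X : Type*} [TopologicalSpace X]
  [ChartedSpace (EuclideanSpace ℝ (Fin (2 * n))) X]
  {M : Type*} [TopologicalSpace M] [ChartedSpace (EuclideanSpace ℝ (Fin n)) M]

lemma IsLagrangianIsotopy.contMDiff [IsManifold (𝓡 (2 * n)) ∞ X] [IsManifold (𝓡 n) ∞ M]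
    {Ω : Form (𝓡 (2 * n)) X 2} {ι : M → X} {ψ : M × Icc (0 : ℝ) 1 → X}
    (hψ : IsLagrangianIsotopy Ω ι ψ) : ContMDiff ((𝓡 n).prod (𝓡∂ 1)) (𝓡 (2 * n)) ∞ ψ :=
  contMDiff_fst.comp hψ.track.isImmersion.contMDiff

/-- A lift of a smooth path through a smooth embedding is smooth. -/
lemma contMDiffOn_of_embedding [IsManifold (𝓡 (2 * n)) ∞ X] [IsManifold (𝓡 n) ∞ M] {ι : M → X}
    (hι : Manifold.IsSmoothEmbedding (𝓡 n) (𝓡 (2 * n)) ∞ ι) {f : ℝ → M} {F : Icc (0 : ℝ) 1 → X}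
    (hF : ContMDiff (𝓡∂ 1) (𝓡 (2 * n)) ∞ F) (h : ∀ t : Icc (0 : ℝ) 1, ι (f t) = F t) :
    ContMDiffOn 𝓘(ℝ, ℝ) (𝓡 n) ∞ f (Icc 0 1) := by
  have hcomp : ι ∘ (fun t : Icc (0 : ℝ) 1 => f t) = F := funext h
  have h1 : ContMDiff (𝓡∂ 1) (𝓡 n) ∞ (fun t : Icc (0 : ℝ) 1 => f t) := by
    -- A continuous map is smooth if its composition with an immersion is; continuity holds because
    -- `ι` is a topological embedding.
    refine (ContMDiff.iff_comp_isImmersion hι.isImmersion).2 ⟨?_, ?_⟩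
    · rw [hι.isEmbedding.continuous_iff, hcomp]
      exact hF.continuous
    · rw [hcomp]
      exact hF
  refine (h1.comp_contMDiffOn contMDiffOn_projIcc).congr fun t ht => ?_
  simp only [comp_apply, projIcc_of_mem zero_le_one ht]

end Lifts

section Sides

variable {n : ℕ} {X : Type*} [TopologicalSpace X]
  [ChartedSpace (EuclideanSpace ℝ (Fin (2 * n))) X]
  {M : Type*} [TopologicalSpace M] [ChartedSpace (EuclideanSpace ℝ (Fin n)) M]

/-- The boundary condition of a polygon on one of its sides. -/
structure IsSide (ι : M → X) (u : ℂ → X) (f : ℝ → M) (a b : ℝ) (p q : M) : Prop where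
  piecewiseSmooth : IsPiecewiseSmoothPath (𝓡 n) f a b
  spec : ∀ s ∈ Icc a b, ι (f s) = u (Complex.exp (s * Complex.I))
  source : f a = p
  target : f b = q

lemma IsSide.eqOn {ι : M → X} (hι : Injective ι) {u v : ℂ → X}
    (huv : EqOn u v (Metric.closedBall 0 1)) {f g : ℝ → M} {a b : ℝ} {p q p' q' : M}
    (hf : IsSide (n := n) ι u f a b p q) (hg : IsSide (n := n) ι v g a b p' q') : EqOn f g (Icc a b) := by
  intro s hs
  refine hι ?_
  rw [hf.spec s hs, hg.spec s hs]
  exact huv (by simp [Complex.norm_exp_ofReal_mul_I])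

variable {α β : ℝ} {G : GluingMaps α β} {ψ : M × Icc (0 : ℝ) 1 → X} {c : ℝ → M} {u u' : ℂ → X}

/-- The glued map agrees with `u` on the part of the circle outside the `m`-th arc. -/
lemma IsGluedMap.exp_eq_of_mem_main (h : IsGluedMap G ψ c u u') {s : ℝ}
    (hs : Complex.exp (s * Complex.I) ∈ mainRegion α β) :
    u' (Complex.exp (s * Complex.I)) = u (Complex.exp (s * Complex.I)) := by
  rw [h.on_main _ hs, G.φ₁_circle _ hs (Complex.norm_exp_ofReal_mul_I s)]

/-- The side on the moved Lagrangian. -/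
lemma IsGluedMap.isSide_mid (h : IsGluedMap G ψ c u u') (hαβ : α < β)
    (hβ : β < α + 2 * Real.pi) {ι : M → X} {p q : M} (hc : IsSide (n := n) ι u c α β p q) :
    IsSide (n := n) (fun p => ψ (p, 1)) u' (fun s : ℝ => c (G.φ₂ (Complex.exp (s * Complex.I))).1)
      ((2 * α + β) / 3) ((α + 2 * β) / 3) p q where
  piecewiseSmooth := hc.piecewiseSmooth.comp hαβ.le (G.isReparam_top hαβ hβ)
  spec s hs := by
    have h1 : Complex.exp (s * Complex.I) ∈ segmentRegion α β :=
      exp_mem_segmentRegion hβ ⟨by linarith [hs.1], by linarith [hs.2]⟩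
    rw [h.on_segment _ h1, G.φ₂_arc_top s hs, projIcc_right]
    rfl
  source := by rw [G.φ₂_corner_left, hc.source]
  target := by rw [G.φ₂_corner_right, hc.target]

variable {N : Type*} [TopologicalSpace N] [ChartedSpace (EuclideanSpace ℝ (Fin n)) N]
  [IsManifold (𝓡 n) ∞ N] {ι : N → X} {γ : ℝ → N} {f : ℝ → N}

/-- The side before the moved one is prolonged by the path of its end point. -/
def prolongAfter (G : GluingMaps α β) (f γ : ℝ → N) (s : ℝ) : N :=
  if s ≤ α then f s else γ (G.φ₂ (Complex.exp (s * Complex.I))).2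

/-- The side after the moved one is prolonged by the reversed path of its starting point. -/
def prolongBefore (G : GluingMaps α β) (γ f : ℝ → N) (s : ℝ) : N :=
  if s < β then γ (G.φ₂ (Complex.exp (s * Complex.I))).2 else f s

lemma prolongAfter_eqOn {a : ℝ} : EqOn f (prolongAfter G f γ) (Icc a α) := fun s hs => by
  rw [prolongAfter, if_pos hs.2]

lemma prolongAfter_eqOn' (h : f α = γ 0) :
    EqOn (fun s : ℝ => γ (G.φ₂ (Complex.exp (s * Complex.I))).2) (prolongAfter G f γ)
      (Icc α ((2 * α + β) / 3)) := fun s hs => by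
  rcases hs.1.eq_or_lt with rfl | h1
  · rw [prolongAfter, if_pos le_rfl, h]
    simp only [G.φ₂_exp_left]
  · rw [prolongAfter, if_neg h1.not_ge]

lemma prolongBefore_eqOn {b : ℝ} : EqOn f (prolongBefore G γ f) (Icc β b) := fun s hs => by
  rw [prolongBefore, if_neg hs.1.not_gt]

lemma prolongBefore_eqOn' (h : f β = γ 0) :
    EqOn (fun s : ℝ => γ (G.φ₂ (Complex.exp (s * Complex.I))).2) (prolongBefore G γ f)
      (Icc ((α + 2 * β) / 3) β) := fun s hs => by
  rcases hs.2.eq_or_lt with rfl | h1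
  · rw [prolongBefore, if_neg (lt_irrefl _), h]
    simp only [G.φ₂_exp_right]
  · rw [prolongBefore, if_pos h1]

/-- The prolonged side satisfies the boundary condition of `u'`: on the first third of the arc the
glued map is `t ↦ ψ (c α, t) = ι (γ t)`, reparametrized by the height of `φ₂`. -/
lemma IsGluedMap.isSide_prolongAfter (h : IsGluedMap G ψ c u u') (hαβ : α < β)
    (hβ : β < α + 2 * Real.pi) {a : ℝ} (ha : a ≤ α) (haβ : β - 2 * Real.pi ≤ a) {p q : N}
    (hf : IsSide (n := n) ι u f a α p q) (hγ : ContMDiffOn 𝓘(ℝ, ℝ) (𝓡 n) ∞ γ (Icc 0 1)) (h0 : γ 0 = q)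
    (hγψ : ∀ t : Icc (0 : ℝ) 1, ι (γ t) = ψ (c α, t)) :
    IsSide (n := n) ι u' (prolongAfter G f γ) a ((2 * α + β) / 3) p (γ 1) where
  piecewiseSmooth := by
    refine (hf.piecewiseSmooth.congr ha prolongAfter_eqOn).trans (m := α) ?_ ha (by linarith)
    refine IsPiecewiseSmoothPath.congr ?_ (by linarith) (prolongAfter_eqOn' (hf.target.trans h0.symm))
    exact (IsPiecewiseSmoothPath.of_contMDiffOn zero_lt_one hγ).comp zero_le_one
      (G.isReparam_left hαβ hβ)
  spec s hs := by
    rcases le_total s α with h1 | h1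
    · rw [← prolongAfter_eqOn ⟨hs.1, h1⟩, hf.spec s ⟨hs.1, h1⟩, h.exp_eq_of_mem_main]
      exact exp_mem_mainRegion_left hαβ ⟨by linarith [hs.1], h1⟩
    · have hseg : Complex.exp (s * Complex.I) ∈ segmentRegion α β :=
        exp_mem_segmentRegion hβ ⟨h1, by linarith [hs.2]⟩
      rw [← prolongAfter_eqOn' (hf.target.trans h0.symm) ⟨h1, hs.2⟩, h.on_segment _ hseg,
        G.φ₂_arc_left s ⟨h1, hs.2⟩, ← hγψ, projIcc_of_mem _ (G.φ₂_bij.mapsTo hseg).2]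
  source := by rw [← prolongAfter_eqOn ⟨le_rfl, ha⟩, hf.source]
  target := by
    rw [← prolongAfter_eqOn' (hf.target.trans h0.symm) ⟨by linarith, le_rfl⟩]
    simp only [G.φ₂_corner_left]

/-- The prolonged side satisfies the boundary condition of `u'`; on the last third of the arc the
height of `φ₂` decreases from `1` to `0`. -/
lemma IsGluedMap.isSide_prolongBefore (h : IsGluedMap G ψ c u u') (hαβ : α < β)
    (hβ : β < α + 2 * Real.pi) {b : ℝ} (hb : β ≤ b) (hbα : b ≤ α + 2 * Real.pi) {p q : N}
    (hf : IsSide (n := n) ι u f β b p q) (hγ : ContMDiffOn 𝓘(ℝ, ℝ) (𝓡 n) ∞ γ (Icc 0 1)) (h0 : γ 0 = p)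
    (hγψ : ∀ t : Icc (0 : ℝ) 1, ι (γ t) = ψ (c β, t)) :
    IsSide (n := n) ι u' (prolongBefore G γ f) ((α + 2 * β) / 3) b (γ 1) q where
  piecewiseSmooth := by
    refine IsPiecewiseSmoothPath.trans (m := β) ?_ (hf.piecewiseSmooth.congr hb prolongBefore_eqOn)
      (by linarith) hb
    refine IsPiecewiseSmoothPath.congr ?_ (by linarith)
      (prolongBefore_eqOn' (hf.source.trans h0.symm))
    exact (IsPiecewiseSmoothPath.of_contMDiffOn zero_lt_one hγ).comp zero_le_one
      (G.isReparam_right hαβ hβ)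
  spec s hs := by
    rcases le_total β s with h1 | h1
    · rw [← prolongBefore_eqOn ⟨h1, hs.2⟩, hf.spec s ⟨h1, hs.2⟩, h.exp_eq_of_mem_main]
      exact exp_mem_mainRegion_right hαβ ⟨h1, by linarith [hs.2]⟩
    · have hseg : Complex.exp (s * Complex.I) ∈ segmentRegion α β :=
        exp_mem_segmentRegion hβ ⟨by linarith [hs.1], h1⟩
      rw [← prolongBefore_eqOn' (hf.source.trans h0.symm) ⟨hs.1, h1⟩, h.on_segment _ hseg,
        G.φ₂_arc_right s ⟨hs.1, h1⟩, ← hγψ, projIcc_of_mem _ (G.φ₂_bij.mapsTo hseg).2]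
  source := by
    rw [← prolongBefore_eqOn' (hf.source.trans h0.symm) ⟨le_rfl, by linarith⟩]
    simp only [G.φ₂_corner_right]
  target := by rw [← prolongBefore_eqOn ⟨hb, le_rfl⟩, hf.target]

end Sides

section GluedMap

variable {X : Type*} {M : Type*}

open Classical in
/-- The map obtained from `u` by inserting the trace of the path `c` under `ψ`. -/
def gluedMap {α β : ℝ} (G : GluingMaps α β) (ψ : M × Icc (0 : ℝ) 1 → X) (c : ℝ → M) (u : ℂ → X)
    (z : ℂ) : X :=
  if z ∈ segmentRegion α β then ψ (c (G.φ₂ z).1, projIcc 0 1 zero_le_one (G.φ₂ z).2)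
  else u (G.φ₁ z)

lemma isGluedMap_gluedMap {α β : ℝ} {G : GluingMaps α β} (hαβ : α < β)
    (hβ : β < α + 2 * Real.pi) {ψ : M × Icc (0 : ℝ) 1 → X} {c : ℝ → M} {u : ℂ → X}
    (h : ∀ s ∈ Icc α β, ψ (c s, 0) = u (Complex.exp (s * Complex.I))) :
    IsGluedMap G ψ c u (gluedMap G ψ c u) where
  on_segment z hz := by rw [gluedMap, if_pos hz]
  on_main z hz := by
    -- The two formulas agree on the chord, where `φ₂ = (φ₁, 0)`.
    by_cases hz' : z ∈ segmentRegion α β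
    · obtain ⟨s, hs, rfl⟩ := inter_regions hαβ hβ hz hz'
      rw [gluedMap, if_pos hz', G.φ₂_chord s hs, G.φ₁_chord s hs, projIcc_left,
        ← h _ (G.η_bij.mapsTo hs)]
      rfl
    · rw [gluedMap, if_neg hz']

end GluedMap

section Angles

variable {k : ℕ}

/-- The angle at which the `j`-th boundary arc ends, for marked points at the angles `A`. -/
def arcEnd (A : Fin (k + 1) → ℝ) (j : Fin (k + 1)) : ℝ :=
  if j = Fin.last k then A 0 + 2 * Real.pi else A (j + 1)

lemma arcEnd_last (A : Fin (k + 1) → ℝ) : arcEnd A (Fin.last k) = A 0 + 2 * Real.pi := if_pos rfl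

lemma arcEnd_castSucc (A : Fin (k + 1) → ℝ) (j : Fin k) : arcEnd A j.castSucc = A j.succ := by
  rw [arcEnd, if_neg (Fin.castSucc_ne_last j), Fin.coeSucc_eq_succ]

variable {A : Fin (k + 1) → ℝ}

lemma lt_arcEnd (hA : StrictMono A) (hl : A (Fin.last k) < A 0 + 2 * Real.pi) (j : Fin (k + 1)) :
    A j < arcEnd A j := by
  rcases Fin.eq_castSucc_or_eq_last j with ⟨j, rfl⟩ | rfl
  · rw [arcEnd_castSucc]
    exact hA Fin.castSucc_lt_succ
  · rwa [arcEnd_last]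

lemma arcEnd_le_of_lt (hA : StrictMono A) {j j' : Fin (k + 1)} (h : j < j') :
    arcEnd A j ≤ A j' := by
  rcases Fin.eq_castSucc_or_eq_last j with ⟨j, rfl⟩ | rfl
  · rw [arcEnd_castSucc]
    exact hA.monotone (Fin.castSucc_lt_iff_succ_le.1 h)
  · exact absurd h (Fin.le_last j').not_gt

lemma le_add_two_pi (hA : StrictMono A) (hl : A (Fin.last k) < A 0 + 2 * Real.pi)
    (j j' : Fin (k + 1)) : A j < A j' + 2 * Real.pi :=
  (hA.monotone (Fin.le_last j)).trans_lt (hl.trans_le (by linarith [hA.monotone (Fin.zero_le j')]))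

lemma arcEnd_le_add_two_pi (hA : StrictMono A) (hl : A (Fin.last k) < A 0 + 2 * Real.pi)
    (j j' : Fin (k + 1)) : arcEnd A j ≤ A j' + 2 * Real.pi := by
  rcases Fin.eq_castSucc_or_eq_last j with ⟨j, rfl⟩ | rfl
  · rw [arcEnd_castSucc]
    exact (le_add_two_pi hA hl _ _).le
  · rw [arcEnd_last]
    linarith [hA.monotone (Fin.zero_le j')]

end Angles

section NewAngles

variable {k : ℕ} (A : Fin (k + 1 + 1) → ℝ) (i : Fin k)

lemma arcEnd_prev : arcEnd A i.castSucc.castSucc = A i.castSucc.succ := arcEnd_castSucc A _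

lemma arcEnd_mid : arcEnd A i.castSucc.succ = A i.succ.succ := arcEnd_castSucc A i.succ

/-- The angles of the marked points of the glued polygon. -/
def newAngle (j : Fin (k + 1 + 1)) : ℝ :=
  if j = i.castSucc.succ then (2 * A i.castSucc.succ + A i.succ.succ) / 3
  else if j = i.succ.succ then (A i.castSucc.succ + 2 * A i.succ.succ) / 3 else A j

lemma newAngle_mid : newAngle A i i.castSucc.succ = (2 * A i.castSucc.succ + A i.succ.succ) / 3 :=
  if_pos rfl

lemma newAngle_next : newAngle A i i.succ.succ = (A i.castSucc.succ + 2 * A i.succ.succ) / 3 := by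
  rw [newAngle, if_neg (next_ne i), if_pos rfl]

lemma newAngle_of_ne {j : Fin (k + 1 + 1)} (h : j ≠ i.castSucc.succ) (h' : j ≠ i.succ.succ) :
    newAngle A i j = A j := by
  rw [newAngle, if_neg h, if_neg h']

lemma arcEnd_newAngle_of_ne {j : Fin (k + 1 + 1)} (h : j ≠ i.castSucc.castSucc)
    (h' : j ≠ i.castSucc.succ) : arcEnd (newAngle A i) j = arcEnd A j := by
  rcases Fin.eq_castSucc_or_eq_last j with ⟨j, rfl⟩ | rfl
  · rw [arcEnd_castSucc, arcEnd_castSucc, newAngle_of_ne]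
    · exact fun h1 => h (congrArg Fin.castSucc (Fin.succ_injective _ h1))
    · intro h1
      rw [Fin.succ_injective _ h1] at h'
      exact h' rfl
  · rw [arcEnd_last, arcEnd_last, newAngle_of_ne A i (zero_ne_mid i) (zero_ne_next i)]

lemma mid_lt_next : i.castSucc.succ < i.succ.succ := by
  simp [Fin.lt_def]

lemma prev_lt_mid : i.castSucc.castSucc < i.castSucc.succ := by
  simp [Fin.lt_def]

variable {A}

lemma strictMono_newAngle (hA : StrictMono A) : StrictMono (newAngle A i) := by
  have h0 := hA (mid_lt_next i)
  have hlt : ∀ j, j < i.castSucc.succ → A j < A i.castSucc.succ := fun j h => hA h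
  have hgt : ∀ j, i.succ.succ < j → A i.succ.succ < A j := fun j h => hA h
  intro a b hab
  have hnm : ∀ j : Fin (k + 1 + 1), j < i.succ.succ → j ≠ i.castSucc.succ →
      j < i.castSucc.succ := by
    intro j h1 h2
    simp only [Fin.lt_def, Fin.val_succ, Fin.val_castSucc, ne_eq, Fin.ext_iff] at h1 h2 ⊢
    omega
  have hmn : ∀ j : Fin (k + 1 + 1), i.castSucc.succ < j → j ≠ i.succ.succ →
      i.succ.succ < j := by
    intro j h1 h2
    simp only [Fin.lt_def, Fin.val_succ, Fin.val_castSucc, ne_eq, Fin.ext_iff] at h1 h2 ⊢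
    omega
  unfold newAngle
  split_ifs with h1 h2 h3 h4 h5 h6 h7 h8
  · exact absurd (h1.trans h2.symm) hab.ne
  · linarith
  · linarith [hgt b (hmn b (h1 ▸ hab) h3)]
  · exact absurd (h4 ▸ h5 ▸ hab) (mid_lt_next i).not_gt
  · exact absurd (h4.trans h6.symm) hab.ne
  · linarith [hgt b (h4 ▸ hab)]
  · linarith [hlt a (h7 ▸ hab)]
  · linarith [hlt a (hnm a (h8 ▸ hab) h1)]
  · exact hA hab

lemma newAngle_last_lt (hA : StrictMono A) (hl : A (Fin.last (k + 1)) < A 0 + 2 * Real.pi) :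
    newAngle A i (Fin.last (k + 1)) < newAngle A i 0 + 2 * Real.pi := by
  have h0 := hA (mid_lt_next i)
  rw [newAngle_of_ne A i (zero_ne_mid i) (zero_ne_next i)]
  by_cases h : Fin.last (k + 1) = i.succ.succ
  · rw [h] at hl ⊢
    rw [newAngle_next]
    linarith
  · rwa [newAngle_of_ne A i (last_ne_mid i) h]

end NewAngles

section GluedPolygon

variable {n k : ℕ} {X : Type*} [TopologicalSpace X]
  [ChartedSpace (EuclideanSpace ℝ (Fin (2 * n))) X]
  {M : Fin (k + 1 + 1) → Type*} [∀ j, TopologicalSpace (M j)]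
  [∀ j, ChartedSpace (EuclideanSpace ℝ (Fin n)) (M j)]

lemma PolygonMap.isSide {k : ℕ} {M : Fin (k + 1) → Type*} [∀ j, TopologicalSpace (M j)]
    [∀ j, ChartedSpace (EuclideanSpace ℝ (Fin n)) (M j)] {ι : ∀ j, M j → X} {src tgt : ∀ j, M j}
    (P : PolygonMap (n := n) ι src tgt) (j : Fin (k + 1)) :
    IsSide (n := n) (ι j) P.toFun (P.side j) (P.angle j) (arcEnd P.angle j) (src j) (tgt j) :=
  ⟨P.side_piecewiseSmooth j, P.side_spec j, P.side_src j, P.side_tgt j⟩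

variable {ι : ∀ j, M j → X} {src tgt : ∀ j, M j} {i : Fin k}
    {ψ : M i.castSucc.succ × Icc (0 : ℝ) 1 → X}
    {γprev : ℝ → M i.castSucc.castSucc} {γnext : ℝ → M i.succ.succ}
    {P : PolygonMap (n := n) ι src tgt}
    {G : GluingMaps (P.angle i.castSucc.succ) (P.angle i.succ.succ)}

lemma PolygonMap.angle_mid_lt (P : PolygonMap (n := n) ι src tgt) (i : Fin k) :
    P.angle i.castSucc.succ < P.angle i.succ.succ := P.angle_strictMono (mid_lt_next i)

lemma PolygonMap.angle_next_lt (P : PolygonMap (n := n) ι src tgt) (i : Fin k) :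
    P.angle i.succ.succ < P.angle i.castSucc.succ + 2 * Real.pi :=
  le_add_two_pi P.angle_strictMono P.angle_last _ _

lemma PolygonMap.isSide_mid (P : PolygonMap (n := n) ι src tgt) (i : Fin k) :
    IsSide (n := n) (ι i.castSucc.succ) P.toFun (P.side i.castSucc.succ) (P.angle i.castSucc.succ)
      (P.angle i.succ.succ) (src i.castSucc.succ) (tgt i.castSucc.succ) := by
  have := P.isSide i.castSucc.succ
  rwa [arcEnd_mid] at this

lemma PolygonMap.isSide_prev (P : PolygonMap (n := n) ι src tgt) (i : Fin k) :
    IsSide (n := n) (ι i.castSucc.castSucc) P.toFun (P.side i.castSucc.castSucc)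
      (P.angle i.castSucc.castSucc) (P.angle i.castSucc.succ) (src i.castSucc.castSucc)
      (tgt i.castSucc.castSucc) := by
  have := P.isSide i.castSucc.castSucc
  rwa [arcEnd_prev] at this

/-- The sides of the glued polygon. -/
def gluedSide (P : PolygonMap (n := n) ι src tgt)
    (G : GluingMaps (P.angle i.castSucc.succ) (P.angle i.succ.succ))
    (γprev : ℝ → M i.castSucc.castSucc) (γnext : ℝ → M i.succ.succ) : ∀ j, ℝ → M j :=
  update (update (update P.side i.castSucc.castSucc
      (prolongAfter G (P.side i.castSucc.castSucc) γprev))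
    i.castSucc.succ (fun s : ℝ => P.side i.castSucc.succ (G.φ₂ (Complex.exp (s * Complex.I))).1))
    i.succ.succ (prolongBefore G γnext (P.side i.succ.succ))

lemma prev_ne_next (i : Fin k) : i.castSucc.castSucc ≠ i.succ.succ := by
  simp only [ne_eq, Fin.ext_iff, Fin.val_castSucc, Fin.val_succ]
  omega

lemma gluedSide_prev : gluedSide P G γprev γnext i.castSucc.castSucc =
    prolongAfter G (P.side i.castSucc.castSucc) γprev := by
  rw [gluedSide, update_of_ne (prev_ne_next i), update_of_ne (prev_ne i), update_self]

lemma gluedSide_mid : gluedSide P G γprev γnext i.castSucc.succ =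
    fun s : ℝ => P.side i.castSucc.succ (G.φ₂ (Complex.exp (s * Complex.I))).1 := by
  rw [gluedSide, update_of_ne (next_ne i).symm, update_self]

lemma gluedSide_next : gluedSide P G γprev γnext i.succ.succ =
    prolongBefore G γnext (P.side i.succ.succ) := by
  rw [gluedSide, update_self]

lemma gluedSide_of_ne {j : Fin (k + 1 + 1)} (h₁ : j ≠ i.castSucc.castSucc)
    (h₂ : j ≠ i.castSucc.succ) (h₃ : j ≠ i.succ.succ) :
    gluedSide P G γprev γnext j = P.side j := by
  rw [gluedSide, update_of_ne h₃, update_of_ne h₂, update_of_ne h₁]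

/-- The end point of the preceding side is the starting point of its prolongation. -/
lemma PolygonMap.prev_zero (P : PolygonMap (n := n) ι src tgt)
    (hι : Injective (ι i.castSucc.castSucc)) (hψ : ∀ p, ψ (p, 0) = ι i.castSucc.succ p)
    (hγ : ∀ t : Icc (0 : ℝ) 1, ι i.castSucc.castSucc (γprev t) = ψ (src i.castSucc.succ, t)) :
    γprev 0 = tgt i.castSucc.castSucc := by
  refine hι ((hγ 0).trans ?_)
  have h1 := P.isSide_mid i
  have h2 := P.isSide_prev i
  rw [hψ, ← h1.source, ← h2.target, h1.spec _ ⟨le_rfl, (P.angle_mid_lt i).le⟩,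
    h2.spec _ ⟨(P.angle_strictMono (prev_lt_mid i)).le, le_rfl⟩]

/-- The starting point of the following side is the starting point of its prolongation. -/
lemma PolygonMap.next_zero (P : PolygonMap (n := n) ι src tgt)
    (hι : Injective (ι i.succ.succ)) (hψ : ∀ p, ψ (p, 0) = ι i.castSucc.succ p)
    (hγ : ∀ t : Icc (0 : ℝ) 1, ι i.succ.succ (γnext t) = ψ (tgt i.castSucc.succ, t)) :
    γnext 0 = src i.succ.succ := by
  refine hι ((hγ 0).trans ?_)
  have h1 := P.isSide_mid i
  have h2 := P.isSide i.succ.succ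
  rw [hψ, ← h1.target, ← h2.source, h1.spec _ ⟨(P.angle_mid_lt i).le, le_rfl⟩,
    h2.spec _ ⟨le_rfl, (lt_arcEnd P.angle_strictMono P.angle_last _).le⟩]

variable [∀ j, IsManifold (𝓡 n) ∞ (M j)]

/-- All sides satisfy the boundary conditions of the glued map. Away from the sides `m - 1`, `m` and
`m + 1` neither the path nor the map on the circle is changed. -/
lemma isSide_gluedSide {u' : ℂ → X}
    (h : IsGluedMap G ψ (P.side i.castSucc.succ) P.toFun u')
    (hprev : ∀ t : Icc (0 : ℝ) 1, ι i.castSucc.castSucc (γprev t) = ψ (src i.castSucc.succ, t))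
    (hnext : ∀ t : Icc (0 : ℝ) 1, ι i.succ.succ (γnext t) = ψ (tgt i.castSucc.succ, t))
    (hprev0 : γprev 0 = tgt i.castSucc.castSucc) (hnext0 : γnext 0 = src i.succ.succ)
    (hsprev : ContMDiffOn 𝓘(ℝ, ℝ) (𝓡 n) ∞ γprev (Icc 0 1))
    (hsnext : ContMDiffOn 𝓘(ℝ, ℝ) (𝓡 n) ∞ γnext (Icc 0 1)) (j : Fin (k + 1 + 1)) :
    IsSide (n := n) (newIncl ι i ψ j) u' (gluedSide P G γprev γnext j)
      (newAngle P.angle i j) (arcEnd (newAngle P.angle i) j) (newSrc src i γnext j)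
      (newTgt tgt i γprev j) := by
  have hA := P.angle_strictMono
  have hl := P.angle_last
  have hαβ := P.angle_mid_lt i
  have hβ := P.angle_next_lt i
  have hmid := P.isSide_mid i
  by_cases h₂ : j = i.castSucc.succ
  · subst h₂
    rw [gluedSide_mid, newIncl, update_self, newAngle_mid, arcEnd_mid, newAngle_next, newSrc,
      update_of_ne (next_ne i).symm, newTgt, update_of_ne (prev_ne i).symm]
    exact h.isSide_mid hαβ hβ hmid
  by_cases h₁ : j = i.castSucc.castSucc
  · subst h₁
    rw [gluedSide_prev, newIncl, update_of_ne h₂, newAngle_of_ne _ _ h₂ (prev_ne_next i),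
      arcEnd_prev, newAngle_mid, newSrc, update_of_ne (prev_ne_next i), newTgt, update_self]
    refine h.isSide_prolongAfter hαβ hβ (hA (prev_lt_mid i)).le ?_ (P.isSide_prev i) hsprev hprev0 ?_
    · linarith [le_add_two_pi hA hl i.succ.succ i.castSucc.castSucc]
    · rw [hmid.source]
      exact hprev
  by_cases h₃ : j = i.succ.succ
  · subst h₃
    rw [gluedSide_next, newIncl, update_of_ne h₂, newAngle_next, arcEnd_newAngle_of_ne _ _ h₁ h₂,
      newSrc, update_self, newTgt, update_of_ne h₁]
    refine h.isSide_prolongBefore hαβ hβ (lt_arcEnd hA hl _).le (arcEnd_le_add_two_pi hA hl _ _)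
      (P.isSide _) hsnext hnext0 ?_
    rw [hmid.target]
    exact hnext
  · rw [gluedSide_of_ne h₁ h₂ h₃, newIncl, update_of_ne h₂, newAngle_of_ne _ _ h₂ h₃,
      arcEnd_newAngle_of_ne _ _ h₁ h₂, newSrc, update_of_ne h₃, newTgt, update_of_ne h₁]
    refine ⟨P.side_piecewiseSmooth j, fun s hs => ?_, P.side_src j, P.side_tgt j⟩
    rw [(P.isSide j).spec s hs, h.exp_eq_of_mem_main]
    rcases lt_or_gt_of_ne h₂ with h4 | h4
    · refine exp_mem_mainRegion_left hαβ ⟨?_, hs.2.trans (arcEnd_le_of_lt hA h4)⟩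
      linarith [le_add_two_pi hA hl i.succ.succ j, hs.1]
    · refine exp_mem_mainRegion_right hαβ ⟨le_trans (hA.monotone ?_) hs.1,
        hs.2.trans (arcEnd_le_add_two_pi hA hl _ _)⟩
      simp only [Fin.lt_def, Fin.le_def, Fin.val_succ, Fin.val_castSucc] at h4 ⊢
      omega

/-- The polygon obtained by inserting the trace of the isotopy along the `m`-th side. -/
def gluedPolygon {u' : ℂ → X} (hu' : IsPiecewiseSmoothDisc (𝓡 (2 * n)) u')
    (hside : ∀ j, IsSide (n := n) (newIncl ι i ψ j) u' (gluedSide P G γprev γnext j)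
      (newAngle P.angle i j) (arcEnd (newAngle P.angle i) j) (newSrc src i γnext j)
      (newTgt tgt i γprev j)) :
    PolygonMap (n := n) (newIncl ι i ψ) (newSrc src i γnext) (newTgt tgt i γprev) where
  angle := newAngle P.angle i
  angle_strictMono := strictMono_newAngle i P.angle_strictMono
  angle_last := newAngle_last_lt i P.angle_strictMono P.angle_last
  toFun := u'
  piecewiseSmooth := hu'
  side := gluedSide P G γprev γnext
  side_piecewiseSmooth j := (hside j).piecewiseSmooth
  side_spec j := (hside j).spec
  side_src j := (hside j).source
  side_tgt j := (hside j).target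

end GluedPolygon

/-! ### Holonomies along the sides of the glued polygon -/

namespace UnitaryLineBundle

lemma fiberCongr_fiberCongr {E H : Type*} [NormedAddCommGroup E] [NormedSpace ℝ E]
    [TopologicalSpace H] {I : ModelWithCorners ℝ E H} {M : Type*} [TopologicalSpace M]
    [ChartedSpace H M] [IsManifold I ∞ M] {V V' : UnitaryLineBundle I M} (hV : V = V') (hV' : V' = V)
    {x y : M} (hx : x = y) (hx' : y = x) (v : V.fiber x) :
    fiberCongr hV' hx' (fiberCongr hV hx v) = v := by
  subst hV hx
  rfl

lemma hol_fiberCongr {E H : Type*} [NormedAddCommGroup E] [NormedSpace ℝ E] [TopologicalSpace H]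
    {I : ModelWithCorners ℝ E H} {M : Type*} [TopologicalSpace M] [ChartedSpace H M]
    [IsManifold I ∞ M] {V V' : UnitaryLineBundle I M} (hV : V = V') {x y x' y' : M} (hx : x = x')
    (hy : y = y') (c : ℝ → M) (a b : ℝ) (v : V.fiber x) :
    V'.hol c a b x' y' (fiberCongr hV hx v) = fiberCongr hV hy (V.hol c a b x y v) := by
  subst hV hx hy
  rfl

section General

variable {E H : Type*} [NormedAddCommGroup E] [NormedSpace ℝ E] [TopologicalSpace H]
    {I : ModelWithCorners ℝ E H} {M : Type*} [TopologicalSpace M] [ChartedSpace H M]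
    [IsManifold I ∞ M] [FiniteDimensional ℝ E] [T2Space M] (V : UnitaryLineBundle I M)
    {c c' : ℝ → M} {a b : ℝ}

/-- By uniqueness, a horizontal lift computes the holonomy. -/
lemma hol_eq_of_par (h : IsRectifiablePath I c a b) {x y : M} (hx : c a = x) (hy : c b = y)
    {v : V.fiber x} {w : V.fiber y} (hw : V.Par c a b ⟨x, v⟩ ⟨y, w⟩) :
    V.hol c a b x y v = w := by
  have h1 := par_unique h (V.par_hol h hx hy v) hw
  simpa using h1

lemma hol_congr (h : IsRectifiablePath I c a b) (h' : IsRectifiablePath I c' a b)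
    (hc : EqOn c c' (Icc a b)) {x y : M} (hx : c a = x) (hy : c b = y) (v : V.fiber x) :
    V.hol c a b x y v = V.hol c' a b x y v := by
  refine (V.hol_eq_of_par h' ?_ ?_ ((V.par_hol h hx hy v).congr hc)).symm
  · rw [← hc ⟨le_rfl, h.le⟩, hx]
  · rw [← hc ⟨h.le, le_rfl⟩, hy]

end General

variable {n : ℕ} {N : Type*} [TopologicalSpace N] [ChartedSpace (EuclideanSpace ℝ (Fin n)) N]
  [IsManifold (𝓡 n) ∞ N] [T2Space N] (V : UnitaryLineBundle (𝓡 n) N)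
  {α β : ℝ} {G : GluingMaps α β} {f γ : ℝ → N} {a b : ℝ} {p q : N}

lemma exists_finite_mdifferentiableAt {c : ℝ → N} (h : IsRectifiablePath (𝓡 n) c a b) :
    ∃ S : Set ℝ, S.Finite ∧ ∀ t ∈ Ioo a b \ S, MDifferentiableAt 𝓘(ℝ, ℝ) (𝓡 n) c t := by
  obtain ⟨S, hS, h⟩ := h.smooth
  exact ⟨S, hS, fun t ht => (h t ht).mdifferentiableAt (by simp)⟩

/-- The holonomy of the prolonged side is followed by the holonomy of the prolongation. -/
lemma hol_prolongAfter (hαβ : α < β) (hβ : β < α + 2 * Real.pi)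
    (hf : IsRectifiablePath (𝓡 n) f a α) (hp : f a = p) (hq : f α = q)
    (hγ : IsRectifiablePath (𝓡 n) γ 0 1) (h0 : γ 0 = q)
    (hP : IsRectifiablePath (𝓡 n) (prolongAfter G f γ) a ((2 * α + β) / 3)) (v : V.fiber p) :
    V.hol (prolongAfter G f γ) a ((2 * α + β) / 3) p (γ 1) v =
      V.hol γ 0 1 q (γ 1) (V.hol f a α p q v) := by
  have hpa : prolongAfter G f γ a = p := by rw [← prolongAfter_eqOn ⟨le_rfl, hf.le⟩, hp]
  have hqa : prolongAfter G f γ ((2 * α + β) / 3) = γ 1 := by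
    rw [← prolongAfter_eqOn' (hq.trans h0.symm) ⟨by linarith, le_rfl⟩]
    simp only [G.φ₂_corner_left]
  obtain ⟨S, hS, hd⟩ := exists_finite_mdifferentiableAt hγ
  refine V.hol_eq_of_par hP hpa hqa (Par.trans (m := α) hf.le (by linarith)
    ((V.par_hol hf hp hq v).congr prolongAfter_eqOn) ?_)
  refine ((V.par_hol hγ h0 rfl _).comp hS hd (G.isReparam_left hαβ hβ) ?_ ?_).congr
    (prolongAfter_eqOn' (hq.trans h0.symm))
  · simp only [G.φ₂_exp_left]
  · simp only [G.φ₂_corner_left]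

/-- The prolongation is run through backwards, so its holonomy is cancelled by the holonomy of `γ`.
-/
lemma hol_prolongBefore (hαβ : α < β) (hβ : β < α + 2 * Real.pi)
    (hf : IsRectifiablePath (𝓡 n) f β b) (hp : f β = p) (hq : f b = q)
    (hγ : IsRectifiablePath (𝓡 n) γ 0 1) (h0 : γ 0 = p)
    (hP : IsRectifiablePath (𝓡 n) (prolongBefore G γ f) ((α + 2 * β) / 3) b) (v : V.fiber p) :
    V.hol (prolongBefore G γ f) ((α + 2 * β) / 3) b (γ 1) q (V.hol γ 0 1 p (γ 1) v) =
      V.hol f β b p q v := by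
  have hpa : prolongBefore G γ f ((α + 2 * β) / 3) = γ 1 := by
    rw [← prolongBefore_eqOn' (hp.trans h0.symm) ⟨le_rfl, by linarith⟩]
    simp only [G.φ₂_corner_right]
  have hqa : prolongBefore G γ f b = q := by rw [← prolongBefore_eqOn ⟨hf.le, le_rfl⟩, hq]
  obtain ⟨S, hS, hd⟩ := exists_finite_mdifferentiableAt hγ
  refine V.hol_eq_of_par hP hpa hqa (Par.trans (m := β) (by linarith) hf.le ?_
    ((V.par_hol hf hp hq v).congr prolongBefore_eqOn))
  refine ((V.par_hol hγ h0 rfl v).comp_reverse hS hd (G.isReparam_right hαβ hβ) ?_ ?_).congr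
    (prolongBefore_eqOn' (hp.trans h0.symm))
  · simp only [G.φ₂_corner_right]
  · simp only [G.φ₂_exp_right]

/-- The `m`-th side of the glued polygon is a reparametrization of the old one. -/
lemma hol_reparam (hαβ : α < β) (hβ : β < α + 2 * Real.pi)
    (hf : IsRectifiablePath (𝓡 n) f α β) (hp : f α = p) (hq : f β = q)
    (hP : IsRectifiablePath (𝓡 n) (fun s : ℝ => f (G.φ₂ (Complex.exp (s * Complex.I))).1)
      ((2 * α + β) / 3) ((α + 2 * β) / 3)) (v : V.fiber p) :
    V.hol (fun s : ℝ => f (G.φ₂ (Complex.exp (s * Complex.I))).1) ((2 * α + β) / 3)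
      ((α + 2 * β) / 3) p q v = V.hol f α β p q v := by
  obtain ⟨S, hS, hd⟩ := exists_finite_mdifferentiableAt hf
  refine V.hol_eq_of_par hP ?_ ?_
    ((V.par_hol hf hp hq v).comp hS hd (G.isReparam_top hαβ hβ) ?_ ?_)
  · simp only [G.φ₂_corner_left, hp]
  · simp only [G.φ₂_corner_right, hq]
  · simp only [G.φ₂_corner_left]
  · simp only [G.φ₂_corner_right]

end UnitaryLineBundle

section Isotopy

variable {n : ℕ} {X : Type*} [TopologicalSpace X]
  [ChartedSpace (EuclideanSpace ℝ (Fin (2 * n))) X] [IsManifold (𝓡 (2 * n)) ∞ X]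
  {M : Type*} [TopologicalSpace M] [ChartedSpace (EuclideanSpace ℝ (Fin n)) M]
  [IsManifold (𝓡 n) ∞ M] [T2Space M] {B : Form (𝓡 (2 * n)) X 2}
  {ψ : M × Icc (0 : ℝ) 1 → X} {V W : UnitaryLineBundle (𝓡 n) M} {c : ℝ → M} {a b : ℝ} {p q : M}

open UnitaryLineBundle

/-- The holonomies along a path in `M` at the times `0` and `1` of an isotopy of bundles differ by
the integral of `B` over the trace of the path. -/
lemma BundleIsotopy.hol_comm (L : BundleIsotopy B ψ V W) (hB : B.IsSmooth)
    (hψ : ContMDiff ((𝓡 n).prod (𝓡∂ 1)) (𝓡 (2 * n)) ∞ ψ) (hc : IsRectifiablePath (𝓡 n) c a b)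
    (hp : c a = p) (hq : c b = q) (v : V.fiber p) :
    W.hol c a b p q (L.hol p v) = Complex.exp (2 * Real.pi * Complex.I *
      ((∫ x in Ioc a b ×ˢ Ioc 0 1, traceDensity B ψ c x : ℝ) : ℂ)) • L.hol q (V.hol c a b p q v) := by
  subst hp hq
  obtain ⟨S, hS, hd⟩ := exists_finite_mdifferentiableAt hc
  have hvert : ∀ p : M, IsRectifiablePath ((𝓡 n).prod (𝓡∂ 1))
      (fun t : ℝ => (p, projIcc (0 : ℝ) 1 zero_le_one t)) 0 1 := fun p =>
    isRectifiablePath_vertical p le_rfl zero_le_one le_rfl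
  have hhor : ∀ t : Icc (0 : ℝ) 1, IsRectifiablePath ((𝓡 n).prod (𝓡∂ 1))
      (fun w : ℝ => (c w, t)) a b := fun t => by
    simpa only [projIcc_val] using isRectifiablePath_horizontal hc (t : ℝ)
  have hincl : ∀ (t : Icc (0 : ℝ) 1) (x : M),
      MDifferentiableAt (𝓡 n) ((𝓡 n).prod (𝓡∂ 1)) (fun p : M => (p, t)) x := fun t x =>
    ((contMDiff_id (n := ∞)).prodMk contMDiff_const x).mdifferentiableAt (by simp)
  have e0 : projIcc (0 : ℝ) 1 zero_le_one 0 = 0 := projIcc_left _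
  have e1 : projIcc (0 : ℝ) 1 zero_le_one 1 = 1 := projIcc_right _
  -- `w₀` is the vector over `(p, 0)`, `w₁` and `w₂` its transports to `(q, 0)` and on to `(q, 1)`,
  -- and `w₃` and `w₄` its transports to `(p, 1)` and on to `(q, 1)`.
  set w₀ := L.atZero.equiv (c a) v with hw₀
  set w₁ := L.bundle.hol (fun w : ℝ => (c w, (0 : Icc (0 : ℝ) 1))) a b (c a, 0) (c b, 0) w₀
  set w₂ := L.bundle.hol (fun t : ℝ => (c b, projIcc 0 1 zero_le_one t)) 0 1 (c b, 0) (c b, 1) w₁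
  set w₃ := L.bundle.hol (fun t : ℝ => (c a, projIcc 0 1 zero_le_one t)) 0 1 (c a, 0) (c a, 1) w₀
  set w₄ := L.bundle.hol (fun w : ℝ => (c w, (1 : Icc (0 : ℝ) 1))) a b (c a, 1) (c b, 1) w₃
  have h1 := L.bundle.par_hol (hhor 0) rfl rfl w₀
  have h2 := L.bundle.par_hol (hvert (c b)) (x := (c b, 0)) (y := (c b, 1)) (Prod.ext rfl e0) (Prod.ext rfl e1) w₁
  have h3 := L.bundle.par_hol (hvert (c a)) (x := (c a, 0)) (y := (c a, 1)) (Prod.ext rfl e0) (Prod.ext rfl e1) w₀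
  have h4 := L.bundle.par_hol (hhor 1) rfl rfl w₃
  have hV : V.hol c a b (c a) (c b) v = (L.atZero.equiv (c b)).symm w₁ := by
    refine V.hol_eq_of_par hc rfl rfl ?_
    have := L.atZero.par hS hc.continuousOn hd (fun t _ => hincl 0 _) rfl rfl h1
    rwa [hw₀, LinearEquiv.symm_apply_apply] at this
  have hW : W.hol c a b (c a) (c b) (L.hol (c a) v) = (L.atOne.equiv (c b)).symm w₄ := by
    refine W.hol_eq_of_par hc rfl rfl ?_
    exact L.atOne.par hS hc.continuousOn hd (fun t _ => hincl 1 _) rfl rfl h4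
  have hrect := rectangleHolonomy L.curvature hB hψ hc _ _ _ _ _
    (by rw [e0]; exact h1) h2 h3 (by rw [e1]; exact h4)
  have h5 : w₄ = Complex.exp (2 * Real.pi * Complex.I *
      ((∫ x in Ioc a b ×ˢ Ioc 0 1, traceDensity B ψ c x : ℝ) : ℂ)) • w₂ := by
    simpa [UnitaryLineBundle.scale] using hrect
  rw [hW, h5, hV, map_smul]
  congr 1
  simp only [BundleIsotopy.hol, LinearEquiv.trans_apply, LinearEquiv.apply_symm_apply]
  rfl

end Isotopy

/-! ### The weight of the glued polygon -/

section Weights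

open UnitaryLineBundle

universe w

variable {n k : ℕ} {X : Type*} [TopologicalSpace X]
  [ChartedSpace (EuclideanSpace ℝ (Fin (2 * n))) X]
  {M : Fin (k + 1 + 1) → Type*} [∀ j, TopologicalSpace (M j)]
  [∀ j, ChartedSpace (EuclideanSpace ℝ (Fin n)) (M j)] [∀ j, IsManifold (𝓡 n) ∞ (M j)]
  {V : ∀ j, UnitaryLineBundle.{w} (𝓡 n) (M j)} {src tgt : ∀ j, M j} {i : Fin k}
  {B : Form (𝓡 (2 * n)) X 2} {ψ : M i.castSucc.succ × Icc (0 : ℝ) 1 → X}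
  {W : UnitaryLineBundle.{w} (𝓡 n) (M i.castSucc.succ)}

/-- The isotopy moves the fibre at the starting corner of the `j`-th side by parallel transport. -/
def srcMove (L : BundleIsotopy B ψ (V i.castSucc.succ) W) (src : ∀ j, M j)
    (γnext : ℝ → M i.succ.succ) (j : Fin (k + 1 + 1)) :
    (V j).fiber (src j) ≃ₗ[ℂ] (newBundle V i W j).fiber (newSrc src i γnext j) :=
  if h₁ : j = i.castSucc.succ then by
    subst h₁
    exact (L.hol (src i.castSucc.succ)).trans (fiberCongr (update_self i.castSucc.succ W V).symm
      (update_of_ne (next_ne i).symm (γnext 1) src).symm)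
  else if h₂ : j = i.succ.succ then by
    subst h₂
    exact ((V i.succ.succ).hol γnext 0 1 (src i.succ.succ) (γnext 1)).trans
      (fiberCongr (update_of_ne h₁ W V).symm (update_self i.succ.succ (γnext 1) src).symm)
  else fiberCongr (update_of_ne h₁ W V).symm (update_of_ne h₂ (γnext 1) src).symm

/-- The isotopy moves the fibre at the final corner of the `j`-th side by parallel transport. -/
def tgtMove (L : BundleIsotopy B ψ (V i.castSucc.succ) W) (tgt : ∀ j, M j)
    (γprev : ℝ → M i.castSucc.castSucc) (j : Fin (k + 1 + 1)) :
    (V j).fiber (tgt j) ≃ₗ[ℂ] (newBundle V i W j).fiber (newTgt tgt i γprev j) :=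
  if h₁ : j = i.castSucc.succ then by
    subst h₁
    exact (L.hol (tgt i.castSucc.succ)).trans (fiberCongr (update_self i.castSucc.succ W V).symm
      (update_of_ne (prev_ne i).symm (γprev 1) tgt).symm)
  else if h₂ : j = i.castSucc.castSucc then by
    subst h₂
    exact ((V i.castSucc.castSucc).hol γprev 0 1 (tgt i.castSucc.castSucc) (γprev 1)).trans
      (fiberCongr (update_of_ne h₁ W V).symm
        (update_self i.castSucc.castSucc (γprev 1) tgt).symm)
  else fiberCongr (update_of_ne h₁ W V).symm (update_of_ne h₂ (γprev 1) tgt).symm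

variable {L : BundleIsotopy B ψ (V i.castSucc.succ) W} {γprev : ℝ → M i.castSucc.castSucc}
  {γnext : ℝ → M i.succ.succ}

lemma srcMove_mid : srcMove L src γnext i.castSucc.succ =
    (L.hol (src i.castSucc.succ)).trans (fiberCongr (update_self i.castSucc.succ W V).symm
      (update_of_ne (next_ne i).symm (γnext 1) src).symm) := by
  rw [srcMove, dif_pos rfl]

lemma srcMove_next : srcMove L src γnext i.succ.succ =
    ((V i.succ.succ).hol γnext 0 1 (src i.succ.succ) (γnext 1)).trans
      (fiberCongr (update_of_ne (next_ne i) W V).symm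
        (update_self i.succ.succ (γnext 1) src).symm) := by
  rw [srcMove, dif_neg (next_ne i), dif_pos rfl]

lemma srcMove_of_ne {j : Fin (k + 1 + 1)} (h₁ : j ≠ i.castSucc.succ) (h₂ : j ≠ i.succ.succ) :
    srcMove L src γnext j =
      fiberCongr (update_of_ne h₁ W V).symm (update_of_ne h₂ (γnext 1) src).symm := by
  rw [srcMove, dif_neg h₁, dif_neg h₂]

lemma tgtMove_mid : tgtMove L tgt γprev i.castSucc.succ =
    (L.hol (tgt i.castSucc.succ)).trans (fiberCongr (update_self i.castSucc.succ W V).symm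
      (update_of_ne (prev_ne i).symm (γprev 1) tgt).symm) := by
  rw [tgtMove, dif_pos rfl]

lemma tgtMove_prev : tgtMove L tgt γprev i.castSucc.castSucc =
    ((V i.castSucc.castSucc).hol γprev 0 1 (tgt i.castSucc.castSucc) (γprev 1)).trans
      (fiberCongr (update_of_ne (prev_ne i) W V).symm
        (update_self i.castSucc.castSucc (γprev 1) tgt).symm) := by
  rw [tgtMove, dif_neg (prev_ne i), dif_pos rfl]

lemma tgtMove_of_ne {j : Fin (k + 1 + 1)} (h₁ : j ≠ i.castSucc.succ)
    (h₂ : j ≠ i.castSucc.castSucc) : tgtMove L tgt γprev j =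
      fiberCongr (update_of_ne h₁ W V).symm (update_of_ne h₂ (γprev 1) tgt).symm := by
  rw [tgtMove, dif_neg h₁, dif_neg h₂]

/-- The new inputs are the conjugates of the old ones by the motions of the corners. -/
lemma newInputs_tgtMove (L : BundleIsotopy B ψ (V i.castSucc.succ) W)
    (ρ : ∀ j : Fin (k + 1),
      (V j.castSucc).fiber (tgt j.castSucc) →ₗ[ℂ] (V j.succ).fiber (src j.succ))
    (j : Fin (k + 1)) (v : (V j.castSucc).fiber (tgt j.castSucc)) :
    newInputs V L γprev γnext ρ j (tgtMove L tgt γprev j.castSucc v) =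
      srcMove L src γnext j.succ (ρ j v) := by
  by_cases h₁ : j = i.castSucc
  · subst h₁
    rw [newInputs, dif_pos rfl, tgtMove_prev, srcMove_mid]
    simp [fiberCongr_fiberCongr]
  by_cases h₂ : j = i.succ
  · subst h₂
    have h : ∀ v : (V i.castSucc.succ).fiber (tgt i.castSucc.succ),
        newInputs V L γprev γnext ρ i.succ (tgtMove L tgt γprev i.castSucc.succ v) =
          srcMove L src γnext i.succ.succ (ρ i.succ v) := by
      intro v
      rw [newInputs, dif_neg h₁, dif_pos rfl, tgtMove_mid, srcMove_next]
      simp [fiberCongr_fiberCongr]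
    exact h v
  · rw [newInputs, dif_neg h₁, dif_neg h₂, tgtMove_of_ne (castSucc_ne h₂)
      (fun h => h₁ (Fin.castSucc_injective _ h)), srcMove_of_ne
      (fun h => h₁ (Fin.succ_injective _ h)) (fun h => h₂ (Fin.succ_injective _ h))]
    simp [fiberCongr_fiberCongr]

end Weights

section GluedWeight

open UnitaryLineBundle

universe w

variable {n k : ℕ} {X : Type*} [TopologicalSpace X]
  [ChartedSpace (EuclideanSpace ℝ (Fin (2 * n))) X]
  {M : Fin (k + 1 + 1) → Type*} [∀ j, TopologicalSpace (M j)]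
  [∀ j, ChartedSpace (EuclideanSpace ℝ (Fin n)) (M j)]
  {ι : ∀ j, M j → X} {src tgt : ∀ j, M j} {i : Fin k}
  {ψ : M i.castSucc.succ × Icc (0 : ℝ) 1 → X}
  {γprev : ℝ → M i.castSucc.castSucc} {γnext : ℝ → M i.succ.succ}
  {P : PolygonMap (n := n) ι src tgt}
  {G : GluingMaps (P.angle i.castSucc.succ) (P.angle i.succ.succ)}
  {P' : PolygonMap (n := n) (newIncl ι i ψ) (newSrc src i γnext) (newTgt tgt i γprev)}

lemma IsGluing.isGluedMap (h : IsGluing P G P') :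
    IsGluedMap G ψ (P.side i.castSucc.succ) P.toFun P'.toFun :=
  ⟨h.on_main, h.on_segment⟩

lemma IsGluing.angle_eq (h : IsGluing P G P') : P'.angle = newAngle P.angle i := by
  funext j
  by_cases h₁ : j = i.castSucc.succ
  · rw [h₁, h.angle_m, newAngle_mid]
  by_cases h₂ : j = i.succ.succ
  · rw [h₂, h.angle_succ, newAngle_next]
  · rw [h.angle_other j h₁ h₂, newAngle_of_ne _ _ h₁ h₂]

variable [∀ j, IsManifold (𝓡 n) ∞ (M j)]

lemma PolygonMap.isRectifiablePath_mid (P : PolygonMap (n := n) ι src tgt) (i : Fin k) :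
    IsRectifiablePath (𝓡 n) (P.side i.castSucc.succ) (P.angle i.castSucc.succ)
      (P.angle i.succ.succ) :=
  (P.isSide_mid i).piecewiseSmooth.isRectifiablePath (P.angle_mid_lt i).le

variable [∀ j, T2Space (M j)] [IsManifold (𝓡 (2 * n)) ∞ X]
  {V : ∀ j, UnitaryLineBundle.{w} (𝓡 n) (M j)} {B : Form (𝓡 (2 * n)) X 2}
  {W : UnitaryLineBundle.{w} (𝓡 n) (M i.castSucc.succ)}

/-- The integral of the 1-form `θ_ψ` along the `m`-th side is the symplectic area of its trace. -/
lemma sideIntegral_thetaForm {Ω : Form (𝓡 (2 * n)) X 2} (hΩ : Ω.IsSmooth)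
    (hψ : ContMDiff ((𝓡 n).prod (𝓡∂ 1)) (𝓡 (2 * n)) ∞ ψ) (P : PolygonMap (n := n) ι src tgt) :
    P.sideIntegral i.castSucc.succ (thetaForm Ω ψ) =
      ∫ x in Ioc (P.angle i.castSucc.succ) (P.angle i.succ.succ) ×ˢ Ioc 0 1,
        traceDensity Ω ψ (P.side i.castSucc.succ) x := by
  have hi := (integrableOn_traceDensity hΩ hψ (P.isRectifiablePath_mid i)).mono_set
    (prod_mono subset_rfl Ioc_subset_Icc_self)
  rw [MeasureTheory.Measure.volume_eq_prod, MeasureTheory.setIntegral_prod _ hi,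
    PolygonMap.sideIntegral, show P.endAngle i.castSucc.succ = P.angle i.succ.succ from
      arcEnd_mid P.angle i, intervalIntegral.integral_of_le (P.angle_mid_lt i).le]
  refine MeasureTheory.setIntegral_congr_fun measurableSet_Ioc fun w _ => ?_
  simp only [thetaForm, traceDensity]
  rw [intervalIntegral.integral_of_le zero_le_one]

/-- The holonomy along the `j`-th side is conjugated by the motions of its end points, up to the
integral of `B` over the trace of the `m`-th side. -/
lemma IsGluing.sideHol_srcMove (h : IsGluing P G P') (hB : B.IsSmooth)
    (hψ : ContMDiff ((𝓡 n).prod (𝓡∂ 1)) (𝓡 (2 * n)) ∞ ψ)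
    (hι : ∀ j, Injective (newIncl ι i ψ j))
    (hprev : ∀ t : Icc (0 : ℝ) 1, ι i.castSucc.castSucc (γprev t) = ψ (src i.castSucc.succ, t))
    (hnext : ∀ t : Icc (0 : ℝ) 1, ι i.succ.succ (γnext t) = ψ (tgt i.castSucc.succ, t))
    (hprev0 : γprev 0 = tgt i.castSucc.castSucc) (hnext0 : γnext 0 = src i.succ.succ)
    (hsprev : ContMDiffOn 𝓘(ℝ, ℝ) (𝓡 n) ∞ γprev (Icc 0 1))
    (hsnext : ContMDiffOn 𝓘(ℝ, ℝ) (𝓡 n) ∞ γnext (Icc 0 1))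
    (L : BundleIsotopy B ψ (V i.castSucc.succ) W) (j : Fin (k + 1 + 1)) (v : (V j).fiber (src j)) :
    P'.sideHol (newBundle V i W) j (srcMove L src γnext j v) =
      (if j = i.castSucc.succ then Complex.exp (2 * Real.pi * Complex.I *
        ((∫ x in Ioc (P.angle i.castSucc.succ) (P.angle i.succ.succ) ×ˢ Ioc 0 1,
          traceDensity B ψ (P.side i.castSucc.succ) x : ℝ) : ℂ)) else 1) •
        tgtMove L tgt γprev j (P.sideHol V j v) := by
  have hA := strictMono_newAngle i P.angle_strictMono
  have hl := newAngle_last_lt i P.angle_strictMono P.angle_last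
  have hαβ := P.angle_mid_lt i
  have hβ := P.angle_next_lt i
  -- A polygon is not determined outside the disc, but on its arcs each side of `P'` is determined
  -- by the map, the inclusions being injective.
  have hs := isSide_gluedSide h.isGluedMap hprev hnext hprev0 hnext0 hsprev hsnext j
  have hs' := P'.isSide j
  rw [h.angle_eq] at hs'
  have hle := (lt_arcEnd hA hl j).le
  have hr := hs.piecewiseSmooth.isRectifiablePath hle
  have hr' := hs'.piecewiseSmooth.isRectifiablePath hle
  have hP := (P.isSide j).piecewiseSmooth.isRectifiablePath
    (lt_arcEnd P.angle_strictMono P.angle_last j).le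
  have hstart : P'.sideHol (newBundle V i W) j (srcMove L src γnext j v) =
      (newBundle V i W j).hol (gluedSide P G γprev γnext j) (newAngle P.angle i j)
        (arcEnd (newAngle P.angle i) j) (newSrc src i γnext j) (newTgt tgt i γprev j)
        (srcMove L src γnext j v) := by
    rw [← hol_congr _ hr' hr (hs'.eqOn (hι j) (eqOn_refl _ _) hs) hs'.source hs'.target, ← h.angle_eq]
    rfl
  have hend : P.sideHol V j v = (V j).hol (P.side j) (P.angle j) (arcEnd P.angle j) (src j) (tgt j) v :=
    rfl
  rw [hstart, hend]
  by_cases h₂ : j = i.castSucc.succ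
  · subst h₂
    rw [srcMove_mid, tgtMove_mid, LinearEquiv.trans_apply, LinearEquiv.trans_apply, hol_fiberCongr _ _
      (update_of_ne (prev_ne i).symm (γprev 1) tgt).symm, if_pos rfl, ← map_smul]
    congr 1
    rw [gluedSide_mid, newAngle_mid, arcEnd_mid, newAngle_next] at hr ⊢
    rw [arcEnd_mid] at hP ⊢
    rw [hol_reparam _ hαβ hβ hP (P.side_src _) (P.isSide_mid i).target hr,
      L.hol_comm hB hψ hP (P.side_src _) (P.isSide_mid i).target]
  rw [if_neg h₂, one_smul]
  by_cases h₁ : j = i.castSucc.castSucc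
  · subst h₁
    rw [srcMove_of_ne h₂ (prev_ne_next i), tgtMove_prev, LinearEquiv.trans_apply, hol_fiberCongr _ _
      (update_self i.castSucc.castSucc (γprev 1) tgt).symm]
    congr 1
    rw [gluedSide_prev, newAngle_of_ne _ _ h₂ (prev_ne_next i), arcEnd_prev, newAngle_mid] at hr ⊢
    rw [arcEnd_prev] at hP ⊢
    exact hol_prolongAfter _ hαβ hβ hP (P.side_src _) (P.isSide_prev i).target
      (IsRectifiablePath.of_contMDiffOn zero_lt_one hsprev) hprev0 hr v
  by_cases h₃ : j = i.succ.succ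
  · subst h₃
    rw [tgtMove_of_ne h₂ h₁, srcMove_next, LinearEquiv.trans_apply, hol_fiberCongr _ _
      (update_of_ne h₁ (γprev 1) tgt).symm]
    congr 1
    rw [gluedSide_next, newAngle_next, arcEnd_newAngle_of_ne _ _ h₁ h₂] at hr ⊢
    exact hol_prolongBefore _ hαβ hβ hP (P.side_src _) (P.side_tgt _)
      (IsRectifiablePath.of_contMDiffOn zero_lt_one hsnext) hnext0 hr v
  · rw [srcMove_of_ne h₂ h₃, tgtMove_of_ne h₂ h₁, hol_fiberCongr _ _
      (update_of_ne h₁ (γprev 1) tgt).symm, gluedSide_of_ne h₁ h₂ h₃, newAngle_of_ne _ _ h₂ h₃,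
      arcEnd_newAngle_of_ne _ _ h₁ h₂]

omit [∀ j, T2Space (M j)] [IsManifold (𝓡 (2 * n)) ∞ X] in
/-- If each side holonomy is conjugated by the motions of the corners up to a factor which is `1`
except on the `m`-th side, so is the composition of the holonomies and inputs. -/
lemma chain_srcMove {κ : ℂ} (L : BundleIsotopy B ψ (V i.castSucc.succ) W)
    (h : ∀ (j : Fin (k + 1 + 1)) (v : (V j).fiber (src j)),
      P'.sideHol (newBundle V i W) j (srcMove L src γnext j v) =
        (if j = i.castSucc.succ then κ else 1) • tgtMove L tgt γprev j (P.sideHol V j v))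
    (ρ : ∀ j : Fin (k + 1),
      (V j.castSucc).fiber (tgt j.castSucc) →ₗ[ℂ] (V j.succ).fiber (src j.succ))
    (j : Fin (k + 1 + 1)) (v : (V 0).fiber (src 0)) :
    P'.chain (newBundle V i W) (newInputs V L γprev γnext ρ) j (srcMove L src γnext 0 v) =
      (if i.castSucc.succ ≤ j then κ else 1) • tgtMove L tgt γprev j (P.chain V ρ j v) := by
  induction j using Fin.induction with
  | zero =>
    have h0 : ¬ i.castSucc.succ ≤ 0 := by simp
    rw [if_neg h0]
    have := h 0 v
    rw [if_neg (zero_ne_mid i)] at this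
    exact this
  | succ j ih =>
    have e1 : P'.chain (newBundle V i W) (newInputs V L γprev γnext ρ) j.succ =
        (P'.sideHol (newBundle V i W) j.succ).toLinearMap ∘ₗ newInputs V L γprev γnext ρ j ∘ₗ
          P'.chain (newBundle V i W) (newInputs V L γprev γnext ρ) j.castSucc :=
      Fin.induction_succ ..
    have e2 : P.chain V ρ j.succ =
        (P.sideHol V j.succ).toLinearMap ∘ₗ ρ j ∘ₗ P.chain V ρ j.castSucc := Fin.induction_succ ..
    rw [e1, e2]
    simp only [LinearMap.comp_apply, LinearEquiv.coe_coe]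
    rw [ih, map_smul, map_smul, newInputs_tgtMove, h, smul_smul]
    congr 1
    by_cases h1 : j.succ = i.castSucc.succ
    · have h2 : ¬ i.castSucc.succ ≤ j.castSucc := by
        rw [← h1, not_le]
        exact Fin.castSucc_lt_succ
      rw [if_pos h1, if_neg h2, if_pos h1.ge, one_mul]
    · have h2 : i.castSucc.succ ≤ j.succ ↔ i.castSucc.succ ≤ j.castSucc := by
        simp only [Fin.ext_iff, Fin.le_def, Fin.val_succ, Fin.val_castSucc] at h1 ⊢
        omega
      rw [if_neg h1, mul_one]
      simp only [h2]

end GluedWeight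

end LagPolygon

end

theorem mainTheorem2
    {n k : ℕ} {X : Type*} [TopologicalSpace X] [T2Space X] [SecondCountableTopology X]
    [ChartedSpace (EuclideanSpace ℝ (Fin (2 * n))) X] [IsManifold (𝓡 (2 * n)) ∞ X]
    (Ω : Form (𝓡 (2 * n)) X 2) (hΩ : Ω.IsSymplectic)
    {M : Fin (k + 1 + 1) → Type*} [∀ j, TopologicalSpace (M j)]
    [∀ j, ChartedSpace (EuclideanSpace ℝ (Fin n)) (M j)] [∀ j, IsManifold (𝓡 n) ∞ (M j)]
    (ι : ∀ j, M j → X) (hι : ∀ j, IsLagrangian Ω (ι j))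
    (src tgt : ∀ j, M j)
    (i : Fin k)
    (ψ : M i.castSucc.succ × Icc (0 : ℝ) 1 → X)
    (hψ : IsLagrangianIsotopy Ω (ι i.castSucc.succ) ψ)
    (γprev : ℝ → M i.castSucc.castSucc) (γnext : ℝ → M i.succ.succ)
    (hγprev : ∀ t : Icc (0 : ℝ) 1,
      ι i.castSucc.castSucc (γprev t) = ψ (src i.castSucc.succ, t))
    (hγnext : ∀ t : Icc (0 : ℝ) 1, ι i.succ.succ (γnext t) = ψ (tgt i.castSucc.succ, t))
    (P : PolygonMap (n := n) ι src tgt)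
    (G : GluingMaps (P.angle i.castSucc.succ) (P.angle i.succ.succ)) :
    (∃ P' : PolygonMap (n := n) (newIncl ι i ψ) (newSrc src i γnext) (newTgt tgt i γprev),
      IsGluing P G P') ∧
    ∃ c : ℂ,
      c = Complex.exp (2 * Real.pi * P.sideIntegral i.castSucc.succ (thetaForm Ω ψ)) ∧
      ∀ P' : PolygonMap (n := n) (newIncl ι i ψ) (newSrc src i γnext) (newTgt tgt i γprev),
        IsGluing P G P' →
        ∀ B : Form (𝓡 (2 * n)) X 2, B.IsSmooth → B.IsClosed →
        ∀ (V : ∀ j, UnitaryLineBundle (𝓡 n) (M j)),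
          (∀ j, (V j).HasCurvature (Form.pullback (𝓡 n) (ι j) B)) →
        ∀ (W : UnitaryLineBundle (𝓡 n) (M i.castSucc.succ))
          (L : BundleIsotopy B ψ (V i.castSucc.succ) W)
          (ρ : ∀ j : Fin (k + 1),
            (V j.castSucc).fiber (tgt j.castSucc) →ₗ[ℂ] (V j.succ).fiber (src j.succ)),
          P'.weight Ω B (newBundle V i W) (newInputs V L γprev γnext ρ) =
            readOutput V W γprev γnext (c • P.weight Ω B V ρ) := by
  have hT2 : ∀ j, T2Space (M j) := fun j => (hι j).embedding.isEmbedding.t2Space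
  have hψs : ContMDiff ((𝓡 n).prod (𝓡∂ 1)) (𝓡 (2 * n)) ∞ ψ := hψ.contMDiff
  have hinj : ∀ j, Injective (ι j) := fun j => (hι j).embedding.isEmbedding.injective
  have hinj' : ∀ j, Injective (newIncl ι i ψ j) := by
    intro j
    by_cases h : j = i.castSucc.succ
    · subst h
      rw [newIncl, update_self]
      exact (hψ.lagrangian 1).embedding.isEmbedding.injective
    · rw [newIncl, update_of_ne h]
      exact hinj j
  have hprev0 := P.prev_zero (hinj _) hψ.src hγprev
  have hnext0 := P.next_zero (hinj _) hψ.src hγnext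
  -- The paths of the corners are smooth, although only assumed to exist: they are lifts of smooth
  -- paths in `X` through embeddings.
  have hsprev : ContMDiffOn 𝓘(ℝ, ℝ) (𝓡 n) ∞ γprev (Icc 0 1) :=
    contMDiffOn_of_embedding (hι _).embedding
      (hψs.comp (contMDiff_const.prodMk contMDiff_id)) hγprev
  have hsnext : ContMDiffOn 𝓘(ℝ, ℝ) (𝓡 n) ∞ γnext (Icc 0 1) :=
    contMDiffOn_of_embedding (hι _).embedding
      (hψs.comp (contMDiff_const.prodMk contMDiff_id)) hγnext
  have hαβ := P.angle_mid_lt i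
  have hβ := P.angle_next_lt i
  have hc := P.isRectifiablePath_mid i
  constructor
  · have hglue : IsGluedMap G ψ (P.side i.castSucc.succ) P.toFun
        (gluedMap G ψ (P.side i.castSucc.succ) P.toFun) :=
      isGluedMap_gluedMap hαβ hβ fun s hs => by rw [hψ.src, (P.isSide_mid i).spec s hs]
    refine ⟨gluedPolygon (hglue.isPiecewiseSmoothDisc hαβ hβ hψs P.piecewiseSmooth hc)
      (isSide_gluedSide hglue hγprev hγnext hprev0 hnext0 hsprev hsnext), ?_⟩
    exact ⟨newAngle_mid _ i, newAngle_next _ i, fun j => newAngle_of_ne _ i, hglue.on_main,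
      hglue.on_segment⟩
  · refine ⟨_, rfl, fun P' hP' B hB _ V _ W L ρ => ?_⟩
    -- The transports of the inputs leave the factor `exp (2πi ∫∫ B)`, which cancels the change of
    -- the integral of `B` over the disc.
    have hchain := fun v => chain_srcMove (P := P) (P' := P') L
      (hP'.sideHol_srcMove hB hψs hinj' hγprev hγnext hprev0 hnext0 hsprev hsnext L) ρ
      (Fin.last (k + 1)) v
    have hareaB := (hP'.isGluedMap.discIntegral_eq hαβ hβ hψs P.piecewiseSmooth hc hB).2
    have hareaΩ := (hP'.isGluedMap.discIntegral_eq hαβ hβ hψs P.piecewiseSmooth hc hΩ.smooth).2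
    rw [sideIntegral_thetaForm hΩ.smooth hψs P]
    refine LinearMap.ext fun x => ?_
    -- The motion of the output corner is the identity, up to a cast.
    obtain ⟨v, rfl⟩ := (srcMove L src γnext 0).surjective x
    rw [PolygonMap.weight, PolygonMap.weight, LinearMap.smul_apply, hchain, if_pos (Fin.le_last _),
      readOutput]
    simp only [LinearMap.comp_apply, LinearMap.smul_apply, LinearEquiv.coe_coe, map_smul]
    rw [srcMove_of_ne (zero_ne_mid i) (zero_ne_next i), UnitaryLineBundle.fiberCongr_fiberCongr,
      tgtMove_of_ne (last_ne_mid i) (last_ne_prev i), smul_smul, smul_smul, ← Complex.exp_add,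
      ← Complex.exp_add, hareaB, hareaΩ]
    congr 2
    -- What remains is `2πi · i ∫∫ Ω = -2π ∫∫ Ω`.
    push_cast
    linear_combination (-2 * Real.pi * ((∫ p in Ioc (P.angle i.castSucc.succ)
      (P.angle i.succ.succ) ×ˢ Ioc 0 1, traceDensity Ω ψ (P.side i.castSucc.succ) p : ℝ) : ℂ)) *
        Complex.I_sq
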